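/- A \emph{convex body} is a compact convex subset of $\mathbb{R}^3$ with nonempty interior; it is \emph{smooth} if it has a unique supporting plane at each boundary point (equivalently, its boundary is of class $C^1$). Let $K$ be a smooth convex body with center of mass $p$ (for uniform density). The \emph{equilibrium points} of $K$ are the critical points of $\delta_K:\mathrm{bd}(K)\to\mathbb{R}$, $\delta_K(x)=\|x-p\|$. An equilibrium point is \emph{nondegenerate} if $\mathrm{bd}(K)$ is of class $C^2$ in a neighborhood of it and the Hessian of $\delta_K$ at it is nondegenerate; it is then \emph{stable} (resp. \emph{unstable}) if this Hessian is positive (resp. negative) definite. For integers $S,U\ge 1$ let $(S,U)_c$ be the family of smooth convex bodies in $\mathbb{R}^3$ that have finitely many equilibrium points, all of them nondegenerate, exactly $S$ of them stable and exactly $U$ of them unstable, and whose boundary has positive Gaussian curvature at each equilibrium point. The \emph{symmetry group} of $K$ is the group of all isometries of $\mathbb{R}^3$ that map $K$ onto itself, and $d_H$ denotes Hausdorff distance. \textbf{Proposition.} Let $S,U\ge 1$, let $K\in(S,U)_c$, and let $G$ be the symmetry group of $K$. Then for every $\varepsilon>0$ and every subgroup $H$ of $G$ there is a $K'\in(S,U)_c$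 such that $d_H(K,K')<\varepsilon$ and the symmetry group of $K'$ is exactly $H$. -/

import Mathlib

open scoped Topology

namespace Equilibria

/-- Euclidean `3`-space. -/
abbrev E3 : Type := EuclideanSpace ℝ (Fin 3)

/-- The Euclidean plane, used as the domain of local parametrizations of surfaces. -/
abbrev E2 : Type := EuclideanSpace ℝ (Fin 2)

/-- The center of mass of a (homogeneous) body. -/
noncomputable def centerOfMass (K : ConvexBody E3) : E3 :=
  ⨍ x in (K : Set E3), x

/-- `n` is an outer unit normal vector of `K` at `q`: the plane through `q` with normal vector `n`
supports `K`. -/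
def IsOuterUnitNormal (K : ConvexBody E3) (q n : E3) : Prop :=
  ‖n‖ = 1 ∧ ∀ y ∈ K, inner ℝ n (y - q) ≤ 0

/-- A convex body with nonempty interior is smooth if it has a unique supporting plane at each of
its boundary points. -/
def IsSmoothBody (K : ConvexBody E3) : Prop :=
  (interior (K : Set E3)).Nonempty ∧
    ∀ q ∈ frontier (K : Set E3), ∃! n : E3, IsOuterUnitNormal K q n

/-- The Euclidean distance from the center of mass (as a function on the whole space; it is
restricted to the boundary of `K` below). -/
noncomputable def centerDist (K : ConvexBody E3) (x : E3) : ℝ :=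
  dist x (centerOfMass K)

/-- `q` is an equilibrium point of `K`: a critical point of the restriction of the distance function
to the boundary, i.e. its differential vanishes on the tangent plane of the boundary at `q`. -/
def IsEquilibrium (K : ConvexBody E3) (q : E3) : Prop :=
  q ∈ frontier (K : Set E3) ∧
    ∃ n : E3, IsOuterUnitNormal K q n ∧
      ∀ v : E3, inner ℝ n v = 0 → fderiv ℝ (centerDist K) q v = 0

/-- `φ` is, near `0`, a regular `C²` parametrization of a neighborhood of `q` in the boundary of
`K`. -/
def IsC2Param (K : ConvexBody E3) (q : E3) (φ : E2 → E3) : Prop :=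
  φ 0 = q ∧ ContDiffAt ℝ 2 φ 0 ∧ Function.Injective (fderiv ℝ φ 0) ∧
    Filter.map φ (𝓝 0) = 𝓝[frontier (K : Set E3)] q

/-- The Hessian, at the parameter value `0`, of the distance function written in the local
coordinates `φ`. -/
noncomputable def hessian (K : ConvexBody E3) (φ : E2 → E3) (u v : E2) : ℝ :=
  fderiv ℝ (fderiv ℝ (fun w => centerDist K (φ w))) 0 u v

/-- The equilibrium point `q` is nondegenerate: the boundary is of class `C²` near `q`, and the
Hessian of the distance function at `q` is nondegenerate. -/
def IsNondegenerateAt (K : ConvexBody E3) (q : E3) : Prop :=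
  ∃ φ : E2 → E3, IsC2Param K q φ ∧ ∀ u : E2, (∀ v : E2, hessian K φ u v = 0) → u = 0

/-- A stable point: an equilibrium point with positive definite Hessian. -/
def IsStable (K : ConvexBody E3) (q : E3) : Prop :=
  IsEquilibrium K q ∧ ∃ φ : E2 → E3, IsC2Param K q φ ∧ ∀ u : E2, u ≠ 0 → 0 < hessian K φ u u

/-- An unstable point: an equilibrium point with negative definite Hessian. -/
def IsUnstable (K : ConvexBody E3) (q : E3) : Prop :=
  IsEquilibrium K q ∧ ∃ φ : E2 → E3, IsC2Param K q φ ∧ ∀ u : E2, u ≠ 0 → hessian K φ u u < 0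

/-- The matrix of the first fundamental form of `φ` at `0`. -/
noncomputable def firstForm (φ : E2 → E3) : Matrix (Fin 2) (Fin 2) ℝ :=
  Matrix.of fun i j =>
    inner ℝ (fderiv ℝ φ 0 (EuclideanSpace.single i 1)) (fderiv ℝ φ 0 (EuclideanSpace.single j 1))

/-- The matrix of the second fundamental form of `φ` at `0` with respect to the unit normal `n`. -/
noncomputable def secondForm (φ : E2 → E3) (n : E3) : Matrix (Fin 2) (Fin 2) ℝ :=
  Matrix.of fun i j =>
    inner ℝ n
      (fderiv ℝ (fderiv ℝ φ) 0 (EuclideanSpace.single i 1) (EuclideanSpace.single j 1))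

/-- The boundary of `K` is of class `C²` near `q` and has Gaussian curvature `κ` at `q`. -/
def HasGaussianCurvatureAt (K : ConvexBody E3) (q : E3) (κ : ℝ) : Prop :=
  ∃ (φ : E2 → E3) (n : E3), IsC2Param K q φ ∧ IsOuterUnitNormal K q n ∧
    κ = (secondForm φ n).det / (firstForm φ).det

/-- The class `(S,U)_c`: smooth convex bodies with finitely many equilibrium points, all of them
nondegenerate and with positive Gaussian curvature of the boundary, exactly `S` of them stable and
exactly `U` of them unstable. -/
def classC (S U : ℕ) : Set (ConvexBody E3) :=
  {K | IsSmoothBody K ∧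
    {q | IsEquilibrium K q}.Finite ∧
    (∀ q, IsEquilibrium K q →
      IsNondegenerateAt K q ∧ ∃ κ : ℝ, 0 < κ ∧ HasGaussianCurvatureAt K q κ) ∧
    {q | IsStable K q}.ncard = S ∧ {q | IsUnstable K q}.ncard = U}

/-- The symmetry group of `K`: all isometries of the space that map `K` onto itself. -/
def symmetryGroup (K : ConvexBody E3) : Subgroup (E3 ≃ᵢ E3) where
  carrier := {g | g '' (K : Set E3) = K}
  one_mem' := by
    change (fun x : E3 => x) '' (K : Set E3) = K
    exact Set.image_id' _
  mul_mem' := by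
    intro a b ha hb
    change (fun x => a (b x)) '' (K : Set E3) = K
    rw [← Set.image_image a b, Set.mem_ofPred_eq.mp hb, Set.mem_ofPred_eq.mp ha]
  inv_mem' := by
    intro a ha
    change a.symm '' (K : Set E3) = K
    conv_lhs => rw [← Set.mem_ofPred_eq.mp ha]
    rw [Set.image_image]
    simp

end Equilibria

/-! Put the center of mass at the origin and let `F` be the fourth power of the gauge of `K`. The
new body is `{F - η ≤ 1}`, where `η` is small, of class C² and supported near the `H`-orbit of one
boundary point `x₀`.

Fourth powers are used because they linearize moments. In dimension three, polar coordinates turn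
the integral over a star body of a function homogeneous of degree one into a spherical integral
against a quarter of the fourth power of the radial function (`moment_eq_integral_sphere`).
Replacing the level `1` in direction `u` by `1 + β u` therefore changes each such moment linearly in
`β` (`IsQuarticGauge.moment_perturb`). Taking `β` from an infinite-dimensional family, any finite
number of moments, the center of mass included, can be kept exactly with a nonzero choice
(`exists_polynomial_moment_eq_zero`).

The symmetry group is finite (`IsQuarticGauge.finite_gaugeSymm`). Otherwise there are nontrivial
symmetries arbitrarily near the identity; they fix all of the finitely many equilibria, in
particular the farthest point, so they are rotations about one axis. The body is then a body of
revolution with all equilibria on the axis, its radial function is strictly monotone from pole to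
pole, and its center of mass cannot be the origin. A finite group is cut out by finitely many
polynomial moments (`IsQuarticGauge.exists_momentSymm_le`), by Stone-Weierstrass, compactness and
the absence of small subgroups. Once these moments are kept, every symmetry of the new body is one
of the old body. Since `x₀` has trivial stabilizer, the translates of the bump are disjoint, and a
bump summed over `H` is preserved only by `H` (`mem_of_symmBump_invariant`).

Positive curvature at a stable point makes `F` of class C² and strongly convex nearby
(`exists_strongly_convex_ball`). Choosing `x₀` there, but not at an equilibrium, a small `η`
preserves convexity and keeps the gradient nonradial on its support. No equilibrium is created, none
is touched, and the class is inherited through germs (`mem_classC_of_germ`). -/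

namespace Equilibria

open MeasureTheory

/-! ### Convexity from local convexity and from monotone derivatives -/

section ConvexCalculus

variable {E : Type*} [NormedAddCommGroup E] [NormedSpace ℝ E]

/-- A continuous function that is convex near each point is convex. -/
theorem convexOn_univ_of_locally {f : E → ℝ} (hf : Continuous f)
    (h : ∀ x, ∃ r > 0, ConvexOn ℝ (Metric.ball x r) f) : ConvexOn ℝ Set.univ f := by
  have key : ∀ x y : E, ∀ t ∈ Set.Icc (0 : ℝ) 1,
      f (x + t • (y - x)) - ((1 - t) * f x + t * f y) ≤ 0 := by
    intro x y
    set l : ℝ → ℝ := fun t => f (x + t • (y - x)) - ((1 - t) * f x + t * f y) with hl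
    have hlc : Continuous l := by fun_prop
    obtain ⟨tm, htm, hmax⟩ := isCompact_Icc.exists_isMaxOn
      (Set.nonempty_Icc.mpr (zero_le_one' ℝ)) hlc.continuousOn
    by_contra hcon
    push Not at hcon
    obtain ⟨t', ht', hpos⟩ := hcon
    have hMpos : 0 < l tm := lt_of_lt_of_le hpos (hmax ht')
    -- At the leftmost maximizer of the excess over the chord, values just to the left are strictly
    -- smaller, which contradicts midpoint convexity on a short symmetric interval.
    have hcomp : IsCompact (Set.Icc (0 : ℝ) 1 ∩ l ⁻¹' {l tm}) :=
      isCompact_Icc.inter_right (isClosed_singleton.preimage hlc)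
    obtain ⟨t0, ⟨⟨h0, h1⟩, hlt0⟩, hleast⟩ := hcomp.exists_isLeast ⟨tm, htm, rfl⟩
    have hlt0 : l t0 = l tm := hlt0
    have hl0 : l 0 = 0 := by simp [hl]
    have hl1 : l 1 = 0 := by simp [hl]
    have h0' : 0 < t0 := lt_of_le_of_ne h0 (by rintro rfl; linarith)
    have h1' : t0 < 1 := lt_of_le_of_ne h1 (by rintro rfl; linarith)
    obtain ⟨r, hr, hconv⟩ := h (x + t0 • (y - x))
    have hev : ∀ᶠ d in 𝓝[>] (0 : ℝ), x + (t0 + d) • (y - x) ∈ Metric.ball (x + t0 • (y - x)) r ∧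
        x + (t0 - d) • (y - x) ∈ Metric.ball (x + t0 • (y - x)) r ∧ d < t0 ∧ d < 1 - t0 := by
      apply Filter.Eventually.filter_mono nhdsWithin_le_nhds
      have c1 : ContinuousAt (fun d : ℝ => x + (t0 + d) • (y - x)) 0 := by fun_prop
      have c2 : ContinuousAt (fun d : ℝ => x + (t0 - d) • (y - x)) 0 := by fun_prop
      refine (c1.eventually_mem ?_).and ((c2.eventually_mem ?_).and
        ((eventually_lt_nhds h0').and (eventually_lt_nhds (by linarith))))
      · simpa using Metric.ball_mem_nhds _ hr
      · simpa using Metric.ball_mem_nhds _ hr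
    obtain ⟨d, ⟨hb1, hb2, hd0, hd1⟩, hdpos⟩ := (hev.and self_mem_nhdsWithin).exists
    have hdpos : 0 < d := hdpos
    have hlt : l (t0 - d) < l tm := by
      refine lt_of_le_of_ne (hmax ⟨by linarith, by linarith⟩) fun he => ?_
      have := hleast ⟨⟨by linarith, by linarith⟩, he⟩
      linarith
    have hle : l (t0 + d) ≤ l tm := hmax ⟨by linarith, by linarith⟩
    have hc := hconv.2 hb1 hb2 (by norm_num : (0 : ℝ) ≤ 1 / 2) (by norm_num : (0 : ℝ) ≤ 1 / 2)
      (by norm_num)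
    have he : (1 / 2 : ℝ) • (x + (t0 + d) • (y - x)) + (1 / 2 : ℝ) • (x + (t0 - d) • (y - x))
        = x + t0 • (y - x) := by module
    rw [he] at hc
    simp only [hl, smul_eq_mul] at hlt hle hlt0 hc ⊢
    linarith
  refine ⟨convex_univ, fun x _ y _ a b ha hb hab => ?_⟩
  have := key x y b ⟨hb, by linarith⟩
  have he : x + b • (y - x) = a • x + b • y := by
    rw [show a = 1 - b by linarith]; module
  rw [he, show 1 - b = a by linarith] at this
  simpa [smul_eq_mul] using this

/-- A differentiable function with monotone derivative is convex. -/
theorem convexOn_of_fderiv_monotone {f : E → ℝ} {s : Set E} (hs : Convex ℝ s)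
    (hf : ∀ x ∈ s, DifferentiableAt ℝ f x)
    (hm : ∀ x ∈ s, ∀ y ∈ s, 0 ≤ (fderiv ℝ f y - fderiv ℝ f x) (y - x)) : ConvexOn ℝ s f := by
  refine ⟨hs, fun x hx y hy a b ha hb hab => ?_⟩
  set g : ℝ → ℝ := fun t => f (x + t • (y - x)) with hg
  have hmem : ∀ t ∈ Set.Icc (0 : ℝ) 1, x + t • (y - x) ∈ s := fun t ht =>
    hs.add_smul_sub_mem hx hy ht
  have hd : ∀ t ∈ Set.Icc (0 : ℝ) 1,
      HasDerivAt g (fderiv ℝ f (x + t • (y - x)) (y - x)) t := by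
    intro t ht
    have h1 : HasDerivAt (fun t : ℝ => x + t • (y - x)) (y - x) t := by
      simpa using ((hasDerivAt_id t).smul_const (y - x)).const_add x
    exact (hf _ (hmem t ht)).hasFDerivAt.comp_hasDerivAt t h1
  have hconv : ConvexOn ℝ (Set.Icc (0 : ℝ) 1) g := by
    apply MonotoneOn.convexOn_of_deriv (convex_Icc 0 1)
    · exact fun t ht => (hd t ht).continuousAt.continuousWithinAt
    · exact fun t ht => (hd t (interior_subset ht)).differentiableAt.differentiableWithinAt
    · intro t ht u hu htu
      have ht := interior_subset ht
      have hu := interior_subset hu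
      rw [(hd t ht).deriv, (hd u hu).deriv]
      rcases htu.eq_or_lt with rfl | htu
      · exact le_rfl
      have h := hm _ (hmem t ht) _ (hmem u hu)
      rw [show x + u • (y - x) - (x + t • (y - x)) = (u - t) • (y - x) by module, map_smul,
        smul_eq_mul] at h
      have := nonneg_of_mul_nonneg_right h (sub_pos.mpr htu)
      simpa using this
  have h := hconv.2 (show (0 : ℝ) ∈ _ by simp) (show (1 : ℝ) ∈ _ by simp) ha hb hab
  have he : x + b • (y - x) = a • x + b • y := by
    rw [show a = 1 - b by linarith]; module
  simpa [hg, he] using h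

end ConvexCalculus

/-! ### Convexity margins of C² functions -/

section InnerProduct

variable {E : Type*} [NormedAddCommGroup E] [InnerProductSpace ℝ E]

theorem hasFDerivAt_mul_norm_sq (m : ℝ) (x : E) :
    HasFDerivAt (fun x : E => m * ‖x‖ ^ 2) ((2 * m) • innerSL ℝ x) x := by
  have h := (hasStrictFDerivAt_norm_sq x).hasFDerivAt.const_mul m
  have he : m • 2 • innerSL ℝ x = (2 * m) • innerSL ℝ x := by
    ext v
    simp only [smul_apply, smul_eq_mul, nsmul_eq_mul, innerSL_apply_apply, Nat.cast_ofNat]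
    ring
  exact he ▸ h

/-- A compactly supported `C²` function becomes convex after adding a multiple of the squared
norm that is proportional to its size. -/
theorem exists_convexOn_mul_norm_sq_sub [FiniteDimensional ℝ E] {η : E → ℝ}
    (hη : ContDiff ℝ 2 η) (hc : HasCompactSupport η) :
    ∃ M : ℝ, 0 < M ∧ ∀ m s : ℝ, |s| * M ≤ m →
      ConvexOn ℝ Set.univ (fun x => m * ‖x‖ ^ 2 - s * η x) := by
  obtain ⟨C, hC⟩ := ContDiff.lipschitzWith_of_hasCompactSupport (hc.fderiv ℝ)
    (hη.fderiv_right (m := 1) (by norm_num)) (by norm_num)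
  -- `C` is a Lipschitz constant of the derivative of `η`; adding one only makes the bound positive.
  refine ⟨C + 1, by positivity, fun m s hms => ?_⟩
  have hd : ∀ x, HasFDerivAt (fun x => m * ‖x‖ ^ 2 - s * η x)
      ((2 * m) • innerSL ℝ x - s • fderiv ℝ η x) x := fun x =>
    (hasFDerivAt_mul_norm_sq m x).sub
      (((hη.differentiable (by norm_num)) x).hasFDerivAt.const_mul s)
  refine convexOn_of_fderiv_monotone convex_univ (fun x _ => (hd x).differentiableAt) ?_
  intro x _ y _
  rw [(hd x).fderiv, (hd y).fderiv]
  have h1 : |(fderiv ℝ η y - fderiv ℝ η x) (y - x)| ≤ C * ‖y - x‖ ^ 2 := by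
    have h2 := (fderiv ℝ η y - fderiv ℝ η x).le_opNorm (y - x)
    have h3 : ‖fderiv ℝ η y - fderiv ℝ η x‖ ≤ C * ‖y - x‖ := hC.norm_sub_le y x
    rw [Real.norm_eq_abs] at h2
    nlinarith [norm_nonneg (y - x)]
  have h4 : s * (fderiv ℝ η y - fderiv ℝ η x) (y - x) ≤ m * ‖y - x‖ ^ 2 := by
    calc _ ≤ |s * (fderiv ℝ η y - fderiv ℝ η x) (y - x)| := le_abs_self _
      _ = |s| * |(fderiv ℝ η y - fderiv ℝ η x) (y - x)| := abs_mul _ _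
      _ ≤ |s| * (C * ‖y - x‖ ^ 2) := by gcongr
      _ ≤ m * ‖y - x‖ ^ 2 := by
        rw [← mul_assoc]; gcongr
        nlinarith [abs_nonneg s]
  have hm0 : 0 ≤ m := le_trans (by positivity) hms
  have h5 : inner ℝ y (y - x) - inner ℝ x (y - x) = ‖y - x‖ ^ 2 := by
    rw [← inner_sub_left, real_inner_self_eq_norm_sq]
  have h6 := mul_nonneg hm0 (sq_nonneg ‖y - x‖)
  simp only [sub_apply, smul_apply, smul_eq_mul, innerSL_apply_apply] at h4 ⊢
  linear_combination h4 + h6 - 2 * m * h5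

/-- A function with positive definite second derivative at `q` is strongly convex near `q`. -/
theorem exists_ball_convexOn_sub_norm_sq {F : E → ℝ} {q : E} (hF : ContDiffAt ℝ 2 F q)
    {m : ℝ} (hm : 0 < m)
    (hpos : ∀ v, 4 * m * ‖v‖ ^ 2 ≤ fderiv ℝ (fderiv ℝ F) q v v) :
    ∃ r > 0, (∀ x ∈ Metric.ball q r, ContDiffAt ℝ 2 F x) ∧
      ConvexOn ℝ (Metric.ball q r) (fun x => F x - m * ‖x‖ ^ 2) := by
  have h1 : ContDiffAt ℝ 1 (fderiv ℝ F) q := hF.fderiv_right (m := 1) (by norm_num)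
  have h2 : HasStrictFDerivAt (fderiv ℝ F) (fderiv ℝ (fderiv ℝ F) q) q :=
    h1.hasStrictFDerivAt (by norm_num)
  -- Strict differentiability controls differences of the derivative at two arbitrary nearby points.
  -- Of the margin `4 * m`, the error costs `m` and the subtracted square costs `2 * m`.
  have h3 := (hasStrictFDerivAt_iff_isLittleO.mp h2).def hm
  have h4 : ∀ᶠ x in 𝓝 q, ContDiffAt ℝ 2 F x := hF.eventually (by simp)
  rw [nhds_prod_eq] at h3
  obtain ⟨t, ht, h3⟩ := Filter.eventually_prod_self_iff'.mp h3
  obtain ⟨r, hr, hsub⟩ := Metric.mem_nhds_iff.mp (Filter.inter_mem ht h4)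
  have hC : ∀ x ∈ Metric.ball q r, ContDiffAt ℝ 2 F x := fun x hx => (hsub hx).2
  refine ⟨r, hr, hC, ?_⟩
  have hd : ∀ x ∈ Metric.ball q r, HasFDerivAt (fun x => F x - m * ‖x‖ ^ 2)
      (fderiv ℝ F x - (2 * m) • innerSL ℝ x) x := fun x hx =>
    ((hC x hx).differentiableAt (by norm_num)).hasFDerivAt.sub (hasFDerivAt_mul_norm_sq m x)
  refine convexOn_of_fderiv_monotone (convex_ball q r) (fun x hx => (hd x hx).differentiableAt) ?_
  intro x hx y hy
  rw [(hd x hx).fderiv, (hd y hy).fderiv]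
  have h5 := h3 y (hsub hy).1 x (hsub hx).1
  have h6 := (fderiv ℝ F y - fderiv ℝ F x - fderiv ℝ (fderiv ℝ F) q (y - x)).le_opNorm (y - x)
  have h7 : inner ℝ y (y - x) - inner ℝ x (y - x) = ‖y - x‖ ^ 2 := by
    rw [← inner_sub_left, real_inner_self_eq_norm_sq]
  have h8 := hpos (y - x)
  rw [Real.norm_eq_abs] at h6
  have h9 := neg_abs_le
    ((fderiv ℝ F y - fderiv ℝ F x - fderiv ℝ (fderiv ℝ F) q (y - x)) (y - x))
  have h10 : ‖fderiv ℝ F y - fderiv ℝ F x - fderiv ℝ (fderiv ℝ F) q (y - x)‖ * ‖y - x‖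
      ≤ m * ‖y - x‖ ^ 2 := by nlinarith [norm_nonneg (y - x)]
  have h11 := mul_nonneg hm.le (sq_nonneg ‖y - x‖)
  simp only [sub_apply, smul_apply, smul_eq_mul, innerSL_apply_apply] at h9 h6 ⊢
  linear_combination h6 + h9 + h10 + h8 + h11 + 2 * m * h7

end InnerProduct

/-! ### The center of mass and its invariance -/

section CenterOfMass

theorem volume_pos_of_interior (K : ConvexBody E3) (h : (interior (K : Set E3)).Nonempty) :
    0 < volume.real (K : Set E3) := by
  refine ENNReal.toReal_pos ?_ K.isCompact.measure_lt_top.ne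
  exact ((isOpen_interior.measure_pos volume h).trans_le (measure_mono interior_subset)).ne'

theorem integrableOn_body (K : ConvexBody E3) {F : Type*} [NormedAddCommGroup F] {f : E3 → F}
    (hf : Continuous f) : IntegrableOn f (K : Set E3) :=
  hf.continuousOn.integrableOn_compact K.isCompact

theorem setIntegral_sub_eq (K : ConvexBody E3) (h : (interior (K : Set E3)).Nonempty) (p : E3) :
    ∫ x in (K : Set E3), (x - p) = volume.real (K : Set E3) • (centerOfMass K - p) := by
  rw [integral_sub (integrableOn_body K continuous_id') (integrableOn_body K continuous_const),
    centerOfMass, setAverage_eq, smul_sub, smul_smul,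
    mul_inv_cancel₀ (volume_pos_of_interior K h).ne', one_smul]
  simp

theorem setIntegral_sub_centerOfMass (K : ConvexBody E3)
    (h : (interior (K : Set E3)).Nonempty) :
    ∫ x in (K : Set E3), (x - centerOfMass K) = 0 := by
  rw [setIntegral_sub_eq K h, sub_self, smul_zero]

theorem centerOfMass_eq (K : ConvexBody E3) (h : (interior (K : Set E3)).Nonempty) {p : E3}
    (hp : ∫ x in (K : Set E3), (x - p) = 0) : centerOfMass K = p := by
  rw [setIntegral_sub_eq K h, smul_eq_zero] at hp
  exact sub_eq_zero.mp (hp.resolve_left (volume_pos_of_interior K h).ne')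

/-- Otherwise a functional separates the center from the interior; the resulting affine function is
nonnegative on the body and positive inside, yet has integral zero. -/
theorem centerOfMass_mem_interior (K : ConvexBody E3) (h : (interior (K : Set E3)).Nonempty) :
    centerOfMass K ∈ interior (K : Set E3) := by
  by_contra hp
  obtain ⟨f, hf⟩ := geometric_hahn_banach_open_point K.convex.interior isOpen_interior hp
  have h0 : ∫ x in (K : Set E3), f (centerOfMass K - x) = 0 := by
    have h1 : ∫ x in (K : Set E3), f (x - centerOfMass K) = 0 := by
      rw [f.integral_comp_comm (integrableOn_body K (by fun_prop)),
        setIntegral_sub_centerOfMass K h, map_zero]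
    rw [← neg_eq_zero, ← integral_neg, ← h1]
    simp
  have hpos : 0 < ∫ x in (K : Set E3), f (centerOfMass K - x) := by
    rw [setIntegral_pos_iff_support_of_nonneg_ae]
    · refine (isOpen_interior.measure_pos volume h).trans_le (measure_mono fun x hx => ?_)
      refine ⟨?_, interior_subset hx⟩
      have := hf x hx
      simp only [Function.mem_support, map_sub]
      linarith
    · filter_upwards [ae_restrict_mem K.isClosed.measurableSet] with x hx
      have hx' : x ∈ closure (interior (K : Set E3)) := by
        rw [K.convex.closure_interior_eq_closure_of_nonempty_interior h]
        exact subset_closure hx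
      have hcl : IsClosed {y | f y ≤ f (centerOfMass K)} :=
        isClosed_le f.continuous continuous_const
      have : f x ≤ f (centerOfMass K) :=
        closure_minimal (fun y hy => (hf y hy).le) hcl hx'
      simpa using this
    · exact integrableOn_body K (by fun_prop)
  exact hpos.ne' h0

theorem measurePreserving_isometryEquiv (g : E3 ≃ᵢ E3) :
    MeasurePreserving g volume volume := by
  have h := (measurePreserving_add_right volume (g 0)).comp
    (g.toRealLinearIsometryEquiv.measurePreserving)
  have he : (fun x => x + g 0) ∘ g.toRealLinearIsometryEquiv = g := by
    ext1 x
    simp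
  exact he ▸ h

/-- Isometries preserve volume and their linear part commutes with the integral. This reduces all
symmetries to linear isometries about the center. -/
theorem symmetry_apply_centerOfMass {K : ConvexBody E3} (h : (interior (K : Set E3)).Nonempty)
    {g : E3 ≃ᵢ E3} (hg : g ∈ symmetryGroup K) : g (centerOfMass K) = centerOfMass K := by
  have hg' : g '' (K : Set E3) = K := hg
  refine (centerOfMass_eq K h ?_).symm
  conv_lhs => rw [← hg']
  rw [(measurePreserving_isometryEquiv g).setIntegral_image_emb
    g.toHomeomorph.measurableEmbedding]
  have h1 : ∀ x, g x - g (centerOfMass K)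
      = g.toRealLinearIsometryEquiv.toContinuousLinearEquiv.toContinuousLinearMap
        (x - centerOfMass K) := by
    intro x
    rw [map_sub]
    simp
  simp_rw [h1]
  rw [ContinuousLinearMap.integral_comp_comm _ (integrableOn_body K (by fun_prop)),
    setIntegral_sub_centerOfMass K h, map_zero]

end CenterOfMass

/-! ### Isometries with a fixed point -/

section Rotations

/-- A linear isometry, conjugated to fix the point `p` instead of the origin. -/
noncomputable def isometryAbout (p : E3) : (E3 ≃ₗᵢ[ℝ] E3) →* (E3 ≃ᵢ E3) where
  toFun L := ((IsometryEquiv.subRight p).trans L.toIsometryEquiv).trans (IsometryEquiv.addRight p)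
  map_one' := by ext1 x; simp
  map_mul' L L' := by ext1 x; simp

@[simp]
theorem isometryAbout_apply (p : E3) (L : E3 ≃ₗᵢ[ℝ] E3) (x : E3) :
    isometryAbout p L x = L (x - p) + p := by
  simp [isometryAbout]

theorem exists_isometryAbout {p : E3} {g : E3 ≃ᵢ E3} (hg : g p = p) :
    ∃ L, isometryAbout p L = g := by
  refine ⟨g.toRealLinearIsometryEquiv, ?_⟩
  ext1 x
  rw [isometryAbout_apply, map_sub]
  simp [hg]

end Rotations

/-! ### Equilibria as support conditions, and their dependence on germs -/

section Equilibrium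

/-- The square of the distance has an explicit derivative, which is also twice the distance times
the derivative of the distance. -/
theorem fderiv_centerDist_eq_zero_iff (K : ConvexBody E3) {q : E3} (hq : q ≠ centerOfMass K)
    (v : E3) : fderiv ℝ (centerDist K) q v = 0 ↔ inner ℝ (q - centerOfMass K) v = 0 := by
  have hd : DifferentiableAt ℝ (centerDist K) q :=
    differentiableAt_id.dist ℝ (differentiableAt_const _) hq
  have h1 := hd.hasFDerivAt.pow 2
  have h2 : HasFDerivAt (fun x => ‖x - centerOfMass K‖ ^ 2)
      ((2 * 1 : ℝ) • innerSL ℝ (q - centerOfMass K)) q := by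
    have := (hasFDerivAt_mul_norm_sq (1 : ℝ) (q - centerOfMass K)).comp q
      ((hasFDerivAt_id q).sub_const (centerOfMass K))
    simpa [Function.comp_def] using this
  have h3 : (fun x => ‖x - centerOfMass K‖ ^ 2) = fun x => centerDist K x ^ 2 := by
    ext x; simp [centerDist, dist_eq_norm]
  rw [h3] at h2
  have h4 := congrArg (fun A => A v) (h1.unique h2)
  have h5 : centerDist K q ≠ 0 := by simpa [centerDist] using hq
  simp only [Nat.add_one_sub_one, pow_one, smul_apply, smul_eq_mul, innerSL_apply_apply,
    nsmul_eq_mul, Nat.cast_ofNat] at h4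
  constructor
  · intro h
    rw [h] at h4
    linarith
  · intro h
    rw [h] at h4
    simpa [h5] using h4

/-- An equilibrium is a boundary point at which the plane perpendicular to the segment from
the center of mass supports the body. -/
theorem isEquilibrium_iff {K : ConvexBody E3} (h : (interior (K : Set E3)).Nonempty) {q : E3} :
    IsEquilibrium K q ↔ q ∈ frontier (K : Set E3) ∧
      ∀ y ∈ K, inner ℝ (q - centerOfMass K) (y - q) ≤ 0 := by
  have hp := centerOfMass_mem_interior K h
  refine and_congr_right fun hq => ?_
  have hqp : q ≠ centerOfMass K := by
    rintro rfl
    exact hq.2 hp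
  simp_rw [fderiv_centerDist_eq_zero_iff K hqp]
  set x := q - centerOfMass K with hx
  constructor
  · rintro ⟨n, ⟨hn, hK⟩, hv⟩ y hy
    -- The component of `x` orthogonal to `n` is a tangent vector. It is orthogonal to `n` and, by
    -- criticality, to `x`, hence to itself. So `x` is a multiple of `n`, nonnegative because the
    -- center lies in the body.
    have h1 : inner ℝ n (x - inner ℝ n x • n) = 0 := by
      rw [inner_sub_right, inner_smul_right, real_inner_self_eq_norm_sq, hn]; ring
    have h2 := hv _ h1
    have h3 : x - (inner ℝ n x : ℝ) • n = 0 := by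
      rw [← inner_self_eq_zero (𝕜 := ℝ)]
      conv_lhs => rw [inner_sub_left, inner_smul_left, h1, h2]
      simp
    have h4 := hK _ (interior_subset hp)
    rw [← neg_sub, inner_neg_right, ← hx] at h4
    rw [sub_eq_zero.mp h3, inner_smul_left]
    exact mul_nonpos_of_nonneg_of_nonpos (by simpa using h4) (hK y hy)
  · intro hy
    have hx0 : x ≠ 0 := sub_ne_zero.mpr hqp
    refine ⟨‖x‖⁻¹ • x, ⟨norm_smul_inv_norm hx0, fun y hyK => ?_⟩, fun v hv => ?_⟩
    · rw [inner_smul_left]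
      exact mul_nonpos_of_nonneg_of_nonpos (by simp) (hy y hyK)
    · rw [inner_smul_left] at hv
      simpa [hx0] using hv

/-- Two convex bodies with the same germ at `q` have the same supporting half-spaces there. -/
theorem support_of_germ {K K' : ConvexBody E3} {q : E3} (hq : q ∈ K')
    (h : ∀ᶠ y in 𝓝 q, y ∈ K ↔ y ∈ K') {n : E3} (hn : ∀ y ∈ K, inner ℝ n (y - q) ≤ 0) :
    ∀ y ∈ K', inner ℝ n (y - q) ≤ 0 := by
  intro y hy
  -- A small step from `q` towards `y` stays in `K'` by convexity and lands where the two bodies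
  -- agree; the inequality scales with the step.
  have hc : ContinuousAt (fun t : ℝ => q + t • (y - q)) 0 := by fun_prop
  have h1 : ∀ᶠ t in 𝓝[>] (0 : ℝ), (q + t • (y - q) ∈ K ↔ q + t • (y - q) ∈ K') ∧ t < 1 := by
    apply Filter.Eventually.filter_mono nhdsWithin_le_nhds
    refine (hc.eventually (p := fun z => z ∈ K ↔ z ∈ K') ?_).and (eventually_lt_nhds one_pos)
    simpa using h
  obtain ⟨t, ⟨ht, ht1⟩, ht0⟩ := (h1.and self_mem_nhdsWithin).exists
  have ht0 : 0 < t := ht0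
  have h2 := hn _ (ht.mpr (K'.convex.add_smul_sub_mem hq hy ⟨ht0.le, ht1.le⟩))
  rw [add_sub_cancel_left, inner_smul_right] at h2
  exact nonpos_of_mul_nonpos_right h2 ht0

theorem support_iff_of_germ {K K' : ConvexBody E3} {q : E3} (hq : q ∈ K)
    (h : ∀ᶠ y in 𝓝 q, y ∈ K ↔ y ∈ K') {n : E3} :
    (∀ y ∈ K, inner ℝ n (y - q) ≤ 0) ↔ ∀ y ∈ K', inner ℝ n (y - q) ≤ 0 :=
  ⟨support_of_germ (h.self_of_nhds.mp hq) h,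
    support_of_germ hq (h.mono fun _ hy => hy.symm)⟩

theorem mem_frontier_iff_of_germ {K K' : ConvexBody E3} {q : E3}
    (h : ∀ᶠ y in 𝓝 q, y ∈ K ↔ y ∈ K') :
    q ∈ frontier (K : Set E3) ↔ q ∈ frontier (K' : Set E3) := by
  rw [K.isClosed.frontier_eq, K'.isClosed.frontier_eq, Set.mem_sdiff, Set.mem_sdiff,
    mem_interior_iff_mem_nhds, mem_interior_iff_mem_nhds]
  have h1 : (K : Set E3) ∈ 𝓝 q ↔ (K' : Set E3) ∈ 𝓝 q := Filter.eventually_congr h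
  rw [h1]
  exact and_congr_left fun _ => h.self_of_nhds

theorem nhdsWithin_frontier_of_germ {K K' : ConvexBody E3} {q : E3}
    (h : ∀ᶠ y in 𝓝 q, y ∈ K ↔ y ∈ K') :
    𝓝[frontier (K : Set E3)] q = 𝓝[frontier (K' : Set E3)] q := by
  rw [nhdsWithin_eq_iff_eventuallyEq]
  filter_upwards [h.eventually_nhds] with y hy
  exact propext (mem_frontier_iff_of_germ hy)

theorem mem_of_mem_frontier {K : ConvexBody E3} {q : E3} (h : q ∈ frontier (K : Set E3)) :
    q ∈ K := K.isClosed.frontier_subset h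

/-- The class `(S,U)_c` is inherited by a body with the same center of mass that differs from the
given one only near smooth boundary points that are not equilibria. -/
theorem mem_classC_of_germ {S U : ℕ} {K K' : ConvexBody E3} (hK : K ∈ classC S U)
    (hint : (interior (K' : Set E3)).Nonempty) (hcm : centerOfMass K' = centerOfMass K)
    (h1 : ∀ q ∈ frontier (K' : Set E3), (∀ᶠ y in 𝓝 q, y ∈ K ↔ y ∈ K') ∨
      ((∃! n : E3, IsOuterUnitNormal K' q n) ∧ ¬ IsEquilibrium K' q))
    (h2 : ∀ q, IsEquilibrium K q → ∀ᶠ y in 𝓝 q, y ∈ K ↔ y ∈ K') :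
    K' ∈ classC S U := by
  obtain ⟨⟨hKint, hsm⟩, hfin, hnd, hst, hun⟩ := hK
  have hnorm : ∀ q n, q ∈ K → (∀ᶠ y in 𝓝 q, y ∈ K ↔ y ∈ K') →
      (IsOuterUnitNormal K q n ↔ IsOuterUnitNormal K' q n) := fun q n hq hg =>
    and_congr_right fun _ => support_iff_of_germ hq hg
  have heqg : ∀ q, (∀ᶠ y in 𝓝 q, y ∈ K ↔ y ∈ K') → (IsEquilibrium K q ↔ IsEquilibrium K' q) := by
    intro q hg
    rw [isEquilibrium_iff hKint, isEquilibrium_iff hint, hcm, mem_frontier_iff_of_germ hg]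
    exact and_congr_right fun hq =>
      support_iff_of_germ (hg.self_of_nhds.mpr (mem_of_mem_frontier hq)) hg
  -- An equilibrium of `K'` is excluded from the second alternative of `h1`. So both bodies have the
  -- same equilibria with the same germs there, and the remaining conditions depend only on these
  -- germs and on the common center.
  have hger : ∀ q, IsEquilibrium K' q → ∀ᶠ y in 𝓝 q, y ∈ K ↔ y ∈ K' := fun q hq =>
    (h1 q hq.1).resolve_right fun h => h.2 hq
  have heq : ∀ q, IsEquilibrium K q ↔ IsEquilibrium K' q := fun q =>
    ⟨fun h => (heqg q (h2 q h)).mp h, fun h => (heqg q (hger q h)).mpr h⟩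
  have hpar : ∀ q φ, IsEquilibrium K q → (IsC2Param K q φ ↔ IsC2Param K' q φ) := by
    intro q φ hq
    rw [IsC2Param, IsC2Param, nhdsWithin_frontier_of_germ (h2 q hq)]
  have hhess : ∀ φ u v, hessian K φ u v = hessian K' φ u v := by
    intro φ u v
    have : centerDist K' = centerDist K := by
      ext x; rw [centerDist, centerDist, hcm]
    rw [hessian, hessian, this]
  refine ⟨⟨hint, fun q hq => ?_⟩, ?_, ?_, ?_, ?_⟩
  · rcases h1 q hq with hg | h
    · have hq' := (mem_frontier_iff_of_germ hg).mpr hq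
      have := hsm q hq'
      simpa only [hnorm q _ (mem_of_mem_frontier hq') hg] using this
    · exact h.1
  · simpa only [heq] using hfin
  · intro q hq
    have hq' := (heq q).mpr hq
    obtain ⟨⟨φ, hφ, hφ'⟩, κ, hκ, ψ, n, hψ, hn, hκ'⟩ := hnd q hq'
    refine ⟨⟨φ, (hpar q φ hq').mp hφ, ?_⟩, κ, hκ, ψ, n, (hpar q ψ hq').mp hψ, ?_, hκ'⟩
    · simpa only [hhess] using hφ'
    · exact (hnorm q n (mem_of_mem_frontier hq'.1) (h2 q hq')).mp hn
  · rw [← hst]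
    congr 1
    ext q
    simp only [Set.mem_ofPred_eq, IsStable, heq, hhess]
    exact and_congr_right fun hq => exists_congr fun φ => and_congr_left fun _ =>
      (hpar q φ ((heq q).mpr hq)).symm
  · rw [← hun]
    congr 1
    ext q
    simp only [Set.mem_ofPred_eq, IsUnstable, heq, hhess]
    exact and_congr_right fun hq => exists_congr fun φ => and_congr_left fun _ =>
      (hpar q φ ((heq q).mpr hq)).symm

end Equilibrium

/-! ### Quartic gauges of bodies -/

/-- The fourth power of the gauge function of a convex body with the origin in its interior. -/
structure IsQuarticGauge (F : E3 → ℝ) : Prop where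
  continuous : Continuous F
  smul : ∀ t : ℝ, 0 ≤ t → ∀ x, F (t • x) = t ^ 4 * F x
  pos : ∀ x, x ≠ 0 → 0 < F x
  convex : ConvexOn ℝ Set.univ F

/-- The fourth power of the gauge function of a convex body, based at the center of mass. -/
noncomputable def quarticGauge (K : ConvexBody E3) (x : E3) : ℝ :=
  gauge {y : E3 | y + centerOfMass K ∈ K} x ^ 4

section QuarticGauge

variable {K : ConvexBody E3}

theorem centered_mem_nhds (h : (interior (K : Set E3)).Nonempty) :
    {y : E3 | y + centerOfMass K ∈ K} ∈ 𝓝 (0 : E3) := by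
  have h1 : (K : Set E3) ∈ 𝓝 ((0 : E3) + centerOfMass K) := by
    rw [zero_add]
    exact mem_interior_iff_mem_nhds.mp (centerOfMass_mem_interior K h)
  exact (continuous_add_const (centerOfMass K)).continuousAt.preimage_mem_nhds h1

theorem centered_convex : Convex ℝ {y : E3 | y + centerOfMass K ∈ K} :=
  K.convex.translate_preimage_left (centerOfMass K)

theorem centered_isClosed : IsClosed {y : E3 | y + centerOfMass K ∈ K} :=
  K.isClosed.preimage (continuous_add_const (centerOfMass K))

theorem centered_isBounded : Bornology.IsBounded {y : E3 | y + centerOfMass K ∈ K} := by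
  obtain ⟨R, hR⟩ := K.isCompact.isBounded.exists_norm_le
  refine isBounded_iff_forall_norm_le.mpr ⟨R + ‖centerOfMass K‖, fun y hy => ?_⟩
  have := hR _ hy
  calc ‖y‖ = ‖(y + centerOfMass K) - centerOfMass K‖ := by simp
    _ ≤ _ := (norm_sub_le _ _).trans (by gcongr)

theorem isQuarticGauge (h : (interior (K : Set E3)).Nonempty) :
    IsQuarticGauge (quarticGauge K) where
  continuous := (continuous_gauge centered_convex (centered_mem_nhds h)).pow 4
  smul t ht x := by
    rw [quarticGauge, gauge_smul_of_nonneg ht, smul_eq_mul, mul_pow, quarticGauge]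
  pos x hx := by
    refine pow_pos ?_ 4
    rw [gauge_pos (absorbent_nhds_zero (centered_mem_nhds h))
      (NormedSpace.isVonNBounded_iff ℝ |>.mpr centered_isBounded)]
    exact hx
  convex := by
    have hc : ConvexOn ℝ Set.univ (gauge {y : E3 | y + centerOfMass K ∈ K}) := by
      refine ⟨convex_univ, fun x _ y _ a b ha hb _ => ?_⟩
      refine (gauge_add_le centered_convex (absorbent_nhds_zero (centered_mem_nhds h)) _ _).trans ?_
      rw [gauge_smul_of_nonneg ha, gauge_smul_of_nonneg hb]
    exact hc.pow (fun _ _ => gauge_nonneg _) 4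

theorem quarticGauge_le_one_iff (h : (interior (K : Set E3)).Nonempty) {x : E3} :
    quarticGauge K x ≤ 1 ↔ x + centerOfMass K ∈ K := by
  rw [quarticGauge, pow_le_one_iff_of_nonneg (gauge_nonneg _) (by norm_num),
    gauge_le_one_iff_mem_closure centered_convex (centered_mem_nhds h),
    centered_isClosed.closure_eq, Set.mem_ofPred_eq]

theorem mem_body_iff (h : (interior (K : Set E3)).Nonempty) {x : E3} :
    x ∈ K ↔ quarticGauge K (x - centerOfMass K) ≤ 1 := by
  rw [quarticGauge_le_one_iff h, sub_add_cancel]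

theorem quarticGauge_eq_one_iff (h : (interior (K : Set E3)).Nonempty) {q : E3} :
    quarticGauge K (q - centerOfMass K) = 1 ↔ q ∈ frontier (K : Set E3) := by
  rw [quarticGauge, pow_eq_one_iff_of_nonneg (gauge_nonneg _) (by norm_num),
    gauge_eq_one_iff_mem_frontier centered_convex (centered_mem_nhds h)]
  have := (Homeomorph.addRight (centerOfMass K)).preimage_frontier (K : Set E3)
  have h2 := congrArg (fun s => q - centerOfMass K ∈ s) this
  have h3 : {y : E3 | y + centerOfMass K ∈ K} = (fun x => x + centerOfMass K) ⁻¹' (K : Set E3) :=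
    rfl
  rw [h3]
  simpa using h2.symm

end QuarticGauge

/-! ### Derivatives of convex and of homogeneous functions -/

section Calculus

/-- The gradient inequality for convex functions. -/
theorem fderiv_le_of_convexOn {E : Type*} [NormedAddCommGroup E] [NormedSpace ℝ E] {F : E → ℝ}
    (hF : ConvexOn ℝ Set.univ F) {x : E} (hd : DifferentiableAt ℝ F x) (y : E) :
    fderiv ℝ F x (y - x) ≤ F y - F x := by
  have h1 : HasDerivAt (fun t : ℝ => F (x + t • (y - x))) (fderiv ℝ F x (y - x)) 0 := by
    have h2 : HasDerivAt (fun t : ℝ => x + t • (y - x)) (y - x) 0 := by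
      simpa using ((hasDerivAt_id (0 : ℝ)).smul_const (y - x)).const_add x
    have h3 : HasFDerivAt F (fderiv ℝ F x) (x + (0 : ℝ) • (y - x)) := by simpa using hd.hasFDerivAt
    exact h3.comp_hasDerivAt 0 h2
  have h4 := h1.tendsto_slope_zero_right
  refine le_of_tendsto h4 ?_
  filter_upwards [Ioc_mem_nhdsGT (zero_lt_one' ℝ)] with t ht
  have h5 := hF.2 (Set.mem_univ x) (Set.mem_univ y) (show 0 ≤ 1 - t by linarith [ht.2]) ht.1.le
    (by ring)
  rw [show (1 - t) • x + t • y = x + t • (y - x) by module] at h5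
  simp only [smul_eq_mul, zero_add, zero_smul, add_zero] at h5 ⊢
  rw [inv_mul_le_iff₀ ht.1]
  linarith

/-- The second derivative of a convex function is positive semidefinite. -/
theorem fderiv_fderiv_nonneg_of_convexOn {E : Type*} [NormedAddCommGroup E] [NormedSpace ℝ E]
    {F : E → ℝ} (hF : ConvexOn ℝ Set.univ F) {x : E} (hd : ContDiffAt ℝ 2 F x) (v : E) :
    0 ≤ fderiv ℝ (fderiv ℝ F) x v v := by
  have hl : HasDerivAt (fun t : ℝ => x + t • v) v 0 := by
    simpa using ((hasDerivAt_id (0 : ℝ)).smul_const v).const_add x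
  have h1 : HasDerivAt (fun t : ℝ => fderiv ℝ F (x + t • v) v) (fderiv ℝ (fderiv ℝ F) x v v) 0 := by
    have h3 : HasFDerivAt (fderiv ℝ F) (fderiv ℝ (fderiv ℝ F) x) (x + (0 : ℝ) • v) := by
      simpa using ((hd.fderiv_right (m := 1) (by norm_num)).differentiableAt
        (by norm_num)).hasFDerivAt
    have h4 := h3.comp_hasDerivAt 0 hl
    simpa using h4.clm_apply (hasDerivAt_const (0 : ℝ) v)
  have hev : ∀ᶠ t in 𝓝 (0 : ℝ), DifferentiableAt ℝ F (x + t • v) := by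
    have h5 : ∀ᶠ y in 𝓝 (x + (0 : ℝ) • v), DifferentiableAt ℝ F y := by
      simpa using (hd.eventually (by simp)).mono fun y hy => hy.differentiableAt (by norm_num)
    exact hl.continuousAt.eventually h5
  refine ge_of_tendsto h1.tendsto_slope_zero_right ?_
  filter_upwards [self_mem_nhdsWithin, hev.filter_mono nhdsWithin_le_nhds] with t ht hdt
  have ht : 0 < t := ht
  have h6 := fderiv_le_of_convexOn hF hdt x
  have h7 := fderiv_le_of_convexOn hF (hd.differentiableAt (by norm_num)) (x + t • v)
  rw [show x - (x + t • v) = (-t) • v by module, map_smul, smul_eq_mul] at h6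
  rw [show x + t • v - x = t • v by module, map_smul, smul_eq_mul] at h7
  have h8 : 0 ≤ t * (fderiv ℝ F (x + t • v) v - fderiv ℝ F x v) := by linarith
  have h9 := nonneg_of_mul_nonneg_right h8 ht
  simp only [zero_add, zero_smul, add_zero, smul_eq_mul]
  positivity

theorem IsQuarticGauge.apply_zero {F : E3 → ℝ} (hF : IsQuarticGauge F) : F 0 = 0 := by
  simpa using hF.smul 0 le_rfl 0

section Homogeneous

variable {E : Type*} [NormedAddCommGroup E] [NormedSpace ℝ E]

/-- Euler's relation in degree four, from differentiation along the ray at `t = 1`. -/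
theorem fderiv_self_of_quartic {F : E → ℝ}
    (hF : ∀ t : ℝ, 0 ≤ t → ∀ x, F (t • x) = t ^ 4 * F x) {x : E}
    (hd : DifferentiableAt ℝ F x) : fderiv ℝ F x x = 4 * F x := by
  have h1 : HasDerivAt (fun t : ℝ => F (t • x)) (fderiv ℝ F x x) 1 := by
    have h2 : HasDerivAt (fun t : ℝ => t • x) x 1 := by
      simpa using (hasDerivAt_id (1 : ℝ)).smul_const x
    have h3 : HasFDerivAt F (fderiv ℝ F x) ((1 : ℝ) • x) := by simpa using hd.hasFDerivAt
    exact h3.comp_hasDerivAt 1 h2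
  have h4 : HasDerivAt (fun t : ℝ => t ^ 4 * F x) (4 * F x) 1 := by
    simpa using (hasDerivAt_pow 4 (1 : ℝ)).mul_const (F x)
  refine h1.unique (h4.congr_of_eventuallyEq ?_)
  filter_upwards [lt_mem_nhds (zero_lt_one' ℝ)] with t ht
  exact hF t ht.le x

theorem fderiv_smul_of_quartic {F : E → ℝ}
    (hF : ∀ t : ℝ, 0 ≤ t → ∀ x, F (t • x) = t ^ 4 * F x) {x : E} {t : ℝ}
    (ht : 0 < t) (hd : DifferentiableAt ℝ F x) (hd' : DifferentiableAt ℝ F (t • x)) (v : E) :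
    fderiv ℝ F (t • x) v = t ^ 3 * fderiv ℝ F x v := by
  have h1 : HasFDerivAt (fun y => F (t • y)) (t • fderiv ℝ F (t • x)) x := by
    have h := hd'.hasFDerivAt.comp x ((hasFDerivAt_id x).const_smul t)
    have he : (fderiv ℝ F (t • x)).comp (t • ContinuousLinearMap.id ℝ E)
        = t • fderiv ℝ F (t • x) := by
      ext w; simp
    exact he ▸ h
  have h2 : (fun y => F (t • y)) = fun y => t ^ 4 * F y := funext fun y => hF t ht.le y
  rw [h2] at h1
  have h3 := congrArg (fun A => A v) (h1.unique (hd.hasFDerivAt.const_mul (t ^ 4)))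
  simp only [smul_apply, smul_eq_mul] at h3
  have : t * (fderiv ℝ F (t • x) v) = t * (t ^ 3 * fderiv ℝ F x v) := by rw [h3]; ring
  exact mul_left_cancel₀ ht.ne' this

/-- Euler's relation for the derivative, which is homogeneous of degree three. It shows that a
kernel vector of the Hessian is tangent to the level set. -/
theorem fderiv_fderiv_self_of_quartic {F : E → ℝ}
    (hF : ∀ t : ℝ, 0 ≤ t → ∀ x, F (t • x) = t ^ 4 * F x) {x : E}
    (hd : ContDiffAt ℝ 2 F x) (v : E) :
    fderiv ℝ (fderiv ℝ F) x x v = 3 * fderiv ℝ F x v := by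
  have h2 : HasDerivAt (fun t : ℝ => t • x) x 1 := by
    simpa using (hasDerivAt_id (1 : ℝ)).smul_const x
  have h1 : HasDerivAt (fun t : ℝ => fderiv ℝ F (t • x) v) (fderiv ℝ (fderiv ℝ F) x x v) 1 := by
    have h3 : HasFDerivAt (fderiv ℝ F) (fderiv ℝ (fderiv ℝ F) x) ((1 : ℝ) • x) := by
      simpa using ((hd.fderiv_right (m := 1) (by norm_num)).differentiableAt
        (by norm_num)).hasFDerivAt
    have h5 : HasDerivAt (fun t : ℝ => fderiv ℝ F (t • x)) (fderiv ℝ (fderiv ℝ F) x x) 1 :=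
      HasFDerivAt.comp_hasDerivAt (f := fun t : ℝ => t • x) (1 : ℝ) h3 h2
    simpa using h5.clm_apply (hasDerivAt_const (1 : ℝ) v)
  have h4 : HasDerivAt (fun t : ℝ => t ^ 3 * fderiv ℝ F x v) (3 * fderiv ℝ F x v) 1 := by
    simpa using (hasDerivAt_pow 3 (1 : ℝ)).mul_const (fderiv ℝ F x v)
  refine h1.unique (h4.congr_of_eventuallyEq ?_)
  have hev : ∀ᶠ t in 𝓝 (1 : ℝ), DifferentiableAt ℝ F (t • x) := by
    have h5 : ∀ᶠ y in 𝓝 ((1 : ℝ) • x), DifferentiableAt ℝ F y := by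
      simpa using (hd.eventually (by simp)).mono fun y hy => hy.differentiableAt (by norm_num)
    exact h2.continuousAt.eventually h5
  filter_upwards [lt_mem_nhds (zero_lt_one' ℝ), hev] with t ht hdt
  exact fderiv_smul_of_quartic hF ht (hd.differentiableAt (by norm_num)) hdt v

end Homogeneous

/-- A positive semidefinite symmetric form without kernel is bounded below by a multiple of the
squared norm. -/
theorem exists_pos_le_of_posSemidef {A : E3 →L[ℝ] E3 →L[ℝ] ℝ} (hs : ∀ u v, A u v = A v u)
    (h0 : ∀ v, 0 ≤ A v v) (hk : ∀ v, (∀ w, A v w = 0) → v = 0) :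
    ∃ m > 0, ∀ v, 4 * m * ‖v‖ ^ 2 ≤ A v v := by
  have hpos : ∀ v, v ≠ 0 → 0 < A v v := by
    intro v hv
    refine lt_of_le_of_ne (h0 v) fun he => hv (hk v fun w => ?_)
    by_contra hne
    -- This nonnegative polynomial in `t` has no constant term, so its linear coefficient must
    -- vanish; the values of `t` below expose a negative value otherwise.
    have hq : ∀ t : ℝ, 0 ≤ 2 * t * A v w + t ^ 2 * A w w := by
      intro t
      have := h0 (v + t • w)
      simp only [map_add, map_smul, add_apply, smul_apply, smul_eq_mul, ← he, hs w v] at this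
      linarith
    rcases (h0 w).eq_or_lt with hw | hw
    · have := hq (-(A v w))
      rw [← hw] at this
      nlinarith [sq_nonneg (A v w), mul_self_pos.mpr hne]
    · have := hq (-(A v w) / A w w)
      have h2 : 2 * (-(A v w) / A w w) * A v w + (-(A v w) / A w w) ^ 2 * A w w
          = - (A v w * A v w) / A w w := by field_simp; ring
      rw [h2] at this
      have := div_neg_of_neg_of_pos (neg_lt_zero.mpr (mul_self_pos.mpr hne)) hw
      linarith
  obtain ⟨v0, hv0, hmin⟩ := (isCompact_sphere (0 : E3) 1).exists_isMinOn
    ((NormedSpace.sphere_nonempty (x := (0 : E3))).mpr zero_le_one)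
    (f := fun v => A v v) (by fun_prop)
  have hv0' : v0 ≠ 0 := by
    rintro rfl
    simp at hv0
  refine ⟨A v0 v0 / 4, by have := hpos v0 hv0'; positivity, fun v => ?_⟩
  rcases eq_or_ne v 0 with rfl | hv
  · simp
  have h1 : ‖v‖⁻¹ • v ∈ Metric.sphere (0 : E3) 1 := by
    simpa using norm_smul_inv_norm (𝕜 := ℝ) hv
  have h2 : A v0 v0 ≤ A (‖v‖⁻¹ • v) (‖v‖⁻¹ • v) := hmin h1
  simp only [map_smul, smul_apply, smul_eq_mul] at h2
  have hn : 0 < ‖v‖ := norm_pos_iff.mpr hv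
  rw [← mul_assoc, ← mul_inv, inv_mul_eq_div, le_div_iff₀ (by positivity)] at h2
  linarith

end Calculus

/-! ### Gaussian curvature and the Hessian of the quartic gauge -/

section Curvature

variable {K : ConvexBody E3}

/-- The center can be moved a little in direction `n` without leaving the body, which makes the
support inequality strict at the center. -/
theorem inner_normal_pos (h : (interior (K : Set E3)).Nonempty) {q n : E3}
    (hn : IsOuterUnitNormal K q n) : 0 < inner ℝ n (q - centerOfMass K) := by
  obtain ⟨r, hr, hsub⟩ := Metric.mem_nhds_iff.mp
    (mem_interior_iff_mem_nhds.mp (centerOfMass_mem_interior K h))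
  have hmem : centerOfMass K + (r / 2) • n ∈ Metric.ball (centerOfMass K) r := by
    rw [mem_ball_iff_norm, add_sub_cancel_left, norm_smul, hn.1, Real.norm_of_nonneg (by linarith)]
    linarith
  have h1 := hn.2 _ (hsub hmem)
  rw [show centerOfMass K + (r / 2) • n - q = (r / 2) • n - (q - centerOfMass K) by abel,
    inner_sub_right, inner_smul_right, real_inner_self_eq_norm_sq, hn.1] at h1
  linarith

variable {q n : E3} {φ : E2 → E3}

theorem IsC2Param.eventually_mem_frontier (hφ : IsC2Param K q φ) :
    ∀ᶠ w in 𝓝 0, φ w ∈ frontier (K : Set E3) := by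
  have h1 : ∀ᶠ y in 𝓝[frontier (K : Set E3)] q, y ∈ frontier (K : Set E3) := self_mem_nhdsWithin
  rwa [← hφ.2.2.2, Filter.eventually_map] at h1

theorem IsC2Param.hasFDerivAt (hφ : IsC2Param K q φ) : HasFDerivAt φ (fderiv ℝ φ 0) 0 :=
  (hφ.2.1.differentiableAt (by norm_num)).hasFDerivAt

/-- The pairing with an outer normal is maximal over the body at `q`, so its derivative along the
boundary vanishes. -/
theorem IsC2Param.inner_normal_fderiv (hφ : IsC2Param K q φ) (hn : IsOuterUnitNormal K q n)
    (w : E2) : inner ℝ n (fderiv ℝ φ 0 w) = 0 := by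
  have hmax : IsLocalMax (fun w => inner ℝ n (φ w)) 0 := by
    filter_upwards [hφ.eventually_mem_frontier] with w hw
    have := hn.2 _ (mem_of_mem_frontier hw)
    rw [inner_sub_right] at this
    rw [hφ.1]
    linarith
  have h1 : HasFDerivAt (fun w => inner ℝ n (φ w)) ((innerSL ℝ n).comp (fderiv ℝ φ 0)) 0 :=
    (innerSL ℝ n).hasFDerivAt.comp 0 hφ.hasFDerivAt
  have h2 := congrArg (fun A => A w) (hmax.hasFDerivAt_eq_zero h1)
  simpa using h2

/-- The radial extension of a parametrization. -/
theorem IsC2Param.exists_equiv (h : (interior (K : Set E3)).Nonempty) (hφ : IsC2Param K q φ)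
    (hn : IsOuterUnitNormal K q n) :
    ∃ e : (E2 × ℝ) ≃L[ℝ] E3, (∀ w t, e (w, t) = fderiv ℝ φ 0 w + t • (q - centerOfMass K)) ∧
      HasFDerivAt (fun z : E2 × ℝ => z.2 • (φ z.1 - centerOfMass K)) (e : (E2 × ℝ) →L[ℝ] E3)
        (0, 1) := by
  set x := q - centerOfMass K with hx
  let A : (E2 × ℝ) →L[ℝ] E3 :=
    (fderiv ℝ φ 0).comp (ContinuousLinearMap.fst ℝ E2 ℝ) +
      (ContinuousLinearMap.snd ℝ E2 ℝ).smulRight x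
  have hA : ∀ w t, A (w, t) = fderiv ℝ φ 0 w + t • x := fun w t => by simp [A]
  -- Pairing with `n` kills the tangential part and has a nonzero value on the radial vector.
  have hinj : Function.Injective A.toLinearMap := by
    rw [← LinearMap.ker_eq_bot, LinearMap.ker_eq_bot']
    rintro ⟨w, t⟩ hwt
    have hwt : fderiv ℝ φ 0 w + t • x = 0 := by rw [← hA]; exact hwt
    have h1 := congrArg (fun y => inner ℝ n y) hwt
    simp only [inner_add_right, hφ.inner_normal_fderiv hn, inner_smul_right, inner_zero_right,
      zero_add] at h1
    have ht : t = 0 := (mul_eq_zero.mp h1).resolve_right (inner_normal_pos h hn).ne'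
    rw [ht, zero_smul, add_zero] at hwt
    have hw : w = 0 := hφ.2.2.1 (by simpa using hwt)
    rw [hw, ht]; rfl
  have hdim : Module.finrank ℝ (E2 × ℝ) = Module.finrank ℝ E3 := by simp
  let e := (LinearMap.linearEquivOfInjective A.toLinearMap hinj hdim).toContinuousLinearEquiv
  have he : (e : (E2 × ℝ) →L[ℝ] E3) = A := by ext z <;> rfl
  refine ⟨e, fun w t => ?_, ?_⟩
  · rw [← hA, ← he]; rfl
  · rw [he]
    have h1 : HasFDerivAt (fun z : E2 × ℝ => φ z.1 - centerOfMass K)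
        ((fderiv ℝ φ 0).comp (ContinuousLinearMap.fst ℝ E2 ℝ)) (0, 1) :=
      (HasFDerivAt.comp (g := φ) ((0, 1) : E2 × ℝ) hφ.hasFDerivAt hasFDerivAt_fst).sub_const _
    have h2 : HasFDerivAt (fun z : E2 × ℝ => z.2) (ContinuousLinearMap.snd ℝ E2 ℝ)
        ((0, 1) : E2 × ℝ) := hasFDerivAt_snd
    have h3 := h2.smul h1
    simp only [one_smul, hφ.1, ← hx] at h3
    exact h3

/-- In the coordinates `(w, t) ↦ t • (φ w - centerOfMass K)` the gauge is `t`. These coordinates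
have a C² local inverse, whose second component to the fourth power is the quartic gauge. -/
theorem contDiffAt_quarticGauge (h : (interior (K : Set E3)).Nonempty) (hφ : IsC2Param K q φ)
    (hn : IsOuterUnitNormal K q n) :
    ContDiffAt ℝ 2 (quarticGauge K) (q - centerOfMass K) := by
  obtain ⟨e, -, hd⟩ := hφ.exists_equiv h hn
  set Φ : E2 × ℝ → E3 := fun z => z.2 • (φ z.1 - centerOfMass K) with hΦ
  have hC : ContDiffAt ℝ 2 Φ (0, 1) := by
    refine contDiffAt_snd.smul (ContDiffAt.sub ?_ contDiffAt_const)
    exact ContDiffAt.comp (g := φ) ((0, 1) : E2 × ℝ) hφ.2.1 contDiffAt_fst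
  have hval : Φ (0, 1) = q - centerOfMass K := by simp [hΦ, hφ.1]
  have h2 : (2 : WithTop ℕ∞) ≠ 0 := by norm_num
  have hinv := hC.to_localInverse hd h2
  have hright := (hC.hasStrictFDerivAt' hd h2).eventually_right_inverse
  have htend := (hC.hasStrictFDerivAt' hd h2).localInverse_tendsto
  rw [hval] at hinv hright htend
  refine ContDiffAt.congr_of_eventuallyEq (f := fun x => (hC.localInverse hd h2 x).2 ^ 4)
    ((contDiffAt_snd.comp _ hinv).pow 4) ?_
  have h3 : ∀ᶠ z in 𝓝 ((0, 1) : E2 × ℝ), φ z.1 ∈ frontier (K : Set E3) ∧ 0 < z.2 := by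
    refine Filter.Eventually.and ?_ ?_
    · exact (continuous_fst.tendsto ((0, 1) : E2 × ℝ)).eventually hφ.eventually_mem_frontier
    · exact (continuous_snd.tendsto ((0, 1) : E2 × ℝ)).eventually (lt_mem_nhds one_pos)
  filter_upwards [hright, htend.eventually h3] with x hx hx'
  have hx1 : Φ (hC.localInverse hd h2 x) = x := hx
  have hx2 : φ (hC.localInverse hd h2 x).1 ∈ frontier (K : Set E3) ∧
    0 < (hC.localInverse hd h2 x).2 := hx'
  conv_lhs => rw [← hx1]
  simp only [hΦ]
  rw [(isQuarticGauge h).smul _ hx2.2.le, (quarticGauge_eq_one_iff h).mpr hx2.1, mul_one]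

/-- At a boundary point of nonzero Gaussian curvature, the fourth power of the gauge function has
positive definite second derivative. -/
theorem exists_pos_le_fderiv_fderiv (h : (interior (K : Set E3)).Nonempty) (hφ : IsC2Param K q φ)
    (hn : IsOuterUnitNormal K q n) (hdet : (secondForm φ n).det ≠ 0) :
    ∃ m > 0, ∀ v, 4 * m * ‖v‖ ^ 2 ≤
      fderiv ℝ (fderiv ℝ (quarticGauge K)) (q - centerOfMass K) v v := by
  set F := quarticGauge K with hFdef
  set x := q - centerOfMass K with hx
  have hF : IsQuarticGauge F := isQuarticGauge h
  have hC : ContDiffAt ℝ 2 F x := contDiffAt_quarticGauge h hφ hn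
  have hdiff : ContDiffAt ℝ 1 (fderiv ℝ F) x := hC.fderiv_right (m := 1) (by norm_num)
  have hsymm : ∀ u v, fderiv ℝ (fderiv ℝ F) x u v = fderiv ℝ (fderiv ℝ F) x v u :=
    fun u v => (hC.isSymmSndFDerivAt (by simp)).eq u v
  obtain ⟨e, he, -⟩ := hφ.exists_equiv h hn
  have hqf : q ∈ frontier (K : Set E3) := by
    have := hφ.eventually_mem_frontier.self_of_nhds
    rwa [hφ.1] at this
  have hFx : F x = 1 := (quarticGauge_eq_one_iff h).mpr hqf
  -- `F` is constant along the boundary. The identity is needed near `0`, since `hsecond`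
  -- differentiates it once more.
  have hFφ : ∀ᶠ w in 𝓝 (0 : E2), fderiv ℝ F (φ w - centerOfMass K) ∘L fderiv ℝ φ w = 0 := by
    have h1 : ∀ᶠ w in 𝓝 (0 : E2), DifferentiableAt ℝ F (φ w - centerOfMass K) := by
      have hc : ContinuousAt (fun w => φ w - centerOfMass K) 0 :=
        hφ.2.1.continuousAt.sub continuousAt_const
      have h2 : ∀ᶠ y in 𝓝 (φ 0 - centerOfMass K), DifferentiableAt ℝ F y := by
        rw [hφ.1]
        exact (hC.eventually (by simp)).mono fun y hy => hy.differentiableAt (by norm_num)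
      exact hc.eventually h2
    have h3 : ∀ᶠ w in 𝓝 (0 : E2), DifferentiableAt ℝ φ w :=
      (hφ.2.1.eventually (by simp)).mono fun y hy => hy.differentiableAt (by norm_num)
    filter_upwards [h1, h3, hφ.eventually_mem_frontier.eventually_nhds] with w hw1 hw2 hw3
    have h4 : HasFDerivAt (fun w => F (φ w - centerOfMass K))
        (fderiv ℝ F (φ w - centerOfMass K) ∘L fderiv ℝ φ w) w :=
      HasFDerivAt.comp (g := F) w hw1.hasFDerivAt (hw2.hasFDerivAt.sub_const _)
    refine h4.unique ((hasFDerivAt_const (1 : ℝ) w).congr_of_eventuallyEq ?_)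
    filter_upwards [hw3] with w' hw'
    exact (quarticGauge_eq_one_iff h).mpr hw'
  have hDφ : ∀ w, fderiv ℝ F x (fderiv ℝ φ 0 w) = 0 := by
    intro w
    have := congrArg (fun A => A w) hFφ.self_of_nhds
    simpa [hφ.1] using this
  -- The derivative vanishes on tangent vectors and Euler's relation gives its radial value, so it
  -- is a nonzero multiple of the normal. With `hsecond`, the Hessian on tangent vectors is then a
  -- nonzero multiple of the second fundamental form.
  have hDF : ∀ u, fderiv ℝ F x u = 4 / inner ℝ n x * inner ℝ n u := by
    intro u
    obtain ⟨⟨w, t⟩, rfl⟩ := e.surjective u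
    have hp := inner_normal_pos h hn
    rw [he, map_add, map_smul, hDφ,
      fderiv_self_of_quartic hF.smul (hC.differentiableAt (by norm_num)), hFx,
      inner_add_right, hφ.inner_normal_fderiv hn, inner_smul_right, smul_eq_mul, ← hx]
    rw [← hx] at hp
    field_simp
    ring
  have hsecond : ∀ a b, fderiv ℝ (fderiv ℝ F) x (fderiv ℝ φ 0 a) (fderiv ℝ φ 0 b) +
      fderiv ℝ F x (fderiv ℝ (fderiv ℝ φ) 0 a b) = 0 := by
    intro a b
    have h1 : HasFDerivAt (fun w => fderiv ℝ F (φ w - centerOfMass K))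
        ((fderiv ℝ (fderiv ℝ F) x).comp (fderiv ℝ φ 0)) 0 := by
      have h2 : HasFDerivAt (fderiv ℝ F) (fderiv ℝ (fderiv ℝ F) x) (φ 0 - centerOfMass K) := by
        rw [hφ.1]
        exact (hdiff.differentiableAt (by norm_num)).hasFDerivAt
      exact HasFDerivAt.comp (g := fderiv ℝ F) (0 : E2) h2 (hφ.hasFDerivAt.sub_const _)
    have h3 : HasFDerivAt (fderiv ℝ φ) (fderiv ℝ (fderiv ℝ φ) 0) 0 :=
      ((hφ.2.1.fderiv_right (m := 1) (by norm_num)).differentiableAt (by norm_num)).hasFDerivAt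
    have h4 := h1.clm_comp h3
    have h5 := congrArg (fun A => A a b)
      (h4.unique ((hasFDerivAt_const (0 : E2 →L[ℝ] ℝ) (0 : E2)).congr_of_eventuallyEq hFφ))
    simp [hφ.1] at h5
    linarith
  refine exists_pos_le_of_posSemidef hsymm (fderiv_fderiv_nonneg_of_convexOn hF.convex hC) ?_
  intro v hv
  -- A kernel vector is tangent by Euler's relation for the derivative, and a tangent kernel vector
  -- is a null vector of the second fundamental form.
  have hv1 : fderiv ℝ F x v = 0 := by
    have h1 := fderiv_fderiv_self_of_quartic hF.smul hC v
    rw [hsymm, hv] at h1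
    linarith
  obtain ⟨⟨w, t⟩, rfl⟩ := e.surjective v
  have ht : t = 0 := by
    rw [he, map_add, map_smul, hDφ,
      fderiv_self_of_quartic hF.smul (hC.differentiableAt (by norm_num)), hFx] at hv1
    simpa using hv1
  have hw : w = 0 := by
    by_contra hw
    refine hdet (Matrix.exists_vecMul_eq_zero_iff.mp
      ⟨w, fun h0 => hw (by ext i; exact congrFun h0 i), ?_⟩)
    ext j
    have h1 := hsecond w (EuclideanSpace.single j 1)
    have h2 := hv (fderiv ℝ φ 0 (EuclideanSpace.single j 1))
    rw [he, ht, zero_smul, add_zero] at h2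
    rw [h2, zero_add, hDF, mul_eq_zero] at h1
    have h3 := h1.resolve_left (div_ne_zero (by norm_num) (inner_normal_pos h hn).ne')
    have hdec : w = ∑ i, w i • EuclideanSpace.single i (1 : ℝ) := by
      ext i
      simp [Fin.sum_univ_two]
      fin_cases i <;> simp
    rw [hdec] at h3
    simp only [map_sum, map_smul, sum_apply, smul_apply, inner_sum,
      inner_smul_right] at h3
    simpa [Matrix.vecMul, dotProduct, secondForm] using h3
  rw [hw, ht]
  exact map_zero e

end Curvature

/-! ### Bodies defined by quartic gauges and their equilibria -/

section Gauge

variable {F : E3 → ℝ}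

theorem IsQuarticGauge.exists_lower_bound (hF : IsQuarticGauge F) :
    ∃ c > 0, ∀ x, c * ‖x‖ ^ 4 ≤ F x := by
  obtain ⟨u, hu, hmin⟩ := (isCompact_sphere (0 : E3) 1).exists_isMinOn
    ((NormedSpace.sphere_nonempty (x := (0 : E3))).mpr zero_le_one) hF.continuous.continuousOn
  have hu0 : u ≠ 0 := by
    rintro rfl
    simp at hu
  refine ⟨F u, hF.pos u hu0, fun x => ?_⟩
  rcases eq_or_ne x 0 with rfl | hx
  · simp [hF.apply_zero]
  have h1 : ‖x‖⁻¹ • x ∈ Metric.sphere (0 : E3) 1 := by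
    simpa using norm_smul_inv_norm (𝕜 := ℝ) hx
  have h2 : F u ≤ F (‖x‖⁻¹ • x) := hmin h1
  have hn : 0 < ‖x‖ := norm_pos_iff.mpr hx
  rw [hF.smul _ (by positivity), inv_pow, inv_mul_eq_div, le_div_iff₀ (by positivity)] at h2
  exact h2

theorem IsQuarticGauge.nonneg (hF : IsQuarticGauge F) (x : E3) : 0 ≤ F x := by
  rcases eq_or_ne x 0 with rfl | hx
  · rw [hF.apply_zero]
  · exact (hF.pos x hx).le

theorem IsQuarticGauge.exists_bound (hF : IsQuarticGauge F) (M : ℝ) :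
    ∃ R > 0, ∀ x, F x ≤ M → ‖x‖ ≤ R := by
  obtain ⟨c, hc, h⟩ := hF.exists_lower_bound
  refine ⟨max 1 (M / c), by positivity, fun x hx => ?_⟩
  by_contra hcon
  push Not at hcon
  have h1 : 1 < ‖x‖ := (le_max_left _ _).trans_lt hcon
  have h2 : M / c < ‖x‖ := (le_max_right _ _).trans_lt hcon
  rw [div_lt_iff₀ hc] at h2
  have h3 : ‖x‖ ≤ ‖x‖ ^ 4 := le_self_pow₀ h1.le (by norm_num)
  nlinarith [h x]

theorem IsQuarticGauge.isCompact_le_one (hF : IsQuarticGauge F) : IsCompact {x | F x ≤ 1} := by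
  obtain ⟨R, -, hR⟩ := hF.exists_bound 1
  refine Metric.isCompact_of_isClosed_isBounded (isClosed_le hF.continuous continuous_const)
    (isBounded_iff_forall_norm_le.mpr ⟨R, fun x hx => hR x hx⟩)

theorem IsQuarticGauge.comp_isometry (hF : IsQuarticGauge F) (L : E3 ≃ₗᵢ[ℝ] E3) :
    IsQuarticGauge (fun x => F (L x)) where
  continuous := hF.continuous.comp L.continuous
  smul t ht x := by rw [map_smul, hF.smul t ht]
  pos x hx := hF.pos _ (by simpa using hx)
  convex := by
    have := hF.convex.comp_linearMap L.toLinearEquiv.toLinearMap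
    simpa [Function.comp_def] using this

theorem IsQuarticGauge.exists_smul_eq_one (hF : IsQuarticGauge F) {x : E3} (hx : x ≠ 0) :
    ∃ t > 0, t ^ 4 * F x = 1 := by
  have h := hF.pos x hx
  refine ⟨(F x)⁻¹ ^ (4⁻¹ : ℝ), by positivity, ?_⟩
  have := Real.rpow_inv_natCast_pow (inv_nonneg.mpr h.le) (n := 4) (by norm_num)
  push_cast at this
  rw [this, inv_mul_cancel₀ h.ne']

/-- Two bodies with the same integral of a weight that separates them are equal where the weight
does not vanish. -/
theorem eq_zero_of_setIntegral_eq {F₁ F₂ w : E3 → ℝ} (h₁ : IsQuarticGauge F₁)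
    (h₂ : IsQuarticGauge F₂) (hw : ∀ x, x ≠ 0 → ContinuousAt w x)
    (hhom : ∀ t : ℝ, 0 < t → ∀ x, w (t • x) = t * w x)
    (hi₁ : IntegrableOn w {x | F₁ x ≤ 1}) (hi₂ : IntegrableOn w {x | F₂ x ≤ 1})
    (hsign : ∀ x, 0 ≤ w x * (F₂ x - F₁ x))
    (heq : ∫ x in {x | F₁ x ≤ 1}, w x = ∫ x in {x | F₂ x ≤ 1}, w x) (x : E3) :
    w x * (F₂ x - F₁ x) = 0 := by
  by_contra hne
  have hpos : 0 < w x * (F₂ x - F₁ x) := lt_of_le_of_ne (hsign x) (Ne.symm hne)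
  have hx : x ≠ 0 := by
    rintro rfl
    rw [h₁.apply_zero, h₂.apply_zero] at hpos
    simp at hpos
  have hm₁ : MeasurableSet {x | F₁ x ≤ 1} := h₁.isCompact_le_one.isClosed.measurableSet
  have hm₂ : MeasurableSet {x | F₂ x ≤ 1} := h₂.isCompact_le_one.isClosed.measurableSet
  -- By the sign condition the weight is nonnegative on points lying only in the first body and
  -- nonpositive on points lying only in the second, so `g` is nonnegative with integral zero.
  set g : E3 → ℝ := fun y => Set.indicator {x | F₁ x ≤ 1} w y - Set.indicator {x | F₂ x ≤ 1} w y
    with hg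
  have hgi : Integrable g := (hi₁.integrable_indicator hm₁).sub (hi₂.integrable_indicator hm₂)
  have hg0 : ∫ y, g y = 0 := by
    rw [hg, integral_sub (hi₁.integrable_indicator hm₁) (hi₂.integrable_indicator hm₂),
      integral_indicator hm₁, integral_indicator hm₂, heq, sub_self]
  have hgn : ∀ y, 0 ≤ g y := by
    intro y
    simp only [hg, Set.indicator, Set.mem_ofPred_eq]
    split_ifs with ha hb hb
    · simp
    · rw [sub_zero]
      exact nonneg_of_mul_nonneg_left (hsign y) (by linarith)
    · have := hsign y
      rw [zero_sub, neg_nonneg]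
      by_contra hc
      push Not at hc
      nlinarith
    · simp
  -- Rescaling `x` puts it strictly inside one body and strictly outside the other, where `g` is
  -- nonzero on a whole neighborhood.
  have key : ∃ z, z ≠ 0 ∧ ∀ᶠ y in 𝓝 z, y ∈ Function.support g := by
    have scale : ∀ a b : ℝ, 0 < a → a < b → ∃ t : ℝ, 0 < t ∧ t ^ 4 * a < 1 ∧ 1 < t ^ 4 * b := by
      intro a b ha hab
      obtain ⟨s, hs1, hs2⟩ := exists_between (one_div_lt_one_div_of_lt ha hab)
      have hs0 : 0 < s := (one_div_pos.mpr (ha.trans hab)).trans hs1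
      refine ⟨s ^ (4⁻¹ : ℝ), by positivity, ?_, ?_⟩
      · have := Real.rpow_inv_natCast_pow hs0.le (n := 4) (by norm_num)
        push_cast at this
        rw [this]
        rwa [lt_div_iff₀ ha] at hs2
      · have := Real.rpow_inv_natCast_pow hs0.le (n := 4) (by norm_num)
        push_cast at this
        rw [this]
        rwa [div_lt_iff₀ (ha.trans hab)] at hs1
    rcases pos_and_pos_or_neg_and_neg_of_mul_pos hpos with ⟨hwx, hFx⟩ | ⟨hwx, hFx⟩
    · obtain ⟨t, ht, h3, h4⟩ := scale _ _ (h₁.pos x hx) (sub_pos.mp hFx)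
      rw [← h₁.smul t ht.le] at h3
      rw [← h₂.smul t ht.le] at h4
      have htx : t • x ≠ 0 := smul_ne_zero ht.ne' hx
      refine ⟨t • x, htx, ?_⟩
      filter_upwards [(h₁.continuous.continuousAt).eventually (gt_mem_nhds h3),
        (h₂.continuous.continuousAt).eventually (lt_mem_nhds h4),
        (hw _ htx).eventually (lt_mem_nhds (b := w (t • x)) (a := 0)
          (by rw [hhom t ht]; positivity))] with y hy1 hy2 hy3
      have h5 : y ∈ {x | F₁ x ≤ 1} := hy1.le
      have h6 : y ∉ {x | F₂ x ≤ 1} := not_le.mpr hy2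
      simp only [Function.mem_support, hg, Set.indicator_of_mem h5, Set.indicator_of_notMem h6]
      simpa using hy3.ne'
    · obtain ⟨t, ht, h3, h4⟩ := scale _ _ (h₂.pos x hx) (sub_neg.mp hFx)
      rw [← h₂.smul t ht.le] at h3
      rw [← h₁.smul t ht.le] at h4
      have htx : t • x ≠ 0 := smul_ne_zero ht.ne' hx
      refine ⟨t • x, htx, ?_⟩
      filter_upwards [(h₂.continuous.continuousAt).eventually (gt_mem_nhds h3),
        (h₁.continuous.continuousAt).eventually (lt_mem_nhds h4),
        (hw _ htx).eventually (eventually_lt_nhds (show w (t • x) < 0 by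
          rw [hhom t ht]; exact mul_neg_of_pos_of_neg ht hwx))] with y hy1 hy2 hy3
      have h5 : y ∈ {x | F₂ x ≤ 1} := hy1.le
      have h6 : y ∉ {x | F₁ x ≤ 1} := not_le.mpr hy2
      simp only [Function.mem_support, hg, Set.indicator_of_mem h5, Set.indicator_of_notMem h6]
      simpa using hy3.ne
  obtain ⟨z, -, hz⟩ := key
  have : 0 < ∫ y, g y := by
    rw [integral_pos_iff_support_of_nonneg hgn hgi]
    exact Measure.measure_pos_of_mem_nhds volume hz
  exact this.ne' hg0

/-- The linear isometries that preserve the body `{F ≤ 1}`. -/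
def gaugeSymm (F : E3 → ℝ) : Subgroup (E3 ≃ₗᵢ[ℝ] E3) where
  carrier := {L | ∀ x, F (L x) = F x}
  one_mem' := fun _ => rfl
  mul_mem' := by
    intro a b ha hb x
    exact (ha (b x)).trans (hb x)
  inv_mem' := by
    intro a ha x
    have := ha (a⁻¹ x)
    rw [← this]
    congr 1
    exact a.apply_symm_apply x

/-- The boundary points of `{F ≤ 1}` whose position vector is normal to the boundary. -/
def equilibriumSet (F : E3 → ℝ) : Set E3 :=
  {x | F x = 1 ∧ ∀ y, F y ≤ 1 → inner ℝ x (y - x) ≤ 0}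

theorem mem_equilibriumSet_of_symm {L : E3 ≃ₗᵢ[ℝ] E3} (hL : L ∈ gaugeSymm F) {x : E3}
    (hx : x ∈ equilibriumSet F) : L x ∈ equilibriumSet F := by
  refine ⟨(hL x).trans hx.1, fun y hy => ?_⟩
  have h1 : F (L.symm y) ≤ 1 := by
    rw [← hL (L.symm y), L.apply_symm_apply]
    exact hy
  have h2 := hx.2 _ h1
  rw [← L.inner_map_map, map_sub, L.apply_symm_apply] at h2
  exact h2

/-- Short segments from `x` into the body cannot increase the norm, and by Cauchy-Schwarz they then
do not increase the pairing with `x`. -/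
theorem IsQuarticGauge.mem_equilibriumSet_of_localMax (hF : IsQuarticGauge F) {x : E3}
    (hx : F x = 1) (h : ∀ᶠ y in 𝓝 x, F y ≤ 1 → ‖y‖ ≤ ‖x‖) : x ∈ equilibriumSet F := by
  refine ⟨hx, fun y hy => ?_⟩
  have hc : ContinuousAt (fun t : ℝ => x + t • (y - x)) 0 := by fun_prop
  have h1 : ∀ᶠ t in 𝓝[>] (0 : ℝ), (F (x + t • (y - x)) ≤ 1 → ‖x + t • (y - x)‖ ≤ ‖x‖) ∧ t < 1 := by
    apply Filter.Eventually.filter_mono nhdsWithin_le_nhds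
    refine (hc.eventually (p := fun z => F z ≤ 1 → ‖z‖ ≤ ‖x‖) ?_).and (eventually_lt_nhds one_pos)
    simpa using h
  obtain ⟨t, ⟨ht, ht1⟩, ht0⟩ := (h1.and self_mem_nhdsWithin).exists
  have ht0 : 0 < t := ht0
  have h2 : F (x + t • (y - x)) ≤ 1 := by
    have := hF.convex.2 (Set.mem_univ x) (Set.mem_univ y) (show 0 ≤ 1 - t by linarith) ht0.le
      (by ring)
    rw [show (1 - t) • x + t • y = x + t • (y - x) by module, hx] at this
    simp only [smul_eq_mul] at this
    nlinarith
  have h3 := ht h2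
  have h4 : inner ℝ x (x + t • (y - x)) ≤ ‖x‖ * ‖x‖ :=
    (real_inner_le_norm _ _).trans (by gcongr)
  rw [inner_add_right, real_inner_self_eq_norm_mul_norm, inner_smul_right] at h4
  exact nonpos_of_mul_nonpos_right (by linarith) ht0

/-- The open sublevel set is separated from `x`; a point of the closed body is the limit of its
multiples by `t < 1`, which lie in the open set. -/
theorem IsQuarticGauge.exists_support (hF : IsQuarticGauge F) {x : E3} (hx : F x = 1) :
    ∃ n : E3, n ≠ 0 ∧ ∀ y, F y ≤ 1 → inner ℝ n y ≤ inner ℝ n x := by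
  have hconv : Convex ℝ {y | F y < 1} := by
    simpa using hF.convex.convex_lt 1
  obtain ⟨f, hf⟩ := geometric_hahn_banach_open_point hconv
    (isOpen_lt hF.continuous continuous_const) (x := x) (by simp [hx])
  set n := (InnerProductSpace.toDual ℝ E3).symm f with hn
  have hfn : ∀ y, inner ℝ n y = f y := fun y => InnerProductSpace.toDual_symm_apply
  have h0 : 0 < f x := by
    have := hf 0 (by simp [hF.apply_zero])
    simpa using this
  refine ⟨n, fun hn0 => ?_, fun y hy => ?_⟩
  · rw [← hfn, hn0, inner_zero_left] at h0
    exact h0.ne rfl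
  · rw [hfn, hfn]
    have hlim : Filter.Tendsto (fun t : ℝ => f (t • y)) (𝓝[<] 1) (𝓝 (f y)) := by
      have hc : Continuous (fun t : ℝ => f (t • y)) := by fun_prop
      have := (hc.tendsto 1).mono_left (nhdsWithin_le_nhds (s := Set.Iio 1))
      simpa using this
    refine le_of_tendsto hlim ?_
    filter_upwards [Ioo_mem_nhdsLT (zero_lt_one' ℝ)] with t ht
    refine (hf _ ?_).le
    change F (t • y) < 1
    rw [hF.smul t ht.1.le]
    have : t ^ 4 < 1 := pow_lt_one₀ ht.1.le ht.2 (by norm_num)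
    nlinarith [hF.nonneg y, pow_pos ht.1 4]

/-- Let `n` be a supporting normal. A short step from `x` towards the point of norm `‖x‖` in
direction `n` stays in the ball of radius `‖x‖`, hence in the body. The support inequality then
forces equality in Cauchy-Schwarz, so `x` is parallel to `n`. -/
theorem IsQuarticGauge.mem_equilibriumSet_of_localMin (hF : IsQuarticGauge F) {x : E3}
    (hx : F x = 1) (h : ∀ᶠ y in 𝓝 x, ‖y‖ ≤ ‖x‖ → F y ≤ 1) : x ∈ equilibriumSet F := by
  obtain ⟨n, hn, hsup⟩ := hF.exists_support hx
  have hn' : 0 < ‖n‖ := norm_pos_iff.mpr hn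
  have hc : ContinuousAt (fun t : ℝ => (1 - t) • x + (t * ‖x‖ / ‖n‖) • n) 0 := by fun_prop
  have h1 : ∀ᶠ t in 𝓝[>] (0 : ℝ), (‖(1 - t) • x + (t * ‖x‖ / ‖n‖) • n‖ ≤ ‖x‖ →
      F ((1 - t) • x + (t * ‖x‖ / ‖n‖) • n) ≤ 1) ∧ t < 1 := by
    apply Filter.Eventually.filter_mono nhdsWithin_le_nhds
    refine (hc.eventually (p := fun z => ‖z‖ ≤ ‖x‖ → F z ≤ 1) ?_).and (eventually_lt_nhds one_pos)
    simpa using h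
  obtain ⟨t, ⟨ht, ht1⟩, ht0⟩ := (h1.and self_mem_nhdsWithin).exists
  have ht0 : 0 < t := ht0
  have h2 : ‖(1 - t) • x + (t * ‖x‖ / ‖n‖) • n‖ ≤ ‖x‖ := by
    refine (norm_add_le _ _).trans ?_
    rw [norm_smul, norm_smul, Real.norm_of_nonneg (by linarith),
      Real.norm_of_nonneg (by positivity)]
    field_simp
    linarith
  have h3 := hsup _ (ht h2)
  rw [inner_add_right, inner_smul_right, inner_smul_right, real_inner_self_eq_norm_mul_norm] at h3
  have h4 : ‖n‖ * ‖x‖ ≤ inner ℝ n x := by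
    have : t * ‖x‖ / ‖n‖ * (‖n‖ * ‖n‖) = t * (‖n‖ * ‖x‖) := by field_simp
    rw [this] at h3
    nlinarith
  have h5 := inner_eq_norm_mul_iff_real.mp (le_antisymm (real_inner_le_norm n x) h4)
  refine ⟨hx, fun y hy => ?_⟩
  have h6 : ‖n‖ * inner ℝ x (y - x) ≤ 0 := by
    rw [← real_inner_smul_left, ← h5, real_inner_smul_left, inner_sub_right]
    exact mul_nonpos_of_nonneg_of_nonpos (norm_nonneg _) (by linarith [hsup y hy])
  exact nonpos_of_mul_nonpos_right h6 hn'

end Gauge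

/-! ### Infinite groups of isometries have elements near the identity -/

section SmallElements

/-- An infinite set of linear isometries of a finite-dimensional space contains distinct elements
that are arbitrarily close to each other. -/
theorem exists_ne_close_of_infinite {s : Set (E3 ≃ₗᵢ[ℝ] E3)} (hs : s.Infinite) {δ : ℝ}
    (hδ : 0 < δ) : ∃ g ∈ s, ∃ g' ∈ s, g ≠ g' ∧ ∀ x, ‖g' x - g x‖ ≤ δ * ‖x‖ := by
  let ι : (E3 ≃ₗᵢ[ℝ] E3) → (E3 →L[ℝ] E3) := fun g => g.toContinuousLinearEquiv.toContinuousLinearMap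
  have hι : ∀ g x, ι g x = g x := fun _ _ => rfl
  have hball : ∀ g, ι g ∈ Metric.closedBall (0 : E3 →L[ℝ] E3) 1 := by
    intro g
    rw [mem_closedBall_zero_iff]
    refine ContinuousLinearMap.opNorm_le_bound _ zero_le_one fun x => ?_
    rw [hι, g.norm_map, one_mul]
  -- Pigeonhole: of infinitely many operators in a compact ball, two share one of finitely many
  -- balls of radius `δ / 2`.
  obtain ⟨t, -, htf, ht⟩ := (isCompact_closedBall (0 : E3 →L[ℝ] E3) 1).finite_cover_balls
    (half_pos hδ)
  have hc : ∀ g, ∃ c ∈ t, ι g ∈ Metric.ball c (δ / 2) := by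
    intro g
    simpa using ht (hball g)
  choose c hct hcb using hc
  obtain ⟨g, hg, g', hg', hne, heq⟩ :=
    hs.exists_ne_map_eq_of_mapsTo (f := c) (t := t) (fun g _ => hct g) htf
  refine ⟨g, hg, g', hg', hne, fun x => ?_⟩
  have h1 : ‖ι g' - ι g‖ ≤ δ := by
    rw [← dist_eq_norm]
    have h2 := hcb g'
    have h3 := hcb g
    rw [Metric.mem_ball] at h2 h3
    rw [← heq] at h2
    linarith [dist_triangle_right (ι g') (ι g) (c g)]
  have h2 := (ι g' - ι g).le_of_opNorm_le h1 x
  simpa [hι] using h2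

theorem exists_near_one_of_infinite {G : Subgroup (E3 ≃ₗᵢ[ℝ] E3)}
    (hG : (G : Set (E3 ≃ₗᵢ[ℝ] E3)).Infinite) {δ : ℝ} (hδ : 0 < δ) :
    ∃ h ∈ G, h ≠ 1 ∧ ∀ x, ‖h x - x‖ ≤ δ * ‖x‖ := by
  obtain ⟨g, hg, g', hg', hne, hclose⟩ := exists_ne_close_of_infinite hG hδ
  refine ⟨g⁻¹ * g', G.mul_mem (G.inv_mem hg) hg', fun h => hne (inv_mul_eq_one.mp h), fun x => ?_⟩
  have h1 : (g⁻¹ * g') x - x = g.symm (g' x - g x) := by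
    rw [map_sub, g.symm_apply_apply]
    rfl
  rw [h1, g.symm.norm_map]
  exact hclose x

end SmallElements

/-! ### Orthonormal frames and rotations about an axis -/

section Frame

variable (b : OrthonormalBasis (Fin 3) ℝ E3)

theorem frame_expand (x : E3) :
    x = inner ℝ (b 0) x • b 0 + inner ℝ (b 1) x • b 1 + inner ℝ (b 2) x • b 2 := by
  have := b.sum_repr' x
  rw [Fin.sum_univ_three] at this
  exact this.symm

theorem frame_inner (i j : Fin 3) : inner ℝ (b i) (b j) = if i = j then (1 : ℝ) else 0 :=
  orthonormal_iff_ite.mp b.orthonormal i j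

theorem frame_inner_combo (x y z : ℝ) :
    inner ℝ (b 0) (x • b 0 + y • b 1 + z • b 2) = x ∧
    inner ℝ (b 1) (x • b 0 + y • b 1 + z • b 2) = y ∧
    inner ℝ (b 2) (x • b 0 + y • b 1 + z • b 2) = z := by
  simp [inner_add_right, inner_smul_right, frame_inner b]

theorem frame_ext {x y : E3} (h0 : inner ℝ (b 0) x = inner ℝ (b 0) y)
    (h1 : inner ℝ (b 1) x = inner ℝ (b 1) y) (h2 : inner ℝ (b 2) x = inner ℝ (b 2) y) : x = y := by
  rw [frame_expand b x, frame_expand b y, h0, h1, h2]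

theorem frame_norm_sq (x : E3) :
    ‖x‖ ^ 2 = inner ℝ (b 0) x ^ 2 + inner ℝ (b 1) x ^ 2 + inner ℝ (b 2) x ^ 2 := by
  have := b.sum_sq_norm_inner_right x
  rw [Fin.sum_univ_three] at this
  simp only [Real.norm_eq_abs, sq_abs] at this
  exact this.symm

/-- The rotation by `θ` about the first vector of the frame. -/
noncomputable def axisRot (θ : ℝ) (x : E3) : E3 :=
  inner ℝ (b 0) x • b 0 + (Real.cos θ * inner ℝ (b 1) x - Real.sin θ * inner ℝ (b 2) x) • b 1 +
    (Real.sin θ * inner ℝ (b 1) x + Real.cos θ * inner ℝ (b 2) x) • b 2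

theorem axisRot_inner (θ : ℝ) (x : E3) :
    inner ℝ (b 0) (axisRot b θ x) = inner ℝ (b 0) x ∧
    inner ℝ (b 1) (axisRot b θ x)
      = Real.cos θ * inner ℝ (b 1) x - Real.sin θ * inner ℝ (b 2) x ∧
    inner ℝ (b 2) (axisRot b θ x)
      = Real.sin θ * inner ℝ (b 1) x + Real.cos θ * inner ℝ (b 2) x :=
  frame_inner_combo b _ _ _

theorem axisRot_zero (x : E3) : axisRot b 0 x = x := by
  obtain ⟨h0, h1, h2⟩ := axisRot_inner b 0 x
  refine frame_ext b h0 ?_ ?_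
  · rw [h1]; simp
  · rw [h2]; simp

theorem axisRot_add (θ θ' : ℝ) (x : E3) : axisRot b (θ + θ') x = axisRot b θ (axisRot b θ' x) := by
  obtain ⟨h0, h1, h2⟩ := axisRot_inner b (θ + θ') x
  obtain ⟨k0, k1, k2⟩ := axisRot_inner b θ (axisRot b θ' x)
  obtain ⟨l0, l1, l2⟩ := axisRot_inner b θ' x
  refine frame_ext b (by rw [h0, k0, l0]) ?_ ?_
  · rw [h1, k1, l1, l2, Real.cos_add, Real.sin_add]; ring
  · rw [h2, k2, l1, l2, Real.cos_add, Real.sin_add]; ring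

/-- The angles of the rotations about the first frame vector that preserve `F`. -/
def rotAngles (F : E3 → ℝ) : AddSubgroup ℝ where
  carrier := {θ | ∀ x, F (axisRot b θ x) = F x}
  zero_mem' := fun x => by rw [axisRot_zero]
  add_mem' := by
    intro θ θ' h h' x
    rw [axisRot_add, h, h']
  neg_mem' := by
    intro θ h x
    rw [← h, ← axisRot_add, add_neg_cancel, axisRot_zero]

/-- A linear isometry close to the identity and fixing a vector is a rotation by a small angle. -/
theorem exists_axisRot_eq {h : E3 ≃ₗᵢ[ℝ] E3} (h0 : h (b 0) = b 0) {δ : ℝ} (hδ1 : δ ≤ 1)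
    (hδ : ∀ x, ‖h x - x‖ ≤ δ * ‖x‖) :
    ∃ s : ℝ, |s| ≤ δ ∧ ∀ x, h x = axisRot b (Real.arcsin s) x := by
  have hb1 : ∀ i, ‖b i‖ = 1 := fun i => b.norm_eq_one i
  have hbd : ∀ i j, |inner ℝ (b i) (h (b j) - b j)| ≤ δ := by
    intro i j
    have h1 := abs_real_inner_le_norm (b i) (h (b j) - b j)
    have h2 := hδ (b j)
    rw [hb1, mul_one] at h2
    rw [hb1, one_mul] at h1
    exact h1.trans h2
  have hz : ∀ j, j ≠ 0 → inner ℝ (b 0) (h (b j)) = 0 := by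
    intro j hj
    conv_lhs => rw [← h0]
    rw [h.inner_map_map, frame_inner, if_neg hj.symm]
  set c := inner ℝ (b 1) (h (b 1)) with hc
  set s := inner ℝ (b 2) (h (b 1)) with hs
  set s' := inner ℝ (b 1) (h (b 2)) with hs'
  set c' := inner ℝ (b 2) (h (b 2)) with hc'
  have e1 : h (b 1) = (0 : ℝ) • b 0 + c • b 1 + s • b 2 := by
    rw [frame_expand b (h (b 1)), hz 1 (by decide)]
  have e2 : h (b 2) = (0 : ℝ) • b 0 + s' • b 1 + c' • b 2 := by
    rw [frame_expand b (h (b 2)), hz 2 (by decide)]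
  have n1 : c ^ 2 + s ^ 2 = 1 := by
    have := frame_norm_sq b (h (b 1))
    rw [hz 1 (by decide), h.norm_map, hb1, ← hc, ← hs] at this
    linarith
  have n2 : s' ^ 2 + c' ^ 2 = 1 := by
    have := frame_norm_sq b (h (b 2))
    rw [hz 2 (by decide), h.norm_map, hb1, ← hc', ← hs'] at this
    linarith
  have n3 : c * s' + s * c' = 0 := by
    have h3 : inner ℝ (h (b 1)) (h (b 2)) = (0 : ℝ) := by
      rw [h.inner_map_map, frame_inner]; simp
    rw [e1] at h3
    simp only [inner_add_left, real_inner_smul_left, ← hs', ← hc', zero_mul, zero_add] at h3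
    exact h3
  -- Closeness to the identity makes both diagonal entries nonnegative, which rules out a reflection
  -- with `c' = -c ≠ 0`. The case `c = 0` is excluded below because `‖h (b 1) - b 1‖ ^ 2` would be
  -- `2`.
  have hcnn : 0 ≤ c := by
    have := abs_le.mp (hbd 1 1)
    rw [inner_sub_right, frame_inner] at this
    simp only [if_true, ← hc] at this
    linarith
  have hcnn' : 0 ≤ c' := by
    have := abs_le.mp (hbd 2 2)
    rw [inner_sub_right, frame_inner] at this
    simp only [if_true, ← hc'] at this
    linarith
  have hcc : c' = c := by
    have h4 : c' ^ 2 = c ^ 2 := by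
      have h5 : c ^ 2 * s' ^ 2 = s ^ 2 * c' ^ 2 := by
        have : c * s' = -(s * c') := by linarith
        rw [← mul_pow, this]; ring
      linear_combination -c' ^ 2 * n1 + c ^ 2 * n2 - h5
    exact (pow_left_inj₀ hcnn' hcnn (by norm_num)).mp h4
  have hsd : |s| ≤ δ := by
    have := hbd 2 1
    rw [inner_sub_right, frame_inner] at this
    simpa using this
  have hs1 := abs_le.mp (hsd.trans hδ1)
  have hcos : Real.cos (Real.arcsin s) = c := by
    rw [Real.cos_arcsin, show 1 - s ^ 2 = c ^ 2 by linarith, Real.sqrt_sq hcnn]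
  have hsin : Real.sin (Real.arcsin s) = s := Real.sin_arcsin hs1.1 hs1.2
  have hss : s' = -s := by
    rcases hcnn.eq_or_lt with h6 | h6
    · exfalso
      have h7 := abs_le.mp (hbd 1 1)
      have h8 : ‖h (b 1) - b 1‖ ^ 2 ≤ 1 := by
        have := hδ (b 1)
        rw [hb1, mul_one] at this
        exact pow_le_one₀ (norm_nonneg _) (this.trans hδ1)
      rw [@norm_sub_sq_real, h.norm_map, hb1, real_inner_comm, ← hc, ← h6] at h8
      norm_num at h8
    · rw [hcc] at n3
      have : c * (s' + s) = 0 := by linarith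
      have := (mul_eq_zero.mp this).resolve_left h6.ne'
      linarith
  refine ⟨s, hsd, fun x => ?_⟩
  conv_lhs => rw [frame_expand b x]
  rw [map_add, map_add, map_smul, map_smul, map_smul, h0, e1, e2, axisRot, hcos, hsin, hcc, hss]
  module

end Frame

/-! ### Monotonicity of functions without interior maxima -/

section Monotone

/-- A continuous function with minimum at `0` and no local maximum inside `(0, c)` increases
strictly on `[0, c]`. -/
theorem strictMono_of_no_localMax {N : ℝ → ℝ} (hN : Continuous N) {c : ℝ}
    (hmin : ∀ θ, N 0 ≤ N θ) (hno : ∀ θ ∈ Set.Ioo 0 c, ¬ IsLocalMax N θ) {α β : ℝ}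
    (hα : 0 ≤ α) (hαβ : α < β) (hβ : β ≤ c) : N α < N β := by
  by_contra hcon
  push Not at hcon
  obtain ⟨m, hm, hmax⟩ := isCompact_Icc.exists_isMaxOn
    (Set.nonempty_Icc.mpr (hα.trans hαβ.le)) hN.continuousOn
  -- A maximizer over `[0, β]` that is interior would be a local maximum. It is not `0` either,
  -- since then the function would be constant on the interval; so only `β` remains.
  have key : ∀ θ ∈ Set.Ioo 0 β, N θ = N m → False := by
    intro θ hθ heq
    refine hno θ ⟨hθ.1, hθ.2.trans_le hβ⟩ ?_
    filter_upwards [Ioo_mem_nhds hθ.1 hθ.2] with y hy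
    rw [heq]
    exact hmax ⟨hy.1.le, hy.2.le⟩
  have h0 : N 0 ≠ N m := by
    intro h0
    have hβ2 : β / 2 ∈ Set.Icc 0 β := ⟨by linarith, by linarith⟩
    exact key (β / 2) ⟨by linarith, by linarith⟩ (le_antisymm (hmax hβ2) (h0 ▸ hmin _))
  have hm0 : 0 < m := lt_of_le_of_ne hm.1 (by rintro rfl; exact h0 rfl)
  rcases hm.2.eq_or_lt with rfl | hmβ
  · have h1 : N α = N m := le_antisymm (hmax ⟨hα, hαβ.le⟩) hcon
    have hα0 : 0 < α := lt_of_le_of_ne hα (by rintro rfl; exact h0 h1)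
    exact key α ⟨hα0, hαβ⟩ h1
  · exact key m ⟨hm0, hmβ⟩ rfl

end Monotone

/-! ### Bodies of revolution with all equilibria on the axis -/

section Revolution

open InnerProductGeometry

variable (b : OrthonormalBasis (Fin 3) ℝ E3)

/-- The meridian through the first two frame vectors. -/
noncomputable def meridian (θ : ℝ) : E3 := Real.cos θ • b 0 + Real.sin θ • b 1

theorem meridian_inner (θ : ℝ) : inner ℝ (b 0) (meridian b θ) = Real.cos θ ∧
    inner ℝ (b 1) (meridian b θ) = Real.sin θ ∧ inner ℝ (b 2) (meridian b θ) = 0 := by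
  have := frame_inner_combo b (Real.cos θ) (Real.sin θ) 0
  simpa [meridian] using this

theorem norm_meridian (θ : ℝ) : ‖meridian b θ‖ = 1 := by
  have h := frame_norm_sq b (meridian b θ)
  obtain ⟨h0, h1, h2⟩ := meridian_inner b θ
  rw [h0, h1, h2] at h
  have : ‖meridian b θ‖ ^ 2 = 1 := by
    rw [h]; linarith [Real.sin_sq_add_cos_sq θ]
  exact (pow_eq_one_iff_of_nonneg (norm_nonneg _) (by norm_num)).mp this

theorem exists_cos_sin {x y : ℝ} (h : x ^ 2 + y ^ 2 = 1) :
    ∃ α, Real.cos α = x ∧ Real.sin α = y := by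
  have hn : ‖(⟨x, y⟩ : ℂ)‖ = 1 := by
    rw [Complex.norm_def, Complex.normSq_mk, ← sq, ← sq, h, Real.sqrt_one]
  have hne : (⟨x, y⟩ : ℂ) ≠ 0 := by
    intro h0
    rw [h0] at hn
    simp at hn
  refine ⟨Complex.arg ⟨x, y⟩, ?_, ?_⟩
  · rw [Complex.cos_arg hne, hn]; simp
  · rw [Complex.sin_arg, hn]; simp

/-- Every vector is a rotated multiple of a point of the meridian. -/
theorem exists_axisRot_meridian {y : E3} (hy : y ≠ 0) :
    ∃ α, y = ‖y‖ • axisRot b α (meridian b (angle (b 0) y)) := by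
  have hn : 0 < ‖y‖ := norm_pos_iff.mpr hy
  set θ := angle (b 0) y with hθ
  have hcos : ‖y‖ * Real.cos θ = inner ℝ (b 0) y := by
    have := cos_angle_mul_norm_mul_norm (b 0) y
    rw [b.norm_eq_one, one_mul] at this
    linarith
  have hsn : 0 ≤ Real.sin θ := sin_angle_nonneg _ _
  have hsq : (‖y‖ * Real.sin θ) ^ 2 = inner ℝ (b 1) y ^ 2 + inner ℝ (b 2) y ^ 2 := by
    have h1 := frame_norm_sq b y
    have h2 := Real.sin_sq_add_cos_sq θ
    rw [← hcos] at h1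
    linear_combination ‖y‖ ^ 2 * h2 + h1
  obtain ⟨α, h1, h2⟩ : ∃ α, ‖y‖ * Real.sin θ * Real.cos α = inner ℝ (b 1) y ∧
      ‖y‖ * Real.sin θ * Real.sin α = inner ℝ (b 2) y := by
    rcases (mul_nonneg hn.le hsn).eq_or_lt with h0 | h0
    · rw [← h0] at hsq
      refine ⟨0, ?_, ?_⟩ <;> rw [← h0] <;> nlinarith
    · obtain ⟨α, h1, h2⟩ := exists_cos_sin
        (x := inner ℝ (b 1) y / (‖y‖ * Real.sin θ)) (y := inner ℝ (b 2) y / (‖y‖ * Real.sin θ))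
        (by rw [div_pow, div_pow, ← add_div, ← hsq, div_self (by positivity)])
      refine ⟨α, ?_, ?_⟩
      · rw [h1, mul_div_cancel₀ _ h0.ne']
      · rw [h2, mul_div_cancel₀ _ h0.ne']
  refine ⟨α, ?_⟩
  obtain ⟨k0, k1, k2⟩ := axisRot_inner b α (meridian b θ)
  obtain ⟨l0, l1, l2⟩ := meridian_inner b θ
  refine frame_ext b ?_ ?_ ?_ <;> rw [inner_smul_right]
  · rw [k0, l0, hcos]
  · rw [k1, l1, l2, ← h1]; ring
  · rw [k2, l1, l2, ← h2]; ring

variable {F : E3 → ℝ}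

theorem IsQuarticGauge.eq_meridian (hF : IsQuarticGauge F) (hrot : rotAngles b F = ⊤) {y : E3}
    (hy : y ≠ 0) : F y = ‖y‖ ^ 4 * F (meridian b (angle (b 0) y)) := by
  obtain ⟨α, hα⟩ := exists_axisRot_meridian b hy
  have h1 : α ∈ rotAngles b F := by rw [hrot]; trivial
  conv_lhs => rw [hα]
  rw [hF.smul _ (norm_nonneg _), h1]

/-- A body of revolution whose equilibria all lie on the axis does not have its center of mass at
the origin. -/
theorem IsQuarticGauge.false_of_revolution (hF : IsQuarticGauge F) (hrot : rotAngles b F = ⊤)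
    {x₀ : E3} (hx₀ : F x₀ = 1) (hmax : ∀ y, F y ≤ 1 → ‖y‖ ≤ ‖x₀‖) (hdir : x₀ = ‖x₀‖ • b 0)
    (haxis : ∀ x ∈ equilibriumSet F, inner ℝ (b 1) x = 0)
    (hmom : ∫ x in {x | F x ≤ 1}, inner ℝ (b 0) x = 0) : False := by
  set N : ℝ → ℝ := fun θ => F (meridian b θ) with hN
  have hNc : Continuous N := by
    refine hF.continuous.comp ?_
    unfold meridian
    fun_prop
  have hm0 : ∀ θ, meridian b θ ≠ 0 := fun θ h => by
    have := norm_meridian b θ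
    rw [h] at this
    simp at this
  -- The farthest point lies in direction `b 0`, and a larger radius means a smaller gauge.
  have hmin : ∀ θ, N 0 ≤ N θ := by
    intro θ
    obtain ⟨t, ht, ht1⟩ := hF.exists_smul_eq_one (hm0 θ)
    have h1 := hmax (t • meridian b θ) (by rw [hF.smul t ht.le, ht1])
    rw [norm_smul, norm_meridian, mul_one, Real.norm_of_nonneg ht.le] at h1
    have h2 : ‖x₀‖ ^ 4 * N 0 = 1 := by
      rw [← hx₀]
      conv_rhs => rw [hdir, hF.smul _ (norm_nonneg _)]
      simp [hN, meridian]
    have h3 : t ^ 4 ≤ ‖x₀‖ ^ 4 := by gcongr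
    have h4 : 0 < t ^ 4 := by positivity
    have h5 : t ^ 4 * N 0 ≤ t ^ 4 * N θ := by
      rw [show t ^ 4 * N θ = 1 from ht1, ← h2]
      have : 0 ≤ N 0 := hF.nonneg _
      gcongr
    exact le_of_mul_le_mul_left h5 h4
  -- Such a maximum is a boundary point locally closest to the origin, because `F` depends only on
  -- the norm and the angle to the axis. It would be an equilibrium off the axis.
  have hno : ∀ θ ∈ Set.Ioo 0 Real.pi, ¬ IsLocalMax N θ := by
    intro θ hθ hloc
    obtain ⟨t, ht, ht1⟩ := hF.exists_smul_eq_one (hm0 θ)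
    have hxn : ‖t • meridian b θ‖ = t := by
      rw [norm_smul, norm_meridian, mul_one, Real.norm_of_nonneg ht.le]
    have hx0 : t • meridian b θ ≠ 0 := smul_ne_zero ht.ne' (hm0 θ)
    have hang : angle (b 0) (t • meridian b θ) = θ := by
      rw [angle_smul_right_of_pos _ _ ht, angle, (meridian_inner b θ).1, norm_meridian,
        b.norm_eq_one, mul_one, div_one, Real.arccos_cos hθ.1.le hθ.2.le]
    have hmem : t • meridian b θ ∈ equilibriumSet F := by
      refine hF.mem_equilibriumSet_of_localMin (by rw [hF.smul t ht.le, ht1]) ?_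
      have hcont : ContinuousAt (fun y => angle (b 0) y) (t • meridian b θ) :=
        ContinuousAt.comp (f := fun y : E3 => (b 0, y)) (g := fun y : E3 × E3 => angle y.1 y.2)
          (continuousAt_angle (x := (b 0, t • meridian b θ)) (b.orthonormal.ne_zero 0) hx0)
          (by fun_prop)
      have hev : ∀ᶠ y in 𝓝 (t • meridian b θ), N (angle (b 0) y) ≤ N θ := by
        have : ∀ᶠ a in 𝓝 (angle (b 0) (t • meridian b θ)), N a ≤ N θ := by
          rw [hang]; exact hloc
        exact hcont.eventually this
      filter_upwards [hev, eventually_ne_nhds hx0] with y hy hy0 hle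
      rw [hF.eq_meridian b hrot hy0, ← ht1]
      rw [hxn] at hle
      have h6 : 0 ≤ N (angle (b 0) y) := hF.nonneg _
      calc ‖y‖ ^ 4 * N (angle (b 0) y) ≤ t ^ 4 * N θ := by gcongr
        _ = _ := rfl
    have h7 := haxis _ hmem
    rw [inner_smul_right, (meridian_inner b θ).2.1] at h7
    exact (mul_pos ht (Real.sin_pos_of_mem_Ioo hθ)).ne' h7
  set σ := (ℝ ∙ b 0)ᗮ.reflection with hσ
  have hσ0 : σ (b 0) = -b 0 := Submodule.reflection_orthogonalComplement_singleton_eq_neg (b 0)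
  have hσσ : ∀ y, σ (σ y) = y := fun y => Submodule.reflection_reflection _ y
  have hσi : ∀ y, inner ℝ (b 0) (σ y) = -inner ℝ (b 0) y := by
    intro y
    rw [← σ.inner_map_map, hσσ, hσ0, inner_neg_left]
  have hσang : ∀ y, angle (b 0) (σ y) = Real.pi - angle (b 0) y := by
    intro y
    rw [← σ.toLinearIsometry.angle_map]
    change angle (σ (b 0)) (σ (σ y)) = _
    rw [hσσ, hσ0, angle_neg_left]
  -- The meridian function increases strictly on `[0, π]` and `σ` replaces the angle by its
  -- supplement.
  have hlt : ∀ y, 0 < inner ℝ (b 0) y → F y < F (σ y) := by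
    intro y hy
    have hy0 : y ≠ 0 := by
      rintro rfl
      simp at hy
    have hσy0 : σ y ≠ 0 := by simpa using hy0
    rw [hF.eq_meridian b hrot hy0, hF.eq_meridian b hrot hσy0, σ.norm_map, hσang]
    have h8 : angle (b 0) y < Real.pi / 2 := by
      rw [angle, Real.arccos_lt_pi_div_two, b.norm_eq_one, one_mul]
      exact div_pos hy (norm_pos_iff.mpr hy0)
    have h9 : N (angle (b 0) y) < N (Real.pi - angle (b 0) y) :=
      strictMono_of_no_localMax hNc hmin hno (angle_nonneg _ _) (by linarith)
        (by linarith [angle_nonneg (b 0) y])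
    have h10 : 0 < ‖y‖ := norm_pos_iff.mpr hy0
    exact mul_lt_mul_of_pos_left h9 (by positivity)
  have hFσ := hF.comp_isometry σ
  have hmom' : ∫ x in {x | F (σ x) ≤ 1}, inner ℝ (b 0) x = 0 := by
    have h11 := (σ.measurePreserving).setIntegral_preimage_emb
      σ.toHomeomorph.measurableEmbedding (fun y => inner ℝ (b 0) (σ y)) {x | F x ≤ 1}
    simp only [hσσ] at h11
    have h12 : σ ⁻¹' {x | F x ≤ 1} = {x | F (σ x) ≤ 1} := rfl
    rw [h12] at h11
    rw [h11]
    simp only [hσi, integral_neg, hmom, neg_zero]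
  have hcont : Continuous (fun x : E3 => inner ℝ (b 0) x) := by fun_prop
  -- The axial coordinate has the sign of `F ∘ σ - F`, while the body and its mirror image both have
  -- zero axial moment. The separation lemma then contradicts strictness at `b 0`.
  have hfin := eq_zero_of_setIntegral_eq hF hFσ (w := fun x => inner ℝ (b 0) x)
    (fun x _ => hcont.continuousAt) (fun t _ x => inner_smul_right _ _ _)
    (hcont.continuousOn.integrableOn_compact hF.isCompact_le_one)
    (hcont.continuousOn.integrableOn_compact hFσ.isCompact_le_one) ?_
    (by rw [hmom, hmom']) (b 0)
  · have h13 : inner ℝ (b 0) (b 0) = (1 : ℝ) := by rw [frame_inner]; simp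
    have h14 := hlt (b 0) (by rw [h13]; norm_num)
    simp only [h13, one_mul] at hfin
    linarith
  · intro x
    rcases lt_trichotomy (inner ℝ (b 0) x) 0 with h | h | h
    · have h15 := hlt (σ x) (by rw [hσi]; linarith)
      rw [hσσ] at h15
      exact mul_nonneg_of_nonpos_of_nonpos h.le (by linarith)
    · simp [h]
    · have h15 := hlt x h
      exact mul_nonneg h.le (by linarith)

end Revolution

/-! ### Finiteness of the symmetry group -/

section Finiteness

variable {F : E3 → ℝ}

theorem exists_frame {e : E3} (he : ‖e‖ = 1) : ∃ b : OrthonormalBasis (Fin 3) ℝ E3, b 0 = e := by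
  have hv : Orthonormal ℝ (({0} : Set (Fin 3)).domRestrict (fun _ => e)) := by
    rw [orthonormal_iff_ite]
    rintro ⟨i, hi⟩ ⟨j, hj⟩
    have hij : i = j := by
      rw [Set.mem_singleton_iff] at hi hj
      rw [hi, hj]
    subst hij
    simp [he]
  obtain ⟨b, hb⟩ := hv.exists_orthonormalBasis_extension_of_card_eq (by simp)
  exact ⟨b, hb 0 rfl⟩

/-- A body with finitely many equilibria with respect to its center of mass has only finitely many
symmetries. -/
theorem IsQuarticGauge.finite_gaugeSymm (hF : IsQuarticGauge F) (hE : (equilibriumSet F).Finite)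
    (hmom : ∀ a : E3, ∫ x in {x | F x ≤ 1}, inner ℝ a x = 0) :
    (gaugeSymm F : Set (E3 ≃ₗᵢ[ℝ] E3)).Finite := by
  by_contra hinf
  have hinf : (gaugeSymm F : Set (E3 ≃ₗᵢ[ℝ] E3)).Infinite := hinf
  obtain ⟨x₀, hx₀, hmax⟩ := hF.isCompact_le_one.exists_isMaxOn
    ⟨0, by simp [hF.apply_zero]⟩ continuous_norm.continuousOn
  have hmax : ∀ y, F y ≤ 1 → ‖y‖ ≤ ‖x₀‖ := fun y hy => hmax hy
  have hx0 : x₀ ≠ 0 := by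
    rintro rfl
    obtain ⟨u, hu⟩ : ∃ u : E3, u ≠ 0 := exists_ne 0
    obtain ⟨t, ht, ht1⟩ := hF.exists_smul_eq_one hu
    have := hmax (t • u) (by rw [hF.smul t ht.le, ht1])
    rw [norm_zero, norm_le_zero_iff, smul_eq_zero] at this
    exact this.elim ht.ne' hu
  have hn0 : 0 < ‖x₀‖ := norm_pos_iff.mpr hx0
  have hFx₀ : F x₀ = 1 := by
    obtain ⟨t, ht, ht1⟩ := hF.exists_smul_eq_one hx0
    have h1 := hmax (t • x₀) (by rw [hF.smul t ht.le, ht1])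
    rw [norm_smul, Real.norm_of_nonneg ht.le] at h1
    have h2 : t ≤ 1 := by nlinarith
    have h3 : t ^ 4 ≤ 1 := pow_le_one₀ ht.le h2
    have h4 : F x₀ ≤ 1 := hx₀
    nlinarith [hF.pos x₀ hx0]
  have hx₀E : x₀ ∈ equilibriumSet F :=
    hF.mem_equilibriumSet_of_localMax hFx₀ (Filter.Eventually.of_forall hmax)
  obtain ⟨b, hb⟩ := exists_frame (e := ‖x₀‖⁻¹ • x₀) (norm_smul_inv_norm hx0)
  have hdir : x₀ = ‖x₀‖ • b 0 := by
    rw [hb, smul_smul, mul_inv_cancel₀ hn0.ne', one_smul]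
  -- Symmetries permute the finitely many equilibria, so one moving them by less than their smallest
  -- gap fixes them all. Fixing the direction of the farthest point, it is a rotation by a small
  -- nonzero angle.
  have hsmall : ∀ ε > 0, ∃ s : ℝ, s ≠ 0 ∧ |s| < 1 ∧ |Real.arcsin s| < ε ∧
      Real.arcsin s ∈ rotAngles b F ∧
      ∀ x ∈ equilibriumSet F, axisRot b (Real.arcsin s) x = x := by
    intro ε hε
    have hev : ∀ᶠ δ in 𝓝[>] (0 : ℝ), (∀ x ∈ equilibriumSet F, ∀ y ∈ equilibriumSet F, x ≠ y →
        δ * ‖x₀‖ < dist x y) ∧ (∀ s, |s| ≤ δ → |Real.arcsin s| < ε) ∧ δ < 1 := by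
      refine Filter.Eventually.filter_mono nhdsWithin_le_nhds ?_
      refine Filter.Eventually.and ?_ (Filter.Eventually.and ?_ (eventually_lt_nhds one_pos))
      · refine (Filter.eventually_all_finite hE).mpr fun x _ =>
          (Filter.eventually_all_finite hE).mpr fun y _ => ?_
        by_cases hxy : x = y
        · simp [hxy]
        · have hc : ContinuousAt (fun δ : ℝ => δ * ‖x₀‖) 0 := by fun_prop
          refine (hc.eventually (eventually_lt_nhds (b := dist x y) ?_)).mono fun δ h _ => h
          simpa using hxy
      · have hc : ContinuousAt (fun s => |Real.arcsin s|) 0 :=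
          (Real.continuous_arcsin.abs).continuousAt
        have h1 : ∀ᶠ s in 𝓝 (0 : ℝ), |Real.arcsin s| < ε :=
          hc.eventually (eventually_lt_nhds (by simpa using hε))
        obtain ⟨r, hr, hsub⟩ := Metric.eventually_nhds_iff.mp h1
        filter_upwards [eventually_lt_nhds hr] with δ hδ s hs
        refine hsub ?_
        rw [Real.dist_eq, sub_zero]
        linarith
    obtain ⟨δ, ⟨hδ1, hδ2, hδ3⟩, hδ0⟩ := (hev.and self_mem_nhdsWithin).exists
    obtain ⟨h, hhG, hh1, hhδ⟩ := exists_near_one_of_infinite hinf hδ0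
    have hfix : ∀ x ∈ equilibriumSet F, h x = x := by
      intro x hx
      by_contra hne
      have h1 := hδ1 _ (mem_equilibriumSet_of_symm hhG hx) _ hx hne
      rw [dist_eq_norm] at h1
      have h2 : δ * ‖x‖ ≤ δ * ‖x₀‖ := mul_le_mul_of_nonneg_left (hmax x hx.1.le) (le_of_lt hδ0)
      linarith [hhδ x]
    have hb0 : h (b 0) = b 0 := by rw [hb, map_smul, hfix x₀ hx₀E]
    obtain ⟨s, hs, hrot⟩ := exists_axisRot_eq b hb0 hδ3.le hhδ
    refine ⟨s, ?_, hs.trans_lt hδ3, hδ2 s hs, fun x => ?_, fun x hx => ?_⟩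
    · rintro rfl
      refine hh1 ?_
      ext1 x
      rw [hrot, Real.arcsin_zero, axisRot_zero]
      rfl
    · rw [← hrot, hhG]
    · rw [← hrot, hfix x hx]
  -- Arbitrarily small positive angles make the group dense; continuity of `F` makes it closed.
  have htop : rotAngles b F = ⊤ := by
    have hd : Dense (rotAngles b F : Set ℝ) := by
      refine AddSubgroup.dense_of_not_isolated_zero _ fun ε hε => ?_
      obtain ⟨s, hs0, hs1, hs2, hs3, -⟩ := hsmall ε hε
      have hne : Real.arcsin s ≠ 0 := by simpa using hs0
      rcases lt_or_gt_of_ne hne with h | h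
      · exact ⟨_, neg_mem hs3, by linarith, by rwa [abs_of_neg h] at hs2⟩
      · exact ⟨_, hs3, h, by rwa [abs_of_pos h] at hs2⟩
    have hcl : IsClosed (rotAngles b F : Set ℝ) := by
      have : (rotAngles b F : Set ℝ) = ⋂ x, {θ | F (axisRot b θ x) = F x} := by
        ext θ
        simp [rotAngles]
      rw [this]
      refine isClosed_iInter fun x => isClosed_eq (hF.continuous.comp ?_) continuous_const
      unfold axisRot
      fun_prop
    rw [← SetLike.coe_set_eq, ← hcl.closure_eq, hd.closure_eq]
    rfl
  refine hF.false_of_revolution b htop hFx₀ hmax hdir (fun x hx => ?_) (hmom _)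
  obtain ⟨s, hs0, hs1, -, -, hs⟩ := hsmall 1 one_pos
  obtain ⟨-, h1, h2⟩ := axisRot_inner b (Real.arcsin s) x
  rw [hs x hx, Real.sin_arcsin (abs_lt.mp hs1).1.le (abs_lt.mp hs1).2.le] at h1 h2
  set c := Real.cos (Real.arcsin s)
  set u := inner ℝ (b 1) x
  set v := inner ℝ (b 2) x
  -- The factor is the determinant of the planar rotation minus the identity, nonzero since `s ≠ 0`;
  -- fixed points therefore lie on the axis.
  have h3 : ((c - 1) ^ 2 + s ^ 2) * u = 0 := by
    linear_combination (-(c - 1)) * h1 - s * h2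
  have h4 : (c - 1) ^ 2 + s ^ 2 ≠ 0 := by positivity
  exact (mul_eq_zero.mp h3).resolve_left h4

end Finiteness

/-! ### Moments in polar coordinates -/

section Moment

/-- The integral over `D` of the positively homogeneous function of degree one that agrees with `P`
on the unit sphere. -/
noncomputable def moment (D : Set E3) (P : E3 → ℝ) : ℝ :=
  ∫ x in D, ‖x‖ * P (‖x‖⁻¹ • x)

theorem norm_radial_le (x : E3) : ‖‖x‖⁻¹ • x‖ ≤ 1 := by
  rw [norm_smul, norm_inv, norm_norm]
  exact inv_mul_le_one

theorem exists_bound_unitBall {P : E3 → ℝ} (hP : Continuous P) :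
    ∃ C, 0 ≤ C ∧ ∀ x : E3, ‖x‖ ≤ 1 → |P x| ≤ C := by
  obtain ⟨C, hC⟩ := (isCompact_closedBall (0 : E3) 1).exists_bound_of_continuousOn hP.continuousOn
  refine ⟨C, (norm_nonneg _).trans (hC 0 (by simp)), fun x hx => ?_⟩
  exact hC x (by simpa using hx)

theorem measurable_radial {P : E3 → ℝ} (hP : Continuous P) :
    Measurable (fun x : E3 => ‖x‖ * P (‖x‖⁻¹ • x)) := by
  refine measurable_norm.mul (hP.measurable.comp ?_)
  exact measurable_norm.inv.smul measurable_id

theorem integrableOn_radial {D : Set E3} (hD : IsCompact D) {P : E3 → ℝ} (hP : Continuous P) :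
    IntegrableOn (fun x : E3 => ‖x‖ * P (‖x‖⁻¹ • x)) D := by
  obtain ⟨C, hC0, hC⟩ := exists_bound_unitBall hP
  obtain ⟨R, hR⟩ := hD.isBounded.exists_norm_le
  refine Measure.integrableOn_of_bounded (M := R * C) hD.measure_lt_top.ne
    (measurable_radial hP).aestronglyMeasurable ?_
  filter_upwards [ae_restrict_mem hD.isClosed.measurableSet] with x hx
  rw [norm_mul, norm_norm, Real.norm_eq_abs]
  exact mul_le_mul (hR x hx) (hC _ (norm_radial_le x)) (abs_nonneg _)
    ((norm_nonneg x).trans (hR x hx))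

theorem moment_sub {D : Set E3} (hD : IsCompact D) {P Q : E3 → ℝ} (hP : Continuous P)
    (hQ : Continuous Q) : moment D (fun x => P x - Q x) = moment D P - moment D Q := by
  rw [moment, moment, moment, ← integral_sub (integrableOn_radial hD hP)
    (integrableOn_radial hD hQ)]
  simp only [mul_sub]

theorem moment_inner (D : Set E3) (a : E3) :
    moment D (fun x => inner ℝ a x) = ∫ x in D, inner ℝ a x := by
  rw [moment]
  congr 1
  ext x
  rcases eq_or_ne x 0 with rfl | hx
  · simp
  · rw [inner_smul_right, mul_inv_cancel_left₀ (norm_ne_zero_iff.mpr hx)]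

theorem moment_comp (D : Set E3) (P : E3 → ℝ) (L : E3 ≃ₗᵢ[ℝ] E3) :
    moment D (fun x => P (L x)) = moment (L '' D) P := by
  rw [moment, moment, (L.measurePreserving).setIntegral_image_emb
    L.toHomeomorph.measurableEmbedding]
  simp

theorem abs_moment_le {D : Set E3} (hD : IsCompact D) {P : E3 → ℝ} {C : ℝ}
    (hC : ∀ x : E3, ‖x‖ ≤ 1 → |P x| ≤ C) : |moment D P| ≤ C * ∫ x in D, ‖x‖ := by
  rw [moment, ← Real.norm_eq_abs, ← integral_const_mul]
  refine norm_integral_le_of_norm_le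
    ((continuous_norm.continuousOn.integrableOn_compact hD).const_mul C) ?_
  filter_upwards with x
  rw [norm_mul, norm_norm, Real.norm_eq_abs, mul_comm]
  exact mul_le_mul_of_nonneg_right (hC _ (norm_radial_le x)) (norm_nonneg x)

theorem integral_volumeIoiPow (n : ℕ) (f : ℝ → ℝ) :
    ∫ r : Set.Ioi (0 : ℝ), f r ∂(Measure.volumeIoiPow n) = ∫ r in Set.Ioi (0 : ℝ), r ^ n * f r := by
  simp only [Measure.volumeIoiPow, ENNReal.ofReal]
  rw [integral_withDensity_eq_integral_smul,
    integral_subtype_comap measurableSet_Ioi fun a ↦ Real.toNNReal (a ^ n) • f a,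
    setIntegral_congr_fun measurableSet_Ioi fun x hx ↦ ?_]
  · rw [NNReal.smul_def, Real.coe_toNNReal _ (pow_nonneg hx.out.le _), smul_eq_mul]
  · exact (measurable_subtype_coe.pow_const _).real_toNNReal

/-- The moments of a star body in polar coordinates. -/
theorem moment_eq_integral_sphere {D : Set E3} (hD : IsCompact D) {R : E3 → ℝ}
    (hR : ∀ u : E3, ‖u‖ = 1 → 0 ≤ R u)
    (hmem : ∀ u : E3, ‖u‖ = 1 → ∀ t : ℝ, 0 < t → (t • u ∈ D ↔ t ^ 4 ≤ R u))
    {P : E3 → ℝ} (hP : Continuous P) :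
    moment D P = ∫ u : Metric.sphere (0 : E3) 1, P u * R u / 4 ∂(volume.toSphere) := by
  set f : E3 → ℝ := D.indicator fun x => ‖x‖ * P (‖x‖⁻¹ • x) with hf
  have hDm := hD.isClosed.measurableSet
  have hfi : Integrable f := (integrableOn_radial hD hP).integrable_indicator hDm
  have hdim : Module.finrank ℝ E3 - 1 = 2 := by simp
  have hmp := (volume : Measure E3).measurePreserving_homeomorphUnitSphereProd
  rw [hdim] at hmp
  set g : Metric.sphere (0 : E3) 1 × Set.Ioi (0 : ℝ) → ℝ := fun z => f ((z.2 : ℝ) • (z.1 : E3))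
    with hg
  have hgc : ∀ x : ({0}ᶜ : Set E3), g (homeomorphUnitSphereProd E3 x) = f x := by
    intro x
    have : (homeomorphUnitSphereProd E3).symm (homeomorphUnitSphereProd E3 x) = x :=
      (homeomorphUnitSphereProd E3).symm_apply_apply x
    conv_rhs => rw [← this]
    rfl
  have h1 : moment D P = ∫ z, g z ∂(volume.toSphere.prod (Measure.volumeIoiPow 2)) := by
    rw [← hmp.integral_comp (Homeomorph.measurableEmbedding _)]
    simp only [hgc]
    rw [integral_subtype_comap (measurableSet_singleton _).compl fun x ↦ f x,
      restrict_compl_singleton, hf, integral_indicator hDm]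
    rfl
  have hgi : Integrable g (volume.toSphere.prod (Measure.volumeIoiPow 2)) := by
    rw [← hmp.integrable_comp_emb (Homeomorph.measurableEmbedding _)]
    have : g ∘ homeomorphUnitSphereProd E3 = f ∘ Subtype.val := funext hgc
    rw [this, ← integrableOn_iff_comap_subtypeVal (measurableSet_singleton _).compl]
    exact hfi.integrableOn
  rw [h1, integral_prod _ hgi]
  congr 1
  ext ⟨u, hu⟩
  have hu1 : ‖u‖ = 1 := by simpa using hu
  have hgu : ∀ r : Set.Ioi (0 : ℝ), g (⟨u, hu⟩, r)
      = (fun r : ℝ => (Set.Iic (R u ^ (4⁻¹ : ℝ))).indicator (fun r => r * P u) r) r := by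
    rintro ⟨r, hr⟩
    have hr : 0 < r := hr
    have hpow : (R u ^ (4⁻¹ : ℝ)) ^ 4 = R u := by
      have := Real.rpow_inv_natCast_pow (hR u hu1) (n := 4) (by norm_num)
      push_cast at this
      exact this
    have hiff : r • u ∈ D ↔ r ∈ Set.Iic (R u ^ (4⁻¹ : ℝ)) := by
      rw [hmem u hu1 r hr, Set.mem_Iic]
      conv_lhs => rw [← hpow]
      exact pow_le_pow_iff_left₀ hr.le (Real.rpow_nonneg (hR u hu1) _) (by norm_num)
    simp only [hg, hf]
    by_cases h : r • u ∈ D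
    · rw [Set.indicator_of_mem h, Set.indicator_of_mem (hiff.mp h), norm_smul, hu1, mul_one,
        Real.norm_of_nonneg hr.le, smul_smul, inv_mul_cancel₀ hr.ne', one_smul]
    · rw [Set.indicator_of_notMem h, Set.indicator_of_notMem (fun h' => h (hiff.mpr h'))]
  simp only [hgu]
  rw [integral_volumeIoiPow]
  have hR4 : 0 ≤ R u ^ (4⁻¹ : ℝ) := Real.rpow_nonneg (hR u hu1) _
  -- The Jacobian `r ^ 2` and the degree-one weight combine to `r ^ 3`, whose integral up to the
  -- radius `R u ^ (1/4)` is `R u / 4`. This is where the fourth power comes from.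
  have h2 : ∀ r : ℝ, r ^ 2 * (Set.Iic (R u ^ (4⁻¹ : ℝ))).indicator (fun r => r * P u) r
      = (Set.Iic (R u ^ (4⁻¹ : ℝ))).indicator (fun r => r ^ 3 * P u) r := by
    intro r
    by_cases h : r ∈ Set.Iic (R u ^ (4⁻¹ : ℝ))
    · rw [Set.indicator_of_mem h, Set.indicator_of_mem h]; ring
    · rw [Set.indicator_of_notMem h, Set.indicator_of_notMem h, mul_zero]
  simp only [h2]
  rw [setIntegral_indicator measurableSet_Iic, Set.Ioi_inter_Iic,
    ← intervalIntegral.integral_of_le hR4, intervalIntegral.integral_mul_const, integral_pow]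
  have hpow : (R u ^ (4⁻¹ : ℝ)) ^ 4 = R u := by
    have := Real.rpow_inv_natCast_pow (hR u hu1) (n := 4) (by norm_num)
    push_cast at this
    exact this
  rw [show (3 : ℕ) + 1 = 4 from rfl, hpow]
  norm_num
  ring

/-- The moments depend affinely on the fourth power of the radial function. -/
theorem IsQuarticGauge.moment_perturb {F : E3 → ℝ} (hF : IsQuarticGauge F) {β : E3 → ℝ}
    (hβ : Continuous β) (hβ1 : ∀ u : E3, ‖u‖ = 1 → |β u| ≤ 1) {D : Set E3} (hD : IsCompact D)
    (hmem : ∀ u : E3, ‖u‖ = 1 → ∀ t : ℝ, 0 < t → (t • u ∈ D ↔ t ^ 4 * F u ≤ 1 + β u))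
    {P : E3 → ℝ} (hP : Continuous P) :
    moment D P = moment {x | F x ≤ 1} P + moment {x | F x ≤ 1} (fun x => P x * β x) := by
  have hFu : ∀ u : E3, ‖u‖ = 1 → 0 < F u := fun u hu => hF.pos u (by
    rintro rfl
    simp at hu)
  have h0 : ∀ u : E3, ‖u‖ = 1 → ∀ t : ℝ, 0 < t → (t • u ∈ {x | F x ≤ 1} ↔ t ^ 4 ≤ 1 / F u) := by
    intro u hu t ht
    rw [Set.mem_ofPred_eq, hF.smul t ht.le, le_div_iff₀ (hFu u hu)]
  -- The fourth powers of the radial functions are `1 / F` and `(1 + β) / F`, so the claim becomes a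
  -- pointwise identity on the sphere.
  rw [moment_eq_integral_sphere hF.isCompact_le_one (fun u hu => (one_div_pos.mpr (hFu u hu)).le)
      h0 hP,
    moment_eq_integral_sphere hF.isCompact_le_one (fun u hu => (one_div_pos.mpr (hFu u hu)).le)
      h0 (P := fun x => P x * β x) (hP.mul hβ),
    moment_eq_integral_sphere hD (R := fun u => (1 + β u) / F u) ?_ ?_ hP, ← integral_add]
  · congr 1
    ext u
    ring
  · refine Continuous.integrable_of_hasCompactSupport ?_ (HasCompactSupport.of_compactSpace _)
    have hc : Continuous fun u : Metric.sphere (0 : E3) 1 => 1 / F u :=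
      continuous_const.div (hF.continuous.comp continuous_subtype_val)
        fun u => (hFu u (by simp)).ne'
    exact ((hP.comp continuous_subtype_val).mul hc).div_const 4
  · refine Continuous.integrable_of_hasCompactSupport ?_ (HasCompactSupport.of_compactSpace _)
    have hc : Continuous fun u : Metric.sphere (0 : E3) 1 => 1 / F u :=
      continuous_const.div (hF.continuous.comp continuous_subtype_val)
        fun u => (hFu u (by simp)).ne'
    exact (((hP.mul hβ).comp continuous_subtype_val).mul hc).div_const 4
  · intro u hu
    have := (abs_le.mp (hβ1 u hu)).1
    exact div_nonneg (by linarith) (hFu u hu).le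
  · intro u hu t ht
    rw [hmem u hu t ht, le_div_iff₀ (hFu u hu)]

end Moment

/-! ### Polynomial functions of bounded degree -/

section Polynomials

/-- The linear functional `⟨a, ·⟩` as a continuous function. -/
noncomputable def innerMap : E3 →ₗ[ℝ] C(E3, ℝ) where
  toFun a := ⟨fun x => inner ℝ a x, by fun_prop⟩
  map_add' a b := by ext x; simp [inner_add_left]
  map_smul' c a := by ext x; simp [inner_smul_left]

@[simp]
theorem innerMap_apply (a x : E3) : innerMap a x = inner ℝ a x := rfl

/-- The affine functions on `E3`. -/
noncomputable def affineSpace : Submodule ℝ C(E3, ℝ) := 1 ⊔ LinearMap.range innerMap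

theorem one_le_affineSpace : 1 ≤ affineSpace := le_sup_left

theorem innerMap_mem (a : E3) : innerMap a ∈ affineSpace :=
  le_sup_right (a := (1 : Submodule ℝ C(E3, ℝ))) (LinearMap.mem_range_self _ a)

/-- The `k`-th power of the affine functions consists of the polynomials of degree at most `k`. Its
finite dimension is what allows all these moments to be annihilated at once. -/
theorem fg_polynomials (k : ℕ) : (affineSpace ^ k).FG := by
  refine Submodule.FG.pow (Submodule.FG.sup ?_ ?_) k
  · exact Submodule.one_eq_span (R := ℝ) (A := C(E3, ℝ)) ▸ Submodule.fg_span_singleton 1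
  · exact Submodule.FG.of_finite

theorem polynomials_mono : Monotone fun k => affineSpace ^ k := fun _ _ h =>
  pow_le_pow_right' one_le_affineSpace h

/-- Composition with a linear isometry. -/
noncomputable def compIsometry (L : E3 ≃ₗᵢ[ℝ] E3) : C(E3, ℝ) →ₐ[ℝ] C(E3, ℝ) :=
  ContinuousMap.compRightAlgHom ℝ ℝ ⟨L, L.continuous⟩

@[simp]
theorem compIsometry_apply (L : E3 ≃ₗᵢ[ℝ] E3) (P : C(E3, ℝ)) (x : E3) :
    compIsometry L P x = P (L x) := rfl

/-- A linear substitution does not raise the degree; this makes `momentSymm` a group. -/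
theorem compIsometry_mem (L : E3 ≃ₗᵢ[ℝ] E3) {k : ℕ} {P : C(E3, ℝ)} (hP : P ∈ affineSpace ^ k) :
    compIsometry L P ∈ affineSpace ^ k := by
  have h1 : affineSpace.map (compIsometry L).toLinearMap ≤ affineSpace := by
    rw [affineSpace, Submodule.map_sup]
    refine sup_le_sup ?_ ?_
    · rw [Submodule.map_one]
    · rintro _ ⟨_, ⟨a, rfl⟩, rfl⟩
      refine ⟨L.symm a, ?_⟩
      ext x
      change inner ℝ (L.symm a) x = inner ℝ a (L x)
      rw [← L.inner_map_map, L.apply_symm_apply]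
  have h2 : (affineSpace ^ k).map (compIsometry L).toLinearMap ≤ affineSpace ^ k := by
    rw [Submodule.map_pow]
    exact pow_le_pow_left' h1 k
  exact h2 ⟨P, hP, rfl⟩

theorem exists_mem_pow_of_mem_adjoin {P : C(E3, ℝ)}
    (hP : P ∈ Algebra.adjoin ℝ (affineSpace : Set C(E3, ℝ))) : ∃ k, P ∈ affineSpace ^ k := by
  induction hP using Algebra.adjoin_induction with
  | mem x hx => exact ⟨1, by simpa using hx⟩
  | algebraMap r => exact ⟨0, by rw [pow_zero]; exact Submodule.algebraMap_mem r⟩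
  | add x y _ _ hx hy =>
    obtain ⟨j, hj⟩ := hx
    obtain ⟨k, hk⟩ := hy
    exact ⟨max j k, add_mem (polynomials_mono (le_max_left j k) hj)
      (polynomials_mono (le_max_right j k) hk)⟩
  | mul x y _ _ hx hy =>
    obtain ⟨j, hj⟩ := hx
    obtain ⟨k, hk⟩ := hy
    exact ⟨j + k, by rw [pow_add]; exact Submodule.mul_mem_mul hj hk⟩

/-- Stone-Weierstrass on the unit ball; the functional `⟨x - y, ·⟩` separates `x` from `y`. -/
theorem exists_polynomial_near {f : E3 → ℝ} (hf : Continuous f) {ε : ℝ} (hε : 0 < ε) :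
    ∃ k, ∃ P ∈ affineSpace ^ k, ∀ x : E3, ‖x‖ ≤ 1 → |f x - P x| ≤ ε := by
  have hsep : (Algebra.adjoin ℝ (affineSpace : Set C(E3, ℝ))).SeparatesPoints := by
    intro x y hxy
    refine ⟨innerMap (x - y), ⟨innerMap (x - y), Algebra.subset_adjoin (innerMap_mem _), rfl⟩, ?_⟩
    intro h
    simp only [innerMap_apply] at h
    rw [← sub_eq_zero, ← inner_sub_right, inner_self_eq_zero, sub_eq_zero] at h
    exact hxy h
  obtain ⟨g, hg, hgf⟩ :=
    ContinuousMap.exists_mem_subalgebra_near_continuous_of_isCompact_of_separatesPoints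
      hsep ⟨f, hf⟩ (isCompact_closedBall (0 : E3) 1) hε
  obtain ⟨k, hk⟩ := exists_mem_pow_of_mem_adjoin hg
  refine ⟨k, g, hk, fun x hx => ?_⟩
  have := hgf x (by simpa using hx)
  rw [Real.norm_eq_abs] at this
  rw [abs_sub_comm]
  exact this.le

end Polynomials

/-! ### No small subgroups near the identity -/

section NoSmallSubgroups

/-- A bounded operator all of whose powers are close to the identity is the identity. -/
theorem eq_one_of_forall_norm_pow_sub_one_lt {A : Type*} [NormedRing A] [NormedAlgebra ℝ A]
    {a : A} (h : ∀ n : ℕ, ‖a ^ n - 1‖ < 1 / 2) : a = 1 := by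
  -- Since `c ^ 2 - 1 = 2 (c - 1) + (c - 1) ^ 2`, squaring multiplies a small distance from `1` by
  -- at least `3 / 2`; repeated squaring would make it unbounded.
  have step : ∀ c : A, ‖c - 1‖ < 1 / 2 → 3 / 2 * ‖c - 1‖ ≤ ‖c ^ 2 - 1‖ := by
    intro c hc
    have h1 : (2 : ℝ) • (c - 1) = (c ^ 2 - 1) - (c - 1) * (c - 1) := by
      rw [two_smul]; noncomm_ring
    have h2 : 2 * ‖c - 1‖ ≤ ‖c ^ 2 - 1‖ + ‖c - 1‖ * ‖c - 1‖ := by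
      calc 2 * ‖c - 1‖ = ‖(2 : ℝ) • (c - 1)‖ := by rw [norm_smul]; norm_num
        _ ≤ ‖c ^ 2 - 1‖ + ‖(c - 1) * (c - 1)‖ := by rw [h1]; exact norm_sub_le _ _
        _ ≤ _ := by gcongr; exact norm_mul_le _ _
    nlinarith [norm_nonneg (c - 1)]
  have grow : ∀ n : ℕ, (3 / 2 : ℝ) ^ n * ‖a - 1‖ ≤ ‖a ^ (2 ^ n) - 1‖ := by
    intro n
    induction n with
    | zero => simp
    | succ n ih =>
      have := step (a ^ 2 ^ n) (h _)
      rw [← pow_mul, ← pow_succ] at this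
      rw [pow_succ]
      linarith
  by_contra hne
  have hpos : 0 < ‖a - 1‖ := norm_pos_iff.mpr (sub_ne_zero.mpr hne)
  obtain ⟨n, hn⟩ := pow_unbounded_of_one_lt (1 / ‖a - 1‖) (by norm_num : (1 : ℝ) < 3 / 2)
  rw [div_lt_iff₀ hpos] at hn
  linarith [grow n, h (2 ^ n)]

end NoSmallSubgroups

/-! ### Finite symmetry groups are determined by finitely many moments -/

section Stabilizer

variable {F : E3 → ℝ}

/-- The underlying operator of a linear isometry. -/
noncomputable def toOperator : (E3 ≃ₗᵢ[ℝ] E3) →* (E3 →L[ℝ] E3) where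
  toFun L := L.toContinuousLinearEquiv.toContinuousLinearMap
  map_one' := rfl
  map_mul' _ _ := rfl

theorem toOperator_injective : Function.Injective toOperator := fun L L' h => by
  ext1 x
  exact congrArg (fun A : E3 →L[ℝ] E3 => A x) h

theorem norm_toOperator_mul_sub (g L L' : E3 ≃ₗᵢ[ℝ] E3) :
    ‖toOperator (g * L) - toOperator (g * L')‖ ≤ ‖toOperator L - toOperator L'‖ := by
  refine ContinuousLinearMap.opNorm_le_bound _ (norm_nonneg _) fun x => ?_
  have h1 : (toOperator (g * L) - toOperator (g * L')) x = g (L x - L' x) := by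
    rw [map_sub]; rfl
  rw [h1, g.norm_map]
  exact (toOperator L - toOperator L').le_opNorm x

/-- The operators that preserve the norm. -/
def isometricOperators : Set (E3 →L[ℝ] E3) := {A | ∀ x, ‖A x‖ = ‖x‖}

theorem isCompact_isometricOperators : IsCompact isometricOperators := by
  refine Metric.isCompact_of_isClosed_isBounded ?_ ?_
  · have : isometricOperators = ⋂ x, {A : E3 →L[ℝ] E3 | ‖A x‖ = ‖x‖} := by
      ext A; simp [isometricOperators]
    rw [this]
    refine isClosed_iInter fun x => isClosed_eq ?_ continuous_const
    exact (ContinuousLinearMap.apply ℝ E3 x).continuous.norm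
  · refine isBounded_iff_forall_norm_le.mpr ⟨1, fun A hA => ?_⟩
    refine ContinuousLinearMap.opNorm_le_bound _ zero_le_one fun x => ?_
    rw [hA x, one_mul]

theorem exists_toOperator_eq {A : E3 →L[ℝ] E3} (hA : A ∈ isometricOperators) :
    ∃ L, toOperator L = A := by
  let l : E3 →ₗᵢ[ℝ] E3 := ⟨A.toLinearMap, hA⟩
  refine ⟨l.toLinearIsometryEquiv rfl, ?_⟩
  ext1 x
  rfl

theorem toOperator_mem (L : E3 ≃ₗᵢ[ℝ] E3) : toOperator L ∈ isometricOperators :=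
  fun x => L.norm_map x

/-- The linear isometries that preserve all moments of degree at most `k`. -/
def momentSymm (D : Set E3) (k : ℕ) : Subgroup (E3 ≃ₗᵢ[ℝ] E3) where
  carrier := {L | ∀ P ∈ affineSpace ^ k, moment D (fun x => P (L x)) = moment D P}
  one_mem' := fun _ _ => rfl
  mul_mem' := by
    intro L L' hL hL' P hP
    exact (hL' _ (compIsometry_mem L hP)).trans (hL P hP)
  inv_mem' := by
    intro L hL P hP
    have := hL _ (compIsometry_mem L⁻¹ hP)
    rw [← show moment D (fun x => compIsometry L⁻¹ P (L x)) = moment D P by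
      congr 1
      ext x
      rw [compIsometry_apply]
      congr 1
      exact L.symm_apply_apply x]
    exact this.symm

/-- Density of polynomials extends the invariance to moments of all continuous functions. The
function `F ∘ L⁻¹ - F` is then a weight that separates the body from its image, so the two coincide.
-/
theorem IsQuarticGauge.mem_gaugeSymm_of_moment (hF : IsQuarticGauge F) {L : E3 ≃ₗᵢ[ℝ] E3}
    (hL : ∀ k, L ∈ momentSymm {x | F x ≤ 1} k) : L ∈ gaugeSymm F := by
  set D := {x | F x ≤ 1} with hD
  have hDc : IsCompact D := hF.isCompact_le_one
  have hall : ∀ f : E3 → ℝ, Continuous f → moment D (fun x => f (L x)) = moment D f := by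
    intro f hf
    set I := ∫ x in D, ‖x‖ with hI
    have hI0 : 0 ≤ I := integral_nonneg fun x => norm_nonneg x
    refine eq_of_abs_sub_le_all fun ε hε => ?_
    obtain ⟨k, P, hP, hPf⟩ := exists_polynomial_near hf (ε := ε / (2 * (I + 1))) (by positivity)
    have h1 := moment_sub hDc hf P.continuous
    have h2 := moment_sub hDc (hf.comp L.continuous) (P.continuous.comp L.continuous)
    have h3 := abs_moment_le hDc hPf
    have h4 : |moment D (fun x => f (L x) - P (L x))| ≤ ε / (2 * (I + 1)) * I :=
      abs_moment_le hDc fun x hx => hPf (L x) (by rwa [L.norm_map])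
    have h5 : moment D (fun x => P (L x)) = moment D P := hL k P hP
    simp only [Function.comp_def] at h2
    have h6 : moment D (fun x => f (L x)) - moment D f
        = moment D (fun x => f (L x) - P (L x)) - moment D (fun x => f x - P x) := by
      rw [h1, h2, h5]; ring
    have h7 : ε / (2 * (I + 1)) * I + ε / (2 * (I + 1)) * I ≤ ε := by
      have : ε / (2 * (I + 1)) * I + ε / (2 * (I + 1)) * I = ε * (I / (I + 1)) := by
        field_simp; ring
      rw [this]
      have h8 : I / (I + 1) ≤ 1 := by rw [div_le_one (by linarith)]; linarith
      nlinarith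
    rw [h6]
    exact (abs_sub _ _).trans (by linarith)
  have hsymm : L.symm ∈ gaugeSymm F := by
    have hF₂ := hF.comp_isometry L.symm
    set P : E3 → ℝ := fun x => F (L.symm x) - F x with hPdef
    have hPc : Continuous P := (hF.continuous.comp L.symm.continuous).sub hF.continuous
    have hscale : ∀ x : E3, x ≠ 0 → P x = ‖x‖ ^ 4 * P (‖x‖⁻¹ • x) := by
      intro x hx
      have hn : 0 < ‖x‖ := norm_pos_iff.mpr hx
      simp only [hPdef, map_smul, hF.smul _ (inv_nonneg.mpr hn.le)]
      field_simp
    have himg : L '' D = {x | F (L.symm x) ≤ 1} := by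
      ext x
      constructor
      · rintro ⟨y, hy, rfl⟩
        change F (L.symm (L y)) ≤ 1
        rw [L.symm_apply_apply]
        exact hy
      · intro hx
        exact ⟨L.symm x, hx, L.apply_symm_apply x⟩
    have hfin := eq_zero_of_setIntegral_eq hF hF₂ (w := fun x => ‖x‖ * P (‖x‖⁻¹ • x))
      (fun x hx => ?_) (fun t ht x => ?_) (integrableOn_radial hDc hPc)
      (integrableOn_radial hF₂.isCompact_le_one hPc) (fun x => ?_) ?_
    · intro x
      rcases eq_or_ne x 0 with rfl | hx
      · simp
      have hn : 0 < ‖x‖ := norm_pos_iff.mpr hx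
      have h1 := hfin x
      have h2 : ‖x‖ * P (‖x‖⁻¹ • x) * (‖x‖ ^ 4 * P (‖x‖⁻¹ • x)) = 0 := by
        rw [← hscale x hx]; exact h1
      have h3 : P (‖x‖⁻¹ • x) = 0 := by
        by_contra hne
        have : ‖x‖ * P (‖x‖⁻¹ • x) * (‖x‖ ^ 4 * P (‖x‖⁻¹ • x)) ≠ 0 := by positivity
        exact this h2
      have h4 := hscale x hx
      rw [h3, mul_zero] at h4
      exact sub_eq_zero.mp h4
    · have hn : ‖x‖ ≠ 0 := norm_ne_zero_iff.mpr hx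
      have h1 : ContinuousAt (fun x : E3 => ‖x‖⁻¹ • x) x :=
        (continuousAt_id.norm.inv₀ hn).smul continuousAt_id
      exact continuousAt_id.norm.mul (ContinuousAt.comp (g := P) hPc.continuousAt h1)
    · rcases eq_or_ne x 0 with rfl | hx
      · simp
      have hn : ‖x‖ ≠ 0 := norm_ne_zero_iff.mpr hx
      simp only [norm_smul, Real.norm_of_nonneg ht.le]
      rw [smul_smul, show (t * ‖x‖)⁻¹ * t = ‖x‖⁻¹ by field_simp]
      ring
    · rcases eq_or_ne x 0 with rfl | hx
      · simp
      have h1 : F (L.symm x) - F x = ‖x‖ ^ 4 * P (‖x‖⁻¹ • x) := hscale x hx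
      rw [h1, show ‖x‖ * P (‖x‖⁻¹ • x) * (‖x‖ ^ 4 * P (‖x‖⁻¹ • x))
        = ‖x‖ ^ 5 * P (‖x‖⁻¹ • x) ^ 2 by ring]
      positivity
    · have h1 := hall P hPc
      rw [moment_comp, himg] at h1
      exact h1.symm
  intro x
  have := hsymm (L x)
  rw [L.symm_apply_apply] at this
  exact this.symm

/-- If the symmetry group of a body is finite, it is determined by finitely many moments. -/
theorem IsQuarticGauge.exists_momentSymm_le (hF : IsQuarticGauge F)
    (hG : (gaugeSymm F : Set (E3 ≃ₗᵢ[ℝ] E3)).Finite) :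
    ∃ k, 1 ≤ k ∧ momentSymm {x | F x ≤ 1} k ≤ gaugeSymm F := by
  set D := {x | F x ≤ 1} with hD
  have hDc : IsCompact D := hF.isCompact_le_one
  -- Nontrivial symmetries are farther than `2 * η` from the identity, so the annulus between `η`
  -- and `2 * η` contains none; `η < 1 / 2` is for the no-small-subgroups lemma.
  obtain ⟨η, ⟨hη1, hη2⟩, hη0⟩ : ∃ η : ℝ, ((∀ g ∈ (gaugeSymm F : Set (E3 ≃ₗᵢ[ℝ] E3)), g ≠ 1 →
      2 * η < ‖toOperator g - 1‖) ∧ η < 1 / 2) ∧ 0 < η := by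
    have hev : ∀ᶠ η in 𝓝[>] (0 : ℝ), (∀ g ∈ (gaugeSymm F : Set (E3 ≃ₗᵢ[ℝ] E3)), g ≠ 1 →
        2 * η < ‖toOperator g - 1‖) ∧ η < 1 / 2 := by
      refine Filter.Eventually.filter_mono nhdsWithin_le_nhds ?_
      refine Filter.Eventually.and ?_ (eventually_lt_nhds (by norm_num))
      refine (Filter.eventually_all_finite hG).mpr fun g _ => ?_
      by_cases hg : g = 1
      · simp [hg]
      · have hc : ContinuousAt (fun η : ℝ => 2 * η) 0 := by fun_prop
        refine (hc.eventually (eventually_lt_nhds (b := ‖toOperator g - 1‖) ?_)).mono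
          fun η h _ => h
        change 2 * 0 < _
        rw [mul_zero, norm_pos_iff, sub_ne_zero]
        exact fun h => hg (toOperator_injective (h.trans (map_one toOperator).symm))
    exact (hev.and self_mem_nhdsWithin).exists
  let T : ℕ → Set (E3 →L[ℝ] E3) := fun k => {A | A ∈ isometricOperators ∧
    ∀ P ∈ affineSpace ^ k, moment D (fun x => P (A x)) = moment D P}
  have hTL : ∀ k L, toOperator L ∈ T k ↔ L ∈ momentSymm D k := fun k L =>
    ⟨fun h => h.2, fun h => ⟨toOperator_mem L, h⟩⟩
  have hTc : ∀ k, IsClosed (T k) := by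
    intro k
    have hcont : ∀ P : C(E3, ℝ), ContinuousOn
        (fun A : E3 →L[ℝ] E3 => moment D (fun x => P (A x))) isometricOperators := by
      intro P
      obtain ⟨C, hC0, hC⟩ := exists_bound_unitBall P.continuous
      refine continuousOn_of_dominated (bound := fun x => ‖x‖ * C) ?_ ?_ ?_ ?_
      · intro A _
        exact (measurable_radial (P.continuous.comp A.continuous)).aestronglyMeasurable
      · intro A hA
        filter_upwards with x
        rw [norm_mul, norm_norm, Real.norm_eq_abs]
        refine mul_le_mul_of_nonneg_left (hC _ ?_) (norm_nonneg x)
        rw [hA]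
        exact norm_radial_le x
      · exact (continuous_norm.continuousOn.integrableOn_compact hDc).mul_const C
      · filter_upwards with x
        refine Continuous.continuousOn ?_
        exact continuous_const.mul
          (P.continuous.comp (ContinuousLinearMap.apply ℝ E3 (‖x‖⁻¹ • x)).continuous)
    have hTk : T k = isometricOperators ∩ ⋂ P : (affineSpace ^ k : Submodule ℝ C(E3, ℝ)),
        (isometricOperators ∩ (fun A : E3 →L[ℝ] E3 =>
          moment D (fun x => (P : C(E3, ℝ)) (A x))) ⁻¹' {moment D (P : C(E3, ℝ))}) := by
      ext A
      simp only [T, Set.mem_ofPred_eq, Set.mem_inter_iff, Set.mem_iInter, Set.mem_preimage,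
        Set.mem_singleton_iff, Subtype.forall]
      exact ⟨fun h => ⟨h.1, fun P hP => ⟨h.1, h.2 P hP⟩⟩, fun h => ⟨h.1, fun P hP => (h.2 P hP).2⟩⟩
    rw [hTk]
    exact isCompact_isometricOperators.isClosed.inter (isClosed_iInter fun P =>
      (hcont P).preimage_isClosed_of_isClosed isCompact_isometricOperators.isClosed
        isClosed_singleton)
  -- The operators to be excluded: those in the annulus and those at distance at least `η` from
  -- every symmetry. No symmetry lies in this compact set, so some member of the decreasing closed
  -- family `T` misses it.
  let C : Set (E3 →L[ℝ] E3) := isometricOperators ∩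
    ({A | η ≤ ‖A - 1‖ ∧ ‖A - 1‖ ≤ 2 * η} ∪
      ⋂ g ∈ (gaugeSymm F : Set (E3 ≃ₗᵢ[ℝ] E3)), {A | η ≤ ‖A - toOperator g‖})
  have hCc : IsCompact C := by
    refine isCompact_isometricOperators.inter_right (IsClosed.union ?_ ?_)
    · have hc : Continuous fun A : E3 →L[ℝ] E3 => ‖A - 1‖ := by fun_prop
      exact (isClosed_le continuous_const hc).inter (isClosed_le hc continuous_const)
    · exact isClosed_biInter fun g _ => isClosed_le continuous_const (by fun_prop)
  have hempty : C ∩ ⋂ k, T k = ∅ := by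
    rw [Set.eq_empty_iff_forall_notMem]
    rintro A ⟨⟨hA, hAC⟩, hAT⟩
    rw [Set.mem_iInter] at hAT
    obtain ⟨L, rfl⟩ := exists_toOperator_eq hA
    have hLG : L ∈ gaugeSymm F := hF.mem_gaugeSymm_of_moment fun k => (hTL k L).mp (hAT k)
    rcases hAC with ⟨h1, h2⟩ | h3
    · by_cases hL1 : L = 1
      · rw [hL1, map_one, sub_self, norm_zero] at h1
        linarith
      · linarith [hη1 L hLG hL1]
    · have h4 := Set.mem_iInter₂.mp h3 L hLG
      rw [Set.mem_ofPred_eq, sub_self, norm_zero] at h4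
      linarith
  have hanti : Antitone T := fun j k hjk A hA =>
    ⟨hA.1, fun P hP => hA.2 P (polynomials_mono hjk hP)⟩
  obtain ⟨k, hk⟩ := hCc.elim_directed_family_closed T hTc hempty
    (directed_of_isDirected_le hanti)
  have hkT : ∀ L ∈ momentSymm D k, toOperator L ∉ C := fun L hL hC => by
    have : toOperator L ∈ C ∩ T k := ⟨hC, (hTL k L).mpr hL⟩
    rw [hk] at this
    exact this
  have hmono : momentSymm D (k + 1) ≤ momentSymm D k := fun L hL P hP =>
    hL P (polynomials_mono k.le_succ hP)
  -- The shift ensures a positive degree, so that the first moments are among those considered.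
  refine ⟨k + 1, by omega, hmono.trans fun L hL => ?_⟩
  have hGT : gaugeSymm F ≤ momentSymm D k := by
    intro g hg P _
    rw [moment_comp]
    congr 1
    ext x
    constructor
    · rintro ⟨y, hy, rfl⟩
      exact (hg y).le.trans hy
    · intro hx
      refine ⟨g.symm x, ?_, g.apply_symm_apply x⟩
      change F (g.symm x) ≤ 1
      rw [← hg, g.apply_symm_apply]
      exact hx
  have h1 := hkT L hL
  have h2 : ∃ g ∈ gaugeSymm F, ‖toOperator L - toOperator g‖ < η := by
    by_contra hcon
    push Not at hcon
    exact h1 ⟨toOperator_mem L, Or.inr (Set.mem_iInter₂.mpr hcon)⟩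
  obtain ⟨g, hg, hgL⟩ := h2
  set h := g⁻¹ * L with hh
  have hhT : h ∈ momentSymm D k := mul_mem (inv_mem (hGT hg)) hL
  have hhη : ‖toOperator h - 1‖ < η := by
    have := norm_toOperator_mul_sub g⁻¹ L g
    rw [inv_mul_cancel, map_one] at this
    exact this.trans_lt hgL
  -- Multiplication by `h` moves a power by less than `η`, too little to jump over the annulus,
  -- which the powers cannot enter either.
  have hpow : ∀ n : ℕ, ‖toOperator h ^ n - 1‖ < η := by
    intro n
    induction n with
    | zero => simpa using hη0
    | succ n ih =>
      by_contra hcon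
      push Not at hcon
      have h3 : ‖toOperator (h ^ (n + 1)) - 1‖ ≤ 2 * η := by
        have h4 := norm_toOperator_mul_sub (h ^ n) h 1
        rw [← pow_succ, mul_one, map_one] at h4
        calc ‖toOperator (h ^ (n + 1)) - 1‖
            = ‖(toOperator (h ^ (n + 1)) - toOperator (h ^ n)) + (toOperator (h ^ n) - 1)‖ := by
              congr 1; abel
          _ ≤ ‖toOperator h - 1‖ + ‖toOperator (h ^ n) - 1‖ :=
              (norm_add_le _ _).trans (by gcongr)
          _ ≤ 2 * η := by rw [map_pow]; linarith
      refine hkT (h ^ (n + 1)) (pow_mem hhT _) ⟨toOperator_mem _, Or.inl ⟨?_, h3⟩⟩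
      rwa [map_pow]
  have h1' : toOperator h = 1 :=
    eq_one_of_forall_norm_pow_sub_one_lt fun n => (hpow n).trans hη2
  have h5 : h = 1 := toOperator_injective (h1'.trans (map_one toOperator).symm)
  have h6 : g = L := inv_mul_eq_one.mp h5
  rwa [← h6]

end Stabilizer

/-! ### Where the body can be perturbed -/

section GoodBall

variable {F : E3 → ℝ}

/-- On the ball, `F` is differentiable and strongly convex, and its gradient is nowhere radial. -/
structure IsGoodBall (F : E3 → ℝ) (x : E3) (r m c : ℝ) : Prop where
  diff : ∀ y ∈ Metric.ball x r, DifferentiableAt ℝ F y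
  convex : ConvexOn ℝ (Metric.ball x r) (fun y => F y - m * ‖y‖ ^ 2)
  slope : ∀ y ∈ Metric.ball x r, ∃ w, inner ℝ y w = 0 ∧ c * ‖w‖ < |fderiv ℝ F y w|

theorem fderiv_of_symm {L : E3 ≃ₗᵢ[ℝ] E3} (hL : L ∈ gaugeSymm F) {x : E3}
    (hd : DifferentiableAt ℝ F x) : HasFDerivAt F ((fderiv ℝ F x).comp (toOperator L⁻¹)) (L x) := by
  have h1 : HasFDerivAt F (fderiv ℝ F x) (toOperator L⁻¹ (L x)) := by
    have : toOperator L⁻¹ (L x) = x := L.symm_apply_apply x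
    rw [this]
    exact hd.hasFDerivAt
  have h2 := h1.comp (L x) (toOperator L⁻¹).hasFDerivAt
  have h3 : F ∘ toOperator L⁻¹ = F := by
    ext y
    exact (gaugeSymm F).inv_mem hL y
  rwa [h3] at h2

/-- Every ingredient is invariant under symmetries of `F`, so one good ball serves the whole orbit
with the same constants. -/
theorem IsGoodBall.symm {x : E3} {r m c : ℝ} (h : IsGoodBall F x r m c) {L : E3 ≃ₗᵢ[ℝ] E3}
    (hL : L ∈ gaugeSymm F) : IsGoodBall F (L x) r m c := by
  have hball : ∀ y ∈ Metric.ball (L x) r, L.symm y ∈ Metric.ball x r := by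
    intro y hy
    rw [Metric.mem_ball, ← L.dist_map, L.apply_symm_apply]
    exact hy
  refine ⟨fun y hy => ?_, ?_, fun y hy => ?_⟩
  · have := (fderiv_of_symm hL (h.diff _ (hball y hy))).differentiableAt
    rwa [L.apply_symm_apply] at this
  · have h1 := h.convex.comp_linearMap L.symm.toLinearEquiv.toLinearMap
    have h2 : (fun y => F y - m * ‖y‖ ^ 2) ∘ L.symm.toLinearEquiv.toLinearMap
        = fun y => F y - m * ‖y‖ ^ 2 := by
      ext y
      have h3 : F (L.symm y) = F y := (gaugeSymm F).inv_mem hL y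
      simp [h3]
    rw [h2] at h1
    exact h1.subset hball (convex_ball _ _)
  · obtain ⟨w, hw1, hw2⟩ := h.slope _ (hball y hy)
    refine ⟨L w, ?_, ?_⟩
    · rw [← L.inner_map_map, L.apply_symm_apply] at hw1
      exact hw1
    · have h4 := fderiv_of_symm hL (h.diff _ (hball y hy))
      rw [L.apply_symm_apply] at h4
      rw [h4.fderiv, L.norm_map]
      have h5 : toOperator L⁻¹ (L w) = w := L.symm_apply_apply w
      rw [ContinuousLinearMap.comp_apply, h5]
      exact hw2

/-- If the derivative vanished orthogonally to `x`, Euler's relation and the gradient inequality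
would bound the radial component of `y - x` for every `y` in the body, making `x` an equilibrium. -/
theorem IsQuarticGauge.exists_tangent_slope (hF : IsQuarticGauge F) {x : E3} (hx : F x = 1)
    (hd : DifferentiableAt ℝ F x) (hE : x ∉ equilibriumSet F) :
    ∃ v, inner ℝ x v = 0 ∧ fderiv ℝ F x v ≠ 0 := by
  by_contra hcon
  push Not at hcon
  refine hE ⟨hx, fun y hy => ?_⟩
  have hx0 : x ≠ 0 := by
    rintro rfl
    rw [hF.apply_zero] at hx
    norm_num at hx
  have hn : 0 < ‖x‖ := norm_pos_iff.mpr hx0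
  set α := inner ℝ x (y - x) / ‖x‖ ^ 2 with hα
  have h1 : inner ℝ x (y - x - α • x) = 0 := by
    rw [inner_sub_right, inner_smul_right, real_inner_self_eq_norm_sq, hα]
    field_simp
    ring
  have h2 := hcon _ h1
  rw [map_sub, map_smul, fderiv_self_of_quartic hF.smul hd, hx, smul_eq_mul] at h2
  have h3 := fderiv_le_of_convexOn hF.convex hd y
  have h4 : α ≤ 0 := by linarith
  rw [hα, div_le_iff₀ (by positivity), zero_mul] at h4
  exact h4

theorem IsQuarticGauge.exists_goodBall (hF : IsQuarticGauge F) {x : E3} (hx : F x = 1)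
    (hE : x ∉ equilibriumSet F) {q : E3} {r m : ℝ} (hxq : x ∈ Metric.ball q r)
    (hC : ∀ y ∈ Metric.ball q r, ContDiffAt ℝ 2 F y)
    (hconv : ConvexOn ℝ (Metric.ball q r) (fun y => F y - m * ‖y‖ ^ 2)) :
    ∃ r' > 0, ∃ c > 0, IsGoodBall F x r' m c := by
  have hCx := hC x hxq
  have hx0 : x ≠ 0 := by
    rintro rfl
    rw [hF.apply_zero] at hx
    norm_num at hx
  obtain ⟨v, hv1, hv2⟩ :=
    hF.exists_tangent_slope hx (hCx.differentiableAt (by norm_num)) hE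
  set d := |fderiv ℝ F x v| with hd
  have hdpos : 0 < d := abs_pos.mpr hv2
  -- Projecting `v` orthogonally to `y` extends the tangent direction continuously to nearby points.
  set V : E3 → E3 := fun y => v - (inner ℝ y v / ‖y‖ ^ 2) • y with hV
  have hVc : ContinuousAt V x := by
    have : ‖x‖ ^ 2 ≠ 0 := by positivity
    have h1 : ContinuousAt (fun y : E3 => inner ℝ y v / ‖y‖ ^ 2) x :=
      ContinuousAt.div (by fun_prop) (by fun_prop) this
    exact continuousAt_const.sub (h1.smul continuousAt_id)
  have hVx : V x = v := by simp [hV, hv1]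
  have hDc : ContinuousAt (fderiv ℝ F) x :=
    (hCx.fderiv_right (m := 1) (by norm_num)).continuousAt
  have hc : ContinuousAt (fun y => |fderiv ℝ F y (V y)|) x := (hDc.clm_apply hVc).abs
  have hev : ∀ᶠ y in 𝓝 x, d / 2 < |fderiv ℝ F y (V y)| ∧ ‖V y‖ < ‖v‖ + 1 ∧ y ≠ 0 ∧
      y ∈ Metric.ball q r := by
    refine (hc.eventually (lt_mem_nhds ?_)).and ((hVc.norm.eventually (gt_mem_nhds ?_)).and
      ((eventually_ne_nhds hx0).and (Metric.isOpen_ball.mem_nhds hxq)))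
    · simp only [hVx]; linarith
    · simp only [hVx]; linarith
  obtain ⟨r', hr', hsub⟩ := Metric.eventually_nhds_iff_ball.mp hev
  -- Nearby the slope exceeds `d / 2` and the direction is shorter than `‖v‖ + 1`.
  refine ⟨r', hr', d / (2 * (‖v‖ + 1)), by positivity, fun y hy => ?_, ?_, fun y hy => ?_⟩
  · exact (hC y (hsub y hy).2.2.2).differentiableAt (by norm_num)
  · exact hconv.subset (fun y hy => (hsub y hy).2.2.2) (convex_ball _ _)
  · obtain ⟨h1, h2, h3, -⟩ := hsub y hy
    refine ⟨V y, ?_, ?_⟩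
    · have hn : 0 < ‖y‖ := norm_pos_iff.mpr h3
      simp only [hV]
      rw [inner_sub_right, inner_smul_right, real_inner_self_eq_norm_sq]
      field_simp
      ring
    · refine lt_of_le_of_lt ?_ h1
      calc d / (2 * (‖v‖ + 1)) * ‖V y‖ ≤ d / (2 * (‖v‖ + 1)) * (‖v‖ + 1) := by gcongr
        _ = d / 2 := by field_simp

/-- Near a given boundary point there are boundary points with trivial stabilizer that are not
equilibria. -/
theorem IsQuarticGauge.exists_generic (hF : IsQuarticGauge F) (hE : (equilibriumSet F).Finite)
    (hG : (gaugeSymm F : Set (E3 ≃ₗᵢ[ℝ] E3)).Finite) {q : E3} (hq : F q = 1) {r : ℝ}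
    (hr : 0 < r) :
    ∃ x ∈ Metric.ball q r, F x = 1 ∧ x ∉ equilibriumSet F ∧
      ∀ g ∈ gaugeSymm F, g ≠ 1 → g x ≠ x := by
  have hq0 : q ≠ 0 := by
    rintro rfl
    rw [hF.apply_zero] at hq
    norm_num at hq
  have hc : ContinuousAt (fun y => ((F y)⁻¹ ^ (4⁻¹ : ℝ)) • y) q := by
    refine ContinuousAt.smul (ContinuousAt.rpow_const ?_ (Or.inr (by norm_num))) continuousAt_id
    exact hF.continuous.continuousAt.inv₀ (by rw [hq]; norm_num)
  have hnhds : ∀ᶠ y in 𝓝 q, ((F y)⁻¹ ^ (4⁻¹ : ℝ)) • y ∈ Metric.ball q r ∧ y ≠ 0 := by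
    refine (hc.eventually ?_).and (eventually_ne_nhds hq0)
    simp only [hq, inv_one, Real.one_rpow, one_smul]
    exact Metric.ball_mem_nhds q hr
  -- The bad directions form finitely many proper subspaces, hence a null set. Being invariant under
  -- scaling, it is still avoided after projecting radially to the boundary.
  let B : Set E3 := (⋃ g ∈ (gaugeSymm F : Set (E3 ≃ₗᵢ[ℝ] E3)) \ {1},
      ((LinearMap.ker (g.toLinearEquiv.toLinearMap - LinearMap.id) : Submodule ℝ E3) : Set E3)) ∪
    ⋃ e ∈ equilibriumSet F, ((ℝ ∙ e : Submodule ℝ E3) : Set E3)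
  have hB : volume B = 0 := by
    refine measure_union_null ?_ ?_
    · refine (measure_biUnion_null_iff (hG.subset Set.sdiff_subset).countable).mpr fun g hg => ?_
      refine Measure.addHaar_submodule _ _ fun htop => hg.2 ?_
      rw [Set.mem_singleton_iff]
      ext1 x
      have : x ∈ LinearMap.ker (g.toLinearEquiv.toLinearMap - LinearMap.id) := by
        rw [htop]; trivial
      rw [LinearMap.mem_ker, LinearMap.sub_apply, sub_eq_zero] at this
      exact this
    · refine (measure_biUnion_null_iff hE.countable).mpr fun e he => ?_
      refine Measure.addHaar_submodule _ _ fun htop => ?_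
      have he0 : e ≠ 0 := by
        rintro rfl
        have := he.1
        rw [hF.apply_zero] at this
        norm_num at this
      have h1 := finrank_span_singleton (K := ℝ) he0
      rw [htop, finrank_top] at h1
      simp at h1
  obtain ⟨y, ⟨hy1, hy0⟩, hyB⟩ : ∃ y, (((F y)⁻¹ ^ (4⁻¹ : ℝ)) • y ∈ Metric.ball q r ∧ y ≠ 0) ∧
      y ∉ B := by
    by_contra hcon
    push Not at hcon
    have h2 : 0 < volume B := (Measure.measure_pos_of_mem_nhds volume hnhds).trans_le
      (measure_mono fun y hy => hcon y hy)
    exact h2.ne' hB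
  have hFy := hF.pos y hy0
  set t := (F y)⁻¹ ^ (4⁻¹ : ℝ) with ht
  have htpos : 0 < t := by positivity
  have ht4 : t ^ 4 * F y = 1 := by
    have := Real.rpow_inv_natCast_pow (inv_nonneg.mpr hFy.le) (n := 4) (by norm_num)
    push_cast at this
    rw [ht, this, inv_mul_cancel₀ hFy.ne']
  refine ⟨t • y, hy1, by rw [hF.smul t htpos.le, ht4], fun hmem => ?_, fun g hg hg1 hgx => ?_⟩
  · refine hyB (Or.inr (Set.mem_iUnion₂.mpr ⟨t • y, hmem, ?_⟩))
    refine Submodule.mem_span_singleton.mpr ⟨t⁻¹, ?_⟩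
    rw [smul_smul, inv_mul_cancel₀ htpos.ne', one_smul]
  · refine hyB (Or.inl (Set.mem_iUnion₂.mpr ⟨g, ⟨hg, hg1⟩, ?_⟩))
    rw [map_smul] at hgx
    have := smul_right_injective E3 htpos.ne' hgx
    rw [SetLike.mem_coe, LinearMap.mem_ker, LinearMap.sub_apply, sub_eq_zero]
    exact this

end GoodBall

/-! ### Symmetrized bumps with vanishing moments -/

section SymmetrizedBump

/-- A smooth bump around `u` times a polynomial in the coordinate `⟨a, ·⟩`. -/
noncomputable def polyBump {u : E3} (b : ContDiffBump u) (a : E3) (Q : Polynomial ℝ) (x : E3) : ℝ :=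
  b x * Q.eval (inner ℝ a x)

/-- The sum of the translates of `polyBump` under a finite group. -/
noncomputable def symmBump (H : Subgroup (E3 ≃ₗᵢ[ℝ] E3)) [Fintype H] {u : E3} (b : ContDiffBump u)
    (a : E3) (Q : Polynomial ℝ) (x : E3) : ℝ :=
  ∑ h : H, polyBump b a Q ((h : E3 ≃ₗᵢ[ℝ] E3).symm x)

variable (H : Subgroup (E3 ≃ₗᵢ[ℝ] E3)) [Fintype H] {u : E3} (b : ContDiffBump u) (a : E3)

theorem contDiff_polyBump (Q : Polynomial ℝ) : ContDiff ℝ 2 (polyBump b a Q) := by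
  refine b.contDiff.mul ?_
  have h1 : ContDiff ℝ 2 fun x : ℝ => Q.eval x := by
    simpa using Q.contDiff_aeval (𝕜 := ℝ) 2
  exact h1.comp (contDiff_const.inner ℝ contDiff_id)

theorem contDiff_symmBump (Q : Polynomial ℝ) : ContDiff ℝ 2 (symmBump H b a Q) := by
  refine ContDiff.sum fun h _ => (contDiff_polyBump b a Q).comp ?_
  exact (h : E3 ≃ₗᵢ[ℝ] E3).symm.contDiff

variable {H} in
theorem symmBump_symm (Q : Polynomial ℝ) {L : E3 ≃ₗᵢ[ℝ] E3} (hL : L ∈ H) (x : E3) :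
    symmBump H b a Q (L x) = symmBump H b a Q x := by
  rw [symmBump, symmBump, ← Equiv.sum_comp (Equiv.mulLeft (⟨L, hL⟩ : H))]
  refine Finset.sum_congr rfl fun h _ => ?_
  congr 1
  change (L * (h : E3 ≃ₗᵢ[ℝ] E3))⁻¹ (L x) = (h : E3 ≃ₗᵢ[ℝ] E3)⁻¹ x
  rw [mul_inv_rev]
  change (h : E3 ≃ₗᵢ[ℝ] E3)⁻¹ (L.symm (L x)) = _
  rw [L.symm_apply_apply]

theorem polyBump_add (Q Q' : Polynomial ℝ) (x : E3) :
    polyBump b a (Q + Q') x = polyBump b a Q x + polyBump b a Q' x := by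
  simp [polyBump, mul_add]

theorem polyBump_smul (c : ℝ) (Q : Polynomial ℝ) (x : E3) :
    polyBump b a (c • Q) x = c * polyBump b a Q x := by
  simp only [polyBump, Polynomial.eval_smul, smul_eq_mul]
  ring

theorem symmBump_add (Q Q' : Polynomial ℝ) (x : E3) :
    symmBump H b a (Q + Q') x = symmBump H b a Q x + symmBump H b a Q' x := by
  simp only [symmBump, polyBump_add, Finset.sum_add_distrib]

theorem symmBump_smul (c : ℝ) (Q : Polynomial ℝ) (x : E3) :
    symmBump H b a (c • Q) x = c * symmBump H b a Q x := by
  simp only [symmBump, polyBump_smul, Finset.mul_sum]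

theorem exists_mem_of_symmBump_ne_zero {Q : Polynomial ℝ} {x : E3}
    (hx : symmBump H b a Q x ≠ 0) : ∃ h ∈ H, h.symm x ∈ Metric.ball u b.rOut := by
  obtain ⟨h, -, hh⟩ := Finset.exists_ne_zero_of_sum_ne_zero hx
  refine ⟨h, h.2, ?_⟩
  rw [← b.support_eq]
  exact fun h0 => hh (by rw [polyBump, h0, zero_mul])

theorem moment_add {D : Set E3} (hD : IsCompact D) {P Q : E3 → ℝ} (hP : Continuous P)
    (hQ : Continuous Q) : moment D (fun x => P x + Q x) = moment D P + moment D Q := by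
  rw [moment, moment, moment, ← integral_add (integrableOn_radial hD hP)
    (integrableOn_radial hD hQ)]
  simp only [mul_add]

theorem moment_const_mul {D : Set E3} (c : ℝ) (P : E3 → ℝ) :
    moment D (fun x => c * P x) = c * moment D P := by
  rw [moment, moment, ← integral_const_mul]
  congr 1
  ext x
  ring

/-- Finitely many moments can be annihilated by a nonzero polynomial factor. -/
theorem exists_polynomial_moment_eq_zero {D : Set E3} (hD : IsCompact D) (k : ℕ) :
    ∃ Q : Polynomial ℝ, Q ≠ 0 ∧ ∀ P ∈ affineSpace ^ k,
      moment D (fun x => P x * symmBump H b a Q x) = 0 := by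
  have hc : ∀ Q, Continuous (symmBump H b a Q) := fun Q => (contDiff_symmBump H b a Q).continuous
  let Λ : Polynomial ℝ →ₗ[ℝ] ((affineSpace ^ k : Submodule ℝ C(E3, ℝ)) →ₗ[ℝ] ℝ) :=
    LinearMap.mk₂ ℝ (fun Q P => moment D (fun x => (P : C(E3, ℝ)) x * symmBump H b a Q x))
      (fun Q Q' P => by
        rw [← moment_add (P := fun x => P.1 x * symmBump H b a Q x)
          (Q := fun x => P.1 x * symmBump H b a Q' x) hD (P.1.continuous.mul (hc Q))
          (P.1.continuous.mul (hc Q'))]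
        simp only [symmBump_add, mul_add])
      (fun c Q P => by
        rw [smul_eq_mul, ← moment_const_mul]
        congr 1
        ext x
        rw [symmBump_smul]; ring)
      (fun Q P P' => by
        rw [← moment_add (P := fun x => P.1 x * symmBump H b a Q x)
          (Q := fun x => P'.1 x * symmBump H b a Q x) hD (P.1.continuous.mul (hc Q))
          (P'.1.continuous.mul (hc Q))]
        congr 1
        ext x
        rw [Submodule.coe_add, ContinuousMap.add_apply]; ring)
      (fun c Q P => by
        rw [smul_eq_mul, ← moment_const_mul]
        congr 1
        ext x
        rw [Submodule.coe_smul, ContinuousMap.smul_apply, smul_eq_mul]; ring)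
  have hfin : Module.Finite ℝ (affineSpace ^ k : Submodule ℝ C(E3, ℝ)) :=
    Module.Finite.iff_fg.mpr (fg_polynomials k)
  -- `Λ` maps the infinite-dimensional space of polynomials to a finite-dimensional dual space.
  have hker : ¬ Function.Injective Λ := fun hinj =>
    Polynomial.not_finite (Module.Finite.of_injective Λ hinj)
  rw [← LinearMap.ker_eq_bot, Submodule.eq_bot_iff] at hker
  push Not at hker
  obtain ⟨Q, hQ, hQ0⟩ := hker
  refine ⟨Q, hQ0, fun P hP => ?_⟩
  have := congrArg (fun f => f (⟨P, hP⟩ : (affineSpace ^ k : Submodule ℝ C(E3, ℝ)))) hQ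
  exact this

/-- A nonzero polynomial factor does not vanish on the unit sphere near the center of the bump. -/
theorem exists_polyBump_ne_zero {Q : Polynomial ℝ} (hQ : Q ≠ 0) (hu : ‖u‖ = 1) (ha : ‖a‖ = 1)
    (hua : inner ℝ a u = 0) :
    ∃ v : E3, ‖v‖ = 1 ∧ v ∈ Metric.ball u b.rOut ∧ polyBump b a Q v ≠ 0 := by
  -- A curve on the unit sphere through `u` along which the coordinate `⟨a, ·⟩` is the parameter, so
  -- that `Q` vanishes only finitely often on it.
  set p : ℝ → E3 := fun z => √(1 - z ^ 2) • u + z • a with hp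
  have hpc : ContinuousAt p 0 := by
    refine Continuous.continuousAt ?_
    fun_prop
  have hp0 : p 0 = u := by simp [hp]
  have hev : ∀ᶠ z in 𝓝 (0 : ℝ), p z ∈ Metric.ball u b.rOut :=
    hpc.eventually (by rw [hp0]; exact Metric.ball_mem_nhds u b.rOut_pos)
  obtain ⟨ε, hε, hsub⟩ := Metric.eventually_nhds_iff.mp hev
  have hinf : (Set.Ioo 0 (min ε 1)).Infinite := Set.Ioo_infinite (by positivity)
  obtain ⟨z, hz, hzr⟩ : ∃ z ∈ Set.Ioo 0 (min ε 1), ¬ Q.IsRoot z := by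
    by_contra hcon
    push Not at hcon
    exact hQ (Polynomial.eq_zero_of_infinite_isRoot Q (hinf.mono fun z hz => hcon z hz))
  have hz1 : z < ε := hz.2.trans_le (min_le_left _ _)
  have hz2 : z < 1 := hz.2.trans_le (min_le_right _ _)
  have hzs : 0 ≤ 1 - z ^ 2 := by nlinarith [hz.1]
  have hmem : p z ∈ Metric.ball u b.rOut := by
    refine hsub ?_
    rw [Real.dist_eq, sub_zero, abs_of_pos hz.1]
    exact hz1
  refine ⟨p z, ?_, hmem, ?_⟩
  · have h1 : ‖p z‖ ^ 2 = 1 := by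
      rw [hp, @norm_add_sq_real, norm_smul, norm_smul, hu, ha, inner_smul_left, inner_smul_right,
        real_inner_comm, hua, mul_one, mul_one, Real.norm_eq_abs, Real.norm_eq_abs, sq_abs, sq_abs,
        Real.sq_sqrt hzs]
      simp
    exact (pow_eq_one_iff_of_nonneg (norm_nonneg _) (by norm_num)).mp h1
  · have h2 : inner ℝ a (p z) = z := by
      rw [hp, inner_add_right, inner_smul_right, inner_smul_right, hua,
        real_inner_self_eq_norm_sq, ha]
      ring
    rw [polyBump, h2]
    refine mul_ne_zero ?_ hzr
    rw [← b.support_eq] at hmem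
    exact hmem

end SymmetrizedBump

/-! ### Radial cutoffs and shifted level sets -/

section RadialBump

/-- The function `β` of the direction, cut off to a spherical shell by a bump in the radius. -/
noncomputable def radialBump {r : ℝ} (θ : ContDiffBump r) (β : E3 → ℝ) (x : E3) : ℝ :=
  θ ‖x‖ * β (‖x‖⁻¹ • x)

variable {r : ℝ} (θ : ContDiffBump r) {β : E3 → ℝ}

theorem radialBump_smul {u : E3} (hu : ‖u‖ = 1) {t : ℝ} (ht : 0 < t) :
    radialBump θ β (t • u) = θ t * β u := by
  rw [radialBump, norm_smul, hu, Real.norm_of_nonneg ht.le, mul_one, smul_smul,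
    inv_mul_cancel₀ ht.ne', one_smul]

theorem radialBump_eq_zero {x : E3} (hx : ‖x‖ < r - θ.rOut) :
    radialBump θ β x = 0 := by
  have h1 : θ ‖x‖ = 0 := by
    refine θ.zero_of_le_dist ?_
    rw [Real.dist_eq, abs_of_nonpos (by linarith [θ.rOut_pos])]
    linarith
  rw [radialBump, h1, zero_mul]

/-- The cutoff vanishes near the origin, the only place where the direction `x / ‖x‖` is not smooth.
-/
theorem contDiff_radialBump (hβ : ContDiff ℝ 2 β) (hr : θ.rOut < r) :
    ContDiff ℝ 2 (radialBump θ β) := by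
  rw [contDiff_iff_contDiffAt]
  intro x
  rcases eq_or_ne x 0 with rfl | hx
  · refine contDiffAt_const (c := (0 : ℝ)) |>.congr_of_eventuallyEq ?_
    have : ∀ᶠ y in 𝓝 (0 : E3), y ∈ Metric.ball (0 : E3) (r - θ.rOut) :=
      Metric.ball_mem_nhds _ (by linarith)
    filter_upwards [this] with y hy
    exact radialBump_eq_zero θ (by simpa using hy)
  · have hn : ContDiffAt ℝ 2 (fun y : E3 => ‖y‖) x := contDiffAt_norm ℝ hx
    have hn0 : ‖x‖ ≠ 0 := norm_ne_zero_iff.mpr hx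
    have h1 : ContDiffAt ℝ 2 (fun y : E3 => θ ‖y‖) x :=
      ContDiffAt.comp (g := (θ : ℝ → ℝ)) x θ.contDiff.contDiffAt hn
    have h2 : ContDiffAt ℝ 2 (fun y : E3 => ‖y‖⁻¹ • y) x := (hn.inv hn0).smul contDiffAt_id
    exact h1.mul (ContDiffAt.comp x hβ.contDiffAt h2)

/-- A symmetrized radial bump is supported in balls around the orbit of its center. -/
theorem support_radialBump_symmBump_subset (H : Subgroup (E3 ≃ₗᵢ[ℝ] E3)) [Fintype H] {u : E3}
    (b : ContDiffBump u) (a : E3) (Q : Polynomial ℝ) (hr : θ.rOut < r) {x : E3}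
    (hx : radialBump θ (symmBump H b a Q) x ≠ 0) :
    ∃ h : H, dist x ((h : E3 ≃ₗᵢ[ℝ] E3) (r • u)) ≤ θ.rOut + r * b.rOut := by
  have hrpos : 0 < r := θ.rOut_pos.trans hr
  have h1 := left_ne_zero_of_mul hx
  obtain ⟨h, hh, hmem⟩ := exists_mem_of_symmBump_ne_zero H b a (right_ne_zero_of_mul hx)
  refine ⟨⟨h, hh⟩, ?_⟩
  have hx0 : x ≠ 0 := by
    rintro rfl
    exact hx (radialBump_eq_zero θ (by rw [norm_zero]; linarith))
  have hn : 0 < ‖x‖ := norm_pos_iff.mpr hx0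
  have h2 : |‖x‖ - r| < θ.rOut := by
    have : ‖x‖ ∈ Function.support θ := h1
    rw [θ.support_eq, Metric.mem_ball, Real.dist_eq] at this
    exact this
  rw [Metric.mem_ball, dist_eq_norm] at hmem
  set v := h.symm (‖x‖⁻¹ • x) with hv
  have hvn : ‖v‖ = 1 := by
    rw [hv, LinearIsometryEquiv.norm_map, norm_smul, norm_inv, norm_norm, inv_mul_cancel₀ hn.ne']
  have hxv : x = h (‖x‖ • v) := by
    rw [hv, ← map_smul, smul_smul, mul_inv_cancel₀ hn.ne', one_smul, h.apply_symm_apply]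
  -- The displacement splits into a radial error, bounded by `θ.rOut`, and `r` times an angular
  -- error, bounded by `b.rOut`.
  have h3 : dist x (h (r • u)) = ‖(‖x‖ - r) • v + r • (v - u)‖ := by
    conv_lhs => rw [hxv]
    rw [h.dist_map, dist_eq_norm]
    congr 1
    module
  change dist x (h (r • u)) ≤ _
  rw [h3]
  refine (norm_add_le _ _).trans ?_
  rw [norm_smul, norm_smul, hvn, mul_one, Real.norm_eq_abs, Real.norm_of_nonneg hrpos.le]
  exact add_le_add h2.le (by gcongr)

theorem tsupport_radialBump_symmBump_subset (H : Subgroup (E3 ≃ₗᵢ[ℝ] E3)) [Fintype H] {u : E3}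
    (b : ContDiffBump u) (a : E3) (Q : Polynomial ℝ) (hr : θ.rOut < r) :
    tsupport (radialBump θ (symmBump H b a Q)) ⊆
      ⋃ h : H, Metric.closedBall ((h : E3 ≃ₗᵢ[ℝ] E3) (r • u)) (θ.rOut + r * b.rOut) := by
  refine closure_minimal (fun x hx => ?_)
    (isClosed_iUnion_of_finite fun h => Metric.isClosed_closedBall)
  obtain ⟨h, hh⟩ := support_radialBump_symmBump_subset θ H b a Q hr hx
  exact Set.mem_iUnion.mpr ⟨h, hh⟩

/-- Along a ray, subtracting a cut-off constant shifts the level set as subtracting the constant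
does. -/
theorem level_shift_iff {f B κ t : ℝ} (hf : 0 ≤ f) (ht : 0 < t) (hr : θ.rIn < r)
    (hB : |B| < κ)
    (hlow : B ≠ 0 → (r - θ.rIn) ^ 4 * f ≤ 1 - κ)
    (hhigh : B ≠ 0 → 1 + κ ≤ (r + θ.rIn) ^ 4 * f) :
    t ^ 4 * f - B * θ t ≤ 1 ↔ t ^ 4 * f ≤ 1 + B := by
  rcases eq_or_ne B 0 with rfl | hB0
  · simp
  have h1 := hlow hB0
  have h2 := hhigh hB0
  have h3 := abs_lt.mp hB
  have h4 : |B * θ t| ≤ |B| := by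
    rw [abs_mul, abs_of_nonneg θ.nonneg]
    exact mul_le_of_le_one_right (abs_nonneg _) θ.le_one
  have h6 := abs_lt.mp (h4.trans_lt hB)
  -- Where the cutoff may differ from one, `t ^ 4 * f` is at least `κ > |B|` away from `1`, so both
  -- inequalities are decided in the same way.
  rcases lt_or_ge t (r - θ.rIn) with h | h
  · have : t ^ 4 * f ≤ (r - θ.rIn) ^ 4 * f := by gcongr
    exact ⟨fun _ => by linarith, fun _ => by linarith⟩
  rcases lt_or_ge (r + θ.rIn) t with h' | h'
  · have : (r + θ.rIn) ^ 4 * f ≤ t ^ 4 * f := by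
      have : 0 ≤ r + θ.rIn := by linarith [θ.rIn_pos]
      gcongr
    exact ⟨fun _ => by linarith, fun _ => by linarith⟩
  · have : θ t = 1 := by
      refine θ.one_of_mem_closedBall ?_
      rw [Metric.mem_closedBall, Real.dist_eq, abs_le]
      constructor <;> linarith
    rw [this, mul_one, sub_le_iff_le_add]

end RadialBump

/-! ### Effect of a perturbation on convexity and moments -/

section Perturbation

variable {F : E3 → ℝ}

/-- Both levels are positive, hence attained on the ray; testing the equivalence at the two
attaining points gives both inequalities. -/
theorem eq_of_forall_level_iff {f B B' : ℝ} (hf : 0 < f) (hB : |B| < 1) (hB' : |B'| < 1)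
    (h : ∀ t : ℝ, 0 < t → (t ^ 4 * f ≤ 1 + B ↔ t ^ 4 * f ≤ 1 + B')) : B = B' := by
  have key : ∀ C : ℝ, |C| < 1 → ∃ t : ℝ, 0 < t ∧ t ^ 4 * f = 1 + C := by
    intro C hC
    have h1 : 0 < (1 + C) / f := div_pos (by linarith [(abs_lt.mp hC).1]) hf
    refine ⟨((1 + C) / f) ^ (4⁻¹ : ℝ), by positivity, ?_⟩
    have := Real.rpow_inv_natCast_pow h1.le (n := 4) (by norm_num)
    push_cast at this
    rw [this]
    field_simp
  obtain ⟨t, ht, htB⟩ := key B hB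
  obtain ⟨t', ht', htB'⟩ := key B' hB'
  have h1 := (h t ht).mp htB.le
  have h2 := (h t' ht').mpr htB'.le
  linarith

/-- Convexity survives a small perturbation supported in balls of strong convexity. -/
theorem IsQuarticGauge.convexOn_sub (hF : IsQuarticGauge F) {η : E3 → ℝ} {m : ℝ}
    (hη : Continuous η) (hconv : ConvexOn ℝ Set.univ (fun x => m * ‖x‖ ^ 2 - η x))
    (hgood : ∀ x ∈ tsupport η, ∃ r > 0, ConvexOn ℝ (Metric.ball x r) (fun y => F y - m * ‖y‖ ^ 2)) :
    ConvexOn ℝ Set.univ (fun x => F x - η x) := by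
  refine convexOn_univ_of_locally (hF.continuous.sub hη) fun x => ?_
  -- On the support, `m * ‖x‖ ^ 2` is moved from `F` to `-η`, leaving two convex summands; off the
  -- support nothing has changed.
  by_cases hx : x ∈ tsupport η
  · obtain ⟨r, hr, h⟩ := hgood x hx
    refine ⟨r, hr, ?_⟩
    refine (h.add (hconv.subset (Set.subset_univ _) (convex_ball _ _))).congr fun y _ => ?_
    simp
  · obtain ⟨r, hr, hsub⟩ := Metric.isOpen_iff.mp (isClosed_tsupport η).isOpen_compl x hx
    refine ⟨r, hr, (hF.convex.subset (Set.subset_univ _) (convex_ball _ _)).congr fun y hy => ?_⟩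
    rw [image_eq_zero_of_notMem_tsupport (hsub hy), sub_zero]

/-- The isometries preserving a perturbed body all of whose moments up to order `k` are unchanged
are symmetries of the original body. -/
theorem mem_momentSymm_of_moment_eq {D D' : Set E3} {k : ℕ}
    (hmom : ∀ P ∈ affineSpace ^ k, moment D' P = moment D P) {L : E3 ≃ₗᵢ[ℝ] E3}
    (hL : ∀ x, x ∈ D' ↔ L x ∈ D') : L ∈ momentSymm D k := by
  intro P hP
  have h1 : L '' D' = D' := by
    ext x
    constructor
    · rintro ⟨y, hy, rfl⟩
      exact (hL y).mp hy
    · intro hx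
      refine ⟨L.symm x, (hL _).mpr ?_, L.apply_symm_apply x⟩
      rwa [L.apply_symm_apply]
  have h2 := hmom _ (compIsometry_mem L hP)
  have h3 := moment_comp D' P L
  rw [h1, hmom P hP] at h3
  rw [← h3]
  exact h2.symm

end Perturbation

/-! ### Construction of the perturbation -/

section Existence

variable {F : E3 → ℝ}

/-- The size of a perturbation around a boundary point `r • u` with trivial stabilizer. -/
theorem IsQuarticGauge.exists_shell (hF : IsQuarticGauge F)
    (hG : (gaugeSymm F : Set (E3 ≃ₗᵢ[ℝ] E3)).Finite) {u : E3} {r : ℝ} (hr : 0 < r)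
    (hru : r ^ 4 * F u = 1) (hfix : ∀ g ∈ gaugeSymm F, g ≠ 1 → g u ≠ u) {ρ : ℝ} (hρ : 0 < ρ) :
    ∃ τ > 0, ∃ κ > 0, ∃ δ > 0, 2 * τ < r ∧ 2 * τ + r * δ < ρ ∧
      (∀ g ∈ gaugeSymm F, g ≠ 1 → 2 * δ < dist (g u) u) ∧
      ∀ v ∈ Metric.ball u δ, (r - τ) ^ 4 * F v ≤ 1 - κ ∧ 1 + κ ≤ (r + τ) ^ 4 * F v := by
  have hFu : 0 < F u := pos_of_mul_pos_right (by rw [hru]; exact one_pos) (by positivity)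
  obtain ⟨τ, hτ, hτr, hτρ⟩ : ∃ τ : ℝ, 0 < τ ∧ 2 * τ < r ∧ 2 * τ < ρ / 2 :=
    ⟨min r ρ / 8, by positivity, by linarith [min_le_left r ρ], by linarith [min_le_right r ρ]⟩
  have h1 : (r - τ) ^ 4 * F u < 1 := by
    rw [← hru]
    have : (r - τ) ^ 4 < r ^ 4 := pow_lt_pow_left₀ (by linarith) (by linarith) (by norm_num)
    gcongr
  have h2 : 1 < (r + τ) ^ 4 * F u := by
    rw [← hru]
    have : r ^ 4 < (r + τ) ^ 4 := pow_lt_pow_left₀ (by linarith) hr.le (by norm_num)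
    gcongr
  -- `τ` is a radial thickness and `κ` the margin by which moving the radius by `τ` crosses the
  -- level `1`. The inequalities are strict, so they persist for directions within an angular radius
  -- `δ`.
  obtain ⟨κ, hκ, hκ1, hκ2⟩ : ∃ κ : ℝ, 0 < κ ∧ (r - τ) ^ 4 * F u < 1 - κ ∧
      1 + κ < (r + τ) ^ 4 * F u := by
    have h3 : 0 < min (1 - (r - τ) ^ 4 * F u) ((r + τ) ^ 4 * F u - 1) :=
      lt_min (by linarith) (by linarith)
    refine ⟨_, half_pos h3, ?_, ?_⟩
    · linarith [min_le_left (1 - (r - τ) ^ 4 * F u) ((r + τ) ^ 4 * F u - 1)]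
    · linarith [min_le_right (1 - (r - τ) ^ 4 * F u) ((r + τ) ^ 4 * F u - 1)]
  have hev : ∀ᶠ v in 𝓝 u, (r - τ) ^ 4 * F v < 1 - κ ∧ 1 + κ < (r + τ) ^ 4 * F v := by
    have hc : ∀ c : ℝ, ContinuousAt (fun v => c * F v) u := fun c =>
      (continuous_const.mul hF.continuous).continuousAt
    exact ((hc _).eventually (gt_mem_nhds hκ1)).and ((hc _).eventually (lt_mem_nhds hκ2))
  obtain ⟨δ₀, hδ₀, hball⟩ := Metric.eventually_nhds_iff_ball.mp hev
  have hsmall : ∀ᶠ δ in 𝓝[>] (0 : ℝ), (∀ g ∈ (gaugeSymm F : Set (E3 ≃ₗᵢ[ℝ] E3)), g ≠ 1 →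
      2 * δ < dist (g u) u) ∧ δ < δ₀ ∧ r * δ < ρ / 2 := by
    have hlt : ∀ c : ℝ, ∀ d > 0, ∀ᶠ δ in 𝓝[>] (0 : ℝ), c * δ < d := by
      intro c d hd
      apply Filter.Eventually.filter_mono nhdsWithin_le_nhds
      have hc : ContinuousAt (fun δ : ℝ => c * δ) 0 := by fun_prop
      exact hc.eventually (gt_mem_nhds (by simpa using hd))
    refine Filter.Eventually.and ?_ (Filter.Eventually.and ?_ (hlt _ _ (by positivity)))
    · rw [Filter.eventually_all_finite hG]
      intro g hg
      by_cases hg1 : g = 1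
      · exact Filter.Eventually.of_forall fun _ h => absurd hg1 h
      · filter_upwards [hlt 2 _ (dist_pos.mpr (hfix g hg hg1))] with δ hδ _
        exact hδ
    · simpa using hlt 1 δ₀ hδ₀
  obtain ⟨δ, ⟨hδG, hδ1, hδ2⟩, hδ⟩ := (hsmall.and self_mem_nhdsWithin).exists
  refine ⟨τ, hτ, κ, hκ, δ, hδ, hτr, by linarith, hδG, fun v hv => ?_⟩
  have := hball v (Metric.ball_subset_ball hδ1.le hv)
  exact ⟨this.1.le, this.2.le⟩

/-- An isometry in a finite group leaving a symmetrized bump invariant belongs to the subgroup used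
for the symmetrization, provided the translates of the bump are disjoint. -/
theorem mem_of_symmBump_invariant {G H : Subgroup (E3 ≃ₗᵢ[ℝ] E3)} [Fintype H] (hHG : H ≤ G)
    {u : E3} (b : ContDiffBump u) {a : E3} {Q : Polynomial ℝ}
    (hsep : ∀ g ∈ G, g ≠ 1 → 2 * b.rOut < dist (g u) u) {v : E3}
    (hv : v ∈ Metric.ball u b.rOut) (hQ : polyBump b a Q v ≠ 0) {L : E3 ≃ₗᵢ[ℝ] E3} (hL : L ∈ G)
    (hinv : symmBump H b a Q (L v) = symmBump H b a Q v) : L ∈ H := by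
  -- An element keeping `v` in the ball moves `u` by less than the separation `2 * b.rOut`. Hence
  -- only the identity summand survives at `v`, and only one translate by `H` can be nonzero at `L
  -- v`.
  have key : ∀ g ∈ G, g v ∈ Metric.ball u b.rOut → g = 1 := by
    intro g hg hgv
    by_contra hg1
    have h1 := hsep g hg hg1
    have h2 : dist (g u) u ≤ dist (g u) (g v) + dist (g v) u := dist_triangle _ _ _
    rw [g.dist_map, dist_comm u v] at h2
    rw [Metric.mem_ball] at hv hgv
    linarith
  have hval : symmBump H b a Q v = polyBump b a Q v := by
    rw [symmBump, Fintype.sum_eq_single (1 : H)]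
    · rfl
    · intro h hh
      by_contra hne
      refine hh ?_
      have h1 : (h : E3 ≃ₗᵢ[ℝ] E3)⁻¹ v ∈ Metric.ball u b.rOut := by
        rw [← b.support_eq]
        exact left_ne_zero_of_mul hne
      have h2 := key _ (inv_mem (hHG h.2)) h1
      rw [inv_eq_one] at h2
      exact Subtype.ext h2
  rw [hval] at hinv
  obtain ⟨h, hh, hmem⟩ := exists_mem_of_symmBump_ne_zero H b a (x := L v) (Q := Q)
    (by rw [hinv]; exact hQ)
  have h3 : h⁻¹ * L = 1 := key _ (mul_mem (inv_mem (hHG hh)) hL) hmem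
  rw [inv_mul_eq_one] at h3
  exact h3 ▸ hh

/-- A compactly supported `C²` function has bounded values and derivative. -/
theorem exists_bound_of_hasCompactSupport {η : E3 → ℝ} (hη : ContDiff ℝ 2 η)
    (hc : HasCompactSupport η) :
    ∃ C, 0 ≤ C ∧ (∀ x, |η x| ≤ C) ∧ ∀ x, ‖fderiv ℝ η x‖ ≤ C := by
  obtain ⟨C₁, h₁⟩ := hη.continuous.bounded_above_of_compact_support hc
  obtain ⟨C₂, h₂⟩ := (hη.continuous_fderiv (by norm_num)).bounded_above_of_compact_support
    (hc.fderiv ℝ)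
  exact ⟨max C₁ C₂, ((norm_nonneg _).trans (h₁ 0)).trans (le_max_left _ _),
    fun x => (h₁ x).trans (le_max_left _ _), fun x => (h₂ x).trans (le_max_right _ _)⟩

/-- A small perturbation of a gauge that does not move the center of mass, creates no equilibria
and has a prescribed subgroup of the symmetry group as its symmetry group. -/
theorem IsQuarticGauge.exists_perturbation (hF : IsQuarticGauge F)
    (hE : (equilibriumSet F).Finite) (hmom : ∀ a, ∫ x in {x | F x ≤ 1}, inner ℝ a x = 0)
    {q : E3} (hq : F q = 1) {R m : ℝ} (hR : 0 < R) (hm : 0 < m)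
    (hC : ∀ y ∈ Metric.ball q R, ContDiffAt ℝ 2 F y)
    (hconv : ConvexOn ℝ (Metric.ball q R) (fun y => F y - m * ‖y‖ ^ 2))
    {H : Subgroup (E3 ≃ₗᵢ[ℝ] E3)} (hH : H ≤ gaugeSymm F) {ε : ℝ} (hε : 0 < ε) :
    ∃ η : E3 → ℝ, ContDiff ℝ 2 η ∧ ConvexOn ℝ Set.univ (fun x => F x - η x) ∧
      (∀ x, |η x| ≤ ε) ∧ η 0 = 0 ∧
      (∀ a, ∫ x in {x | F x - η x ≤ 1}, inner ℝ a x = 0) ∧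
      (∀ x ∈ tsupport η, DifferentiableAt ℝ F x ∧
        ∃ w, inner ℝ x w = 0 ∧ fderiv ℝ F x w ≠ 0 ∧ fderiv ℝ (fun y => F y - η y) x w ≠ 0) ∧
      ∀ L : E3 ≃ₗᵢ[ℝ] E3, L ∈ H ↔ ∀ x, F x - η x ≤ 1 ↔ F (L x) - η (L x) ≤ 1 := by
  have hG := hF.finite_gaugeSymm hE hmom
  have hHfin : (H : Set (E3 ≃ₗᵢ[ℝ] E3)).Finite := hG.subset hH
  have : Fintype H := hHfin.fintype
  obtain ⟨x₀, hx₀q, hx₀, hx₀E, hx₀fix⟩ := hF.exists_generic hE hG hq hR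
  obtain ⟨ρ, hρ, c, hc, hgood⟩ := hF.exists_goodBall hx₀ hx₀E hx₀q hC hconv
  have hx₀0 : x₀ ≠ 0 := by
    rintro rfl
    rw [hF.apply_zero] at hx₀
    norm_num at hx₀
  obtain ⟨r, hr, u, hu, rfl⟩ : ∃ r : ℝ, 0 < r ∧ ∃ u : E3, ‖u‖ = 1 ∧ x₀ = r • u := by
    have hn := norm_pos_iff.mpr hx₀0
    refine ⟨‖x₀‖, hn, ‖x₀‖⁻¹ • x₀, ?_, ?_⟩
    · rw [norm_smul, norm_inv, norm_norm, inv_mul_cancel₀ hn.ne']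
    · rw [smul_smul, mul_inv_cancel₀ hn.ne', one_smul]
  have hufix : ∀ g ∈ gaugeSymm F, g ≠ 1 → g u ≠ u := fun g hg hg1 h =>
    hx₀fix g hg hg1 (by rw [map_smul, h])
  rw [hF.smul r hr.le] at hx₀
  obtain ⟨τ, hτ, κ, hκ, δ, hδ, hτr, hτρ, hsep, hshell⟩ := hF.exists_shell hG hr hx₀ hufix hρ
  -- The bump `b` lives in the angular radius `δ`. The cutoff `θ` is one within `τ` of `r` and zero
  -- beyond `2 * τ`, so by `hτρ` the supports fit into the good balls.
  let b : ContDiffBump u := ⟨δ / 2, δ, half_pos hδ, half_lt_self hδ⟩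
  let θ : ContDiffBump r := ⟨τ, 2 * τ, hτ, by linarith⟩
  obtain ⟨a, ha, hua⟩ : ∃ a : E3, ‖a‖ = 1 ∧ inner ℝ a u = 0 := by
    obtain ⟨e, he⟩ := exists_frame hu
    exact ⟨e 1, e.norm_eq_one 1, by rw [← he]; exact e.inner_eq_zero (by decide)⟩
  have hDc : IsCompact {x | F x ≤ 1} := hF.isCompact_le_one
  -- One degree serves two purposes: these moments confine the symmetries of the new body to the old
  -- group, and `1 ≤ k` fixes the center of mass.
  obtain ⟨k, hk1, hk⟩ := hF.exists_momentSymm_le hG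
  obtain ⟨Q, hQ0, hQ⟩ := exists_polynomial_moment_eq_zero H b a hDc k
  set β := symmBump H b a Q with hβ
  have hβC : ContDiff ℝ 2 β := contDiff_symmBump H b a Q
  set η₀ := radialBump θ β with hη₀
  have hη₀C : ContDiff ℝ 2 η₀ := contDiff_radialBump θ hβC hτr
  have hts : tsupport η₀ ⊆ ⋃ h : H, Metric.closedBall ((h : E3 ≃ₗᵢ[ℝ] E3) (r • u))
      (2 * τ + r * δ) := tsupport_radialBump_symmBump_subset θ H b a Q hτr
  have hη₀c : HasCompactSupport η₀ :=
    (isCompact_iUnion fun h : H => isCompact_closedBall _ _).of_isClosed_subset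
      (isClosed_tsupport _) hts
  have hgoodx : ∀ x ∈ tsupport η₀, ∃ z, IsGoodBall F z ρ m c ∧ x ∈ Metric.ball z ρ := by
    intro x hx
    obtain ⟨h, hh⟩ := Set.mem_iUnion.mp (hts hx)
    exact ⟨_, hgood.symm (hH h.2), Metric.closedBall_subset_ball hτρ hh⟩
  obtain ⟨M, hM, hMconv⟩ := exists_convexOn_mul_norm_sq_sub hη₀C hη₀c
  obtain ⟨C, hC0, hCη, hCd⟩ := exists_bound_of_hasCompactSupport hη₀C hη₀c
  -- The bounds on `s` secure, in order: convexity, the exact shift of levels along rays, positivity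
  -- of the shifted levels, nonradial gradients, and smallness of `η`.
  obtain ⟨s, hs, hsM, hsκ, hs1, hsc, hsε⟩ : ∃ s : ℝ, 0 < s ∧ s * M ≤ m ∧ s * C < κ ∧ s * C < 1 ∧
      s * C ≤ c ∧ s * C ≤ ε := by
    have hlt : ∀ A : ℝ, ∀ d > 0, ∀ᶠ s in 𝓝[>] (0 : ℝ), s * A < d := by
      intro A d hd
      apply Filter.Eventually.filter_mono nhdsWithin_le_nhds
      have hc : ContinuousAt (fun s : ℝ => s * A) 0 := by fun_prop
      exact hc.eventually (gt_mem_nhds (by simpa using hd))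
    have hpos : ∀ᶠ s in 𝓝[>] (0 : ℝ), 0 < s := self_mem_nhdsWithin
    obtain ⟨s, hs, h1, h2, h3, h4, h5⟩ := (hpos.and
      ((hlt M m hm).and ((hlt C κ hκ).and ((hlt C 1 one_pos).and
        ((hlt C c hc).and (hlt C ε hε)))))).exists
    exact ⟨s, hs, h1.le, h2, h3, h4.le, h5.le⟩
  have hβbound : ∀ v : E3, ‖v‖ = 1 → |s * β v| ≤ s * C := by
    intro v hv
    rw [abs_mul, abs_of_pos hs]
    have h1 := hCη (r • v)
    rw [hη₀, radialBump_smul θ hv hr, θ.one_of_mem_closedBall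
      (Metric.mem_closedBall_self θ.rIn_pos.le), one_mul] at h1
    gcongr
  set η : E3 → ℝ := fun x => s * η₀ x with hη
  have hηC : ContDiff ℝ 2 η := contDiff_const.mul hη₀C
  have hηts : tsupport η ⊆ tsupport η₀ :=
    closure_mono fun x hx => right_ne_zero_of_mul hx
  have hηbound : ∀ x, |η x| ≤ s * C := by
    intro x
    rw [hη, abs_mul, abs_of_pos hs]
    exact mul_le_mul_of_nonneg_left (hCη x) hs.le
  set D' := {x | F x - η x ≤ 1} with hD'
  have hD'c : IsCompact D' := by
    obtain ⟨B, -, hB⟩ := hF.exists_bound 2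
    refine Metric.isCompact_of_isClosed_isBounded
      (isClosed_le (hF.continuous.sub hηC.continuous) continuous_const)
      (isBounded_iff_forall_norm_le.mpr ⟨B, fun x hx => hB x ?_⟩)
    have h1 : F x - η x ≤ 1 := hx
    linarith [(abs_le.mp (hηbound x)).2]
  have hpolar : ∀ v : E3, ‖v‖ = 1 → ∀ t : ℝ, 0 < t →
      (t • v ∈ D' ↔ t ^ 4 * F v ≤ 1 + s * β v) := by
    intro v hv t ht
    have hsupp : s * β v ≠ 0 → (r - τ) ^ 4 * F v ≤ 1 - κ ∧ 1 + κ ≤ (r + τ) ^ 4 * F v := by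
      intro h0
      obtain ⟨h, hh, hmem⟩ := exists_mem_of_symmBump_ne_zero H b a (right_ne_zero_of_mul h0)
      have h1 : F (h.symm v) = F v := (gaugeSymm F).inv_mem (hH hh) v
      rw [← h1]
      exact hshell _ hmem
    rw [← level_shift_iff θ (hF.nonneg v) ht (by change τ < r; linarith)
      ((hβbound v hv).trans_lt hsκ) (fun h => (hsupp h).1) (fun h => (hsupp h).2)]
    rw [hD', Set.mem_ofPred_eq, hF.smul t ht.le, hη]
    simp only [hη₀]
    rw [radialBump_smul θ hv ht, mul_assoc, mul_comm (β v)]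
  have hmomeq : ∀ P ∈ affineSpace ^ k, moment D' P = moment {x | F x ≤ 1} P := by
    intro P hP
    rw [hF.moment_perturb (β := fun x => s * β x) (continuous_const.mul hβC.continuous)
      (fun v hv => (hβbound v hv).trans hs1.le) hD'c hpolar P.continuous]
    have h1 : moment {x | F x ≤ 1} (fun x => P x * (s * β x)) = 0 := by
      have h2 : (fun x => P x * (s * β x)) = fun x => s * (P x * β x) := by
        ext x; ring
      rw [h2, moment_const_mul, hQ P hP, mul_zero]
    rw [h1, add_zero]
  refine ⟨η, hηC, ?_, fun x => (hηbound x).trans hsε, ?_, fun w => ?_, fun x hx => ?_,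
    fun L => ⟨fun hL x => ?_, fun hL => ?_⟩⟩
  · refine hF.convexOn_sub hηC.continuous (hMconv m s (by rwa [abs_of_pos hs])) fun x hx => ?_
    obtain ⟨z, hz, hxz⟩ := hgoodx x (hηts hx)
    obtain ⟨r', hr', hsub⟩ := Metric.isOpen_iff.mp Metric.isOpen_ball x hxz
    exact ⟨r', hr', hz.convex.subset hsub (convex_ball _ _)⟩
  · rw [hη]
    simp only [hη₀]
    rw [radialBump_eq_zero θ (by rw [norm_zero]; change 0 < r - 2 * τ; linarith), mul_zero]
  · rw [← moment_inner, ← hmom w, ← moment_inner]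
    exact hmomeq _ (polynomials_mono hk1 (by simpa using innerMap_mem w))
  · obtain ⟨z, hz, hxz⟩ := hgoodx x (hηts hx)
    obtain ⟨w, hw1, hw2⟩ := hz.slope x hxz
    have hd := hz.diff x hxz
    have hdη : DifferentiableAt ℝ η x := hηC.differentiable (by norm_num) x
    refine ⟨hd, w, hw1, ?_, ?_⟩
    · rw [← abs_pos]
      exact lt_of_le_of_lt (by positivity) hw2
    · have h1 : fderiv ℝ (fun y => F y - η y) x = fderiv ℝ F x - fderiv ℝ η x := fderiv_sub hd hdη
      have h2 : fderiv ℝ η x = s • fderiv ℝ η₀ x :=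
        fderiv_const_mul (hη₀C.differentiable (by norm_num) x) s
      rw [h1, sub_apply, sub_ne_zero]
      intro h3
      rw [h3, h2, smul_apply, smul_eq_mul, abs_mul, abs_of_pos hs] at hw2
      have h4 : |fderiv ℝ η₀ x w| ≤ C * ‖w‖ :=
        ((fderiv ℝ η₀ x).le_opNorm w).trans (mul_le_mul_of_nonneg_right (hCd x) (norm_nonneg w))
      have h5 : s * |fderiv ℝ η₀ x w| ≤ c * ‖w‖ := by
        calc s * |fderiv ℝ η₀ x w| ≤ s * (C * ‖w‖) := by gcongr
          _ = s * C * ‖w‖ := by ring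
          _ ≤ c * ‖w‖ := by gcongr
      linarith
  · have h1 : η (L x) = η x := by
      simp only [hη, hη₀, radialBump]
      rw [L.norm_map, ← map_smul, hβ, symmBump_symm b a Q hL]
    rw [h1, hH hL x]
  -- The unchanged moments put `L` into the old group. Then `F` is invariant, so equality of level
  -- sets along rays makes the bump itself invariant.
  · have hLG : L ∈ gaugeSymm F := hk (mem_momentSymm_of_moment_eq hmomeq hL)
    obtain ⟨v, hv, hvb, hv0⟩ := exists_polyBump_ne_zero b a hQ0 hu ha hua
    refine mem_of_symmBump_invariant hH b hsep hvb hv0 hLG ?_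
    have hLv : ‖L v‖ = 1 := by rw [L.norm_map, hv]
    have hFv : 0 < F v := hF.pos v (norm_ne_zero_iff.mp (by rw [hv]; norm_num))
    have h1 : s * β v = s * β (L v) := by
      refine eq_of_forall_level_iff hFv ((hβbound v hv).trans_lt hs1)
        ((hβbound _ hLv).trans_lt hs1) fun t ht => ?_
      have h2 := hpolar v hv t ht
      have h3 := hpolar (L v) hLv t ht
      rw [hLG v, ← map_smul] at h3
      rw [← h2, ← h3]
      exact hL _
    exact (mul_left_cancel₀ hs.ne' h1).symm

end Existence

/-! ### Sublevel sets of convex functions as bodies -/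

section SublevelBody

variable {f : E3 → ℝ} {x : E3}

theorem exists_lt_of_fderiv_neg (hd : DifferentiableAt ℝ f x) {v : E3} (hv : fderiv ℝ f x v < 0) :
    ∃ t : ℝ, 0 < t ∧ f (x + t • v) < f x := by
  have h1 : HasDerivAt (fun t : ℝ => f (x + t • v)) (fderiv ℝ f x v) 0 := by
    have h2 : HasDerivAt (fun t : ℝ => x + t • v) v 0 := by
      simpa using ((hasDerivAt_id (0 : ℝ)).smul_const v).const_add x
    have h3 : HasFDerivAt f (fderiv ℝ f x) (x + (0 : ℝ) • v) := by simpa using hd.hasFDerivAt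
    exact h3.comp_hasDerivAt 0 h2
  have h4 := h1.tendsto_slope_zero_right
  have hpos : ∀ᶠ t in 𝓝[>] (0 : ℝ), 0 < t := self_mem_nhdsWithin
  obtain ⟨t, ht, ht0⟩ := ((h4.eventually (gt_mem_nhds hv)).and hpos).exists
  refine ⟨t, ht0, ?_⟩
  simp only [zero_add, zero_smul, add_zero, smul_eq_mul] at ht
  have := (inv_mul_lt_iff₀ ht0).mp ht
  linarith

/-- Where the gradient is not radial, some point of the sublevel set violates the equilibrium
condition. -/
theorem exists_inner_pos_of_slope (hd : DifferentiableAt ℝ f x) (hx0 : x ≠ 0) {w : E3}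
    (hw : inner ℝ x w = 0) (hfw : fderiv ℝ f x w ≠ 0) :
    ∃ y, f y ≤ f x ∧ 0 < inner ℝ x (y - x) := by
  wlog hneg : fderiv ℝ f x w < 0 generalizing w
  · refine this (w := -w) (by rw [inner_neg_right, hw, neg_zero])
      (by rw [map_neg]; exact neg_ne_zero.mpr hfw) ?_
    rw [map_neg, neg_lt_zero]
    exact lt_of_le_of_ne (not_lt.mp hneg) hfw.symm
  -- Tilting `w` slightly outwards keeps it a direction of decrease and makes its pairing with `x`
  -- positive.
  have hc : ContinuousAt (fun e : ℝ => fderiv ℝ f x (w + e • x)) 0 := by fun_prop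
  have hev : ∀ᶠ e in 𝓝[>] (0 : ℝ), fderiv ℝ f x (w + e • x) < 0 :=
    Filter.Eventually.filter_mono nhdsWithin_le_nhds
      (hc.eventually (gt_mem_nhds (by simpa using hneg)))
  have hpos : ∀ᶠ t in 𝓝[>] (0 : ℝ), 0 < t := self_mem_nhdsWithin
  obtain ⟨e, he, he0⟩ := (hev.and hpos).exists
  obtain ⟨t, ht, hlt⟩ := exists_lt_of_fderiv_neg hd he
  refine ⟨_, hlt.le, ?_⟩
  have hn := norm_pos_iff.mpr hx0
  rw [add_sub_cancel_left, inner_smul_right, inner_add_right, hw, inner_smul_right,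
    real_inner_self_eq_norm_sq, zero_add]
  positivity

variable {K : ConvexBody E3} {p : E3}

/-- A sublevel body of a differentiable convex function has a unique normal. -/
theorem existsUnique_normal (hconv : ConvexOn ℝ Set.univ f) (hd : DifferentiableAt ℝ f x)
    (hx : f x = 1) (h0 : f 0 < 1) (hK : ∀ y, y ∈ K ↔ f (y - p) ≤ 1) :
    ∃! n, IsOuterUnitNormal K (x + p) n := by
  set g : E3 := (InnerProductSpace.toDual ℝ E3).symm (fderiv ℝ f x) with hg
  have hgv : ∀ v, inner ℝ g v = fderiv ℝ f x v := fun v => by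
    rw [hg, InnerProductSpace.toDual_symm_apply]
  have hg0 : g ≠ 0 := by
    intro h
    have h1 := fderiv_le_of_convexOn hconv hd 0
    rw [← hgv, h, inner_zero_left] at h1
    linarith
  have hgn : 0 < ‖g‖ := norm_pos_iff.mpr hg0
  refine ⟨‖g‖⁻¹ • g, ⟨?_, fun y hy => ?_⟩, fun n hn => ?_⟩
  · rw [norm_smul, norm_inv, norm_norm, inv_mul_cancel₀ hgn.ne']
  · have h1 := fderiv_le_of_convexOn hconv hd (y - p)
    have h2 := (hK y).mp hy
    rw [inner_smul_left, hgv]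
    have h3 : y - (x + p) = y - p - x := by abel
    rw [h3]
    exact mul_nonpos_of_nonneg_of_nonpos (by simp) (by linarith)
  · have key : ∀ v, inner ℝ g v < 0 → inner ℝ n v ≤ 0 := by
      intro v hv
      rw [hgv] at hv
      obtain ⟨t, ht, hlt⟩ := exists_lt_of_fderiv_neg hd hv
      have h1 := hn.2 (x + t • v + p) ((hK _).mpr (by rw [add_sub_cancel_right]; linarith))
      have h2 : x + t • v + p - (x + p) = t • v := by abel
      rw [h2, inner_smul_right] at h1
      exact nonpos_of_mul_nonpos_right h1 ht
    -- A normal is nonpositive on directions of decrease, and in the limit on the hyperplane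
    -- orthogonal to the gradient. Applied to its own component there, this makes the normal
    -- parallel to the gradient.
    have key' : ∀ v, inner ℝ g v = 0 → inner ℝ n v ≤ 0 := by
      intro v hv
      have h1 : ∀ᶠ e in 𝓝[>] (0 : ℝ), inner ℝ n (v - e • g) ≤ 0 := by
        have hpos : ∀ᶠ t in 𝓝[>] (0 : ℝ), 0 < t := self_mem_nhdsWithin
        filter_upwards [hpos] with e he
        refine key _ ?_
        rw [inner_sub_right, hv, inner_smul_right, real_inner_self_eq_norm_sq]
        have : 0 < e * ‖g‖ ^ 2 := by positivity
        linarith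
      have hc : ContinuousAt (fun e : ℝ => inner ℝ n (v - e • g)) 0 := by fun_prop
      have h2 := le_of_tendsto (hc.mono_left nhdsWithin_le_nhds) h1
      simpa using h2
    set c := inner ℝ n g / ‖g‖ ^ 2 with hc
    have horth : inner ℝ g (n - c • g) = 0 := by
      rw [inner_sub_right, inner_smul_right, real_inner_self_eq_norm_sq, real_inner_comm, hc]
      field_simp
      ring
    have hz : n - c • g = 0 := by
      have h1 := key' _ horth
      have h2 : inner ℝ (n - c • g) (n - c • g) ≤ 0 := by
        rw [inner_sub_left, inner_smul_left, horth, mul_zero, sub_zero]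
        exact h1
      exact inner_self_eq_zero.mp (le_antisymm h2 real_inner_self_nonneg)
    have hc0 : 0 ≤ c := by
      have h1 := key (-g) (by
        rw [inner_neg_right, real_inner_self_eq_norm_sq]
        have : 0 < ‖g‖ ^ 2 := by positivity
        linarith)
      rw [inner_neg_right] at h1
      exact div_nonneg (by linarith) (by positivity)
    rw [sub_eq_zero] at hz
    have h1 := hn.1
    rw [hz, norm_smul, Real.norm_of_nonneg hc0] at h1
    rw [hz, eq_inv_of_mul_eq_one_left h1]

theorem isometryAbout_mem_symmetryGroup_iff (hK : ∀ y, y ∈ K ↔ f (y - p) ≤ 1)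
    (L : E3 ≃ₗᵢ[ℝ] E3) :
    isometryAbout p L ∈ symmetryGroup K ↔ ∀ x, f x ≤ 1 ↔ f (L x) ≤ 1 := by
  have h1 : isometryAbout p L ∈ symmetryGroup K ↔ ∀ y, y ∈ K ↔ isometryAbout p L y ∈ K := by
    change isometryAbout p L '' (K : Set E3) = K ↔ _
    constructor
    · intro h y
      constructor
      · intro hy
        exact h.subset ⟨y, hy, rfl⟩
      · intro hy
        obtain ⟨z, hz, hzy⟩ := h.symm.subset hy
        rwa [← (isometryAbout p L).injective hzy]
    · intro h
      ext y
      constructor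
      · rintro ⟨z, hz, rfl⟩
        exact (h z).mp hz
      · intro hy
        refine ⟨(isometryAbout p L).symm y, (h _).mpr ?_, (isometryAbout p L).apply_symm_apply y⟩
        rw [(isometryAbout p L).apply_symm_apply]
        exact hy
  rw [h1]
  constructor
  · intro h x
    have := h (x + p)
    rwa [hK, hK, isometryAbout_apply, add_sub_cancel_right, add_sub_cancel_right] at this
  · intro h y
    rw [hK, hK, isometryAbout_apply, add_sub_cancel_right]
    exact h _

theorem setIntegral_inner_sub (hK : ∀ y, y ∈ K ↔ f (y - p) ≤ 1) (a : E3) :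
    inner ℝ a (∫ x in (K : Set E3), (x - p)) = ∫ x in {x | f x ≤ 1}, inner ℝ a x := by
  rw [← integral_inner (integrableOn_body K (by fun_prop))]
  have h1 : (K : Set E3) = (fun x => x - p) ⁻¹' {x | f x ≤ 1} := by
    ext y
    exact hK y
  rw [h1]
  exact (measurePreserving_sub_right volume p).setIntegral_preimage_emb
    (Homeomorph.subRight p).measurableEmbedding (fun x => inner ℝ a x) _

theorem frontier_subset_level (hf : Continuous f) (hK : ∀ y, y ∈ K ↔ f (y - p) ≤ 1) {q : E3}
    (hq : q ∈ frontier (K : Set E3)) : f (q - p) = 1 := by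
  have h1 : (K : Set E3) = {y | f (y - p) ≤ 1} := by
    ext y
    exact hK y
  rw [h1] at hq
  exact frontier_le_subset_eq (hf.comp (continuous_sub_right p)) continuous_const hq

end SublevelBody

/-! ### Assembly of the perturbed body -/

/-- By homogeneity a single sublevel set determines `F`: scale a point to level one and compare. -/
theorem IsQuarticGauge.mem_gaugeSymm_of_le_one_iff {F : E3 → ℝ} (hF : IsQuarticGauge F)
    {L : E3 ≃ₗᵢ[ℝ] E3} (hL : ∀ x, F x ≤ 1 ↔ F (L x) ≤ 1) : L ∈ gaugeSymm F := by
  intro x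
  rcases eq_or_ne x 0 with rfl | hx
  · rw [map_zero]
  have hx' : L x ≠ 0 := by simpa using hx
  apply le_antisymm
  · obtain ⟨t, ht, h1⟩ := hF.exists_smul_eq_one hx
    have h2 := (hL (t • x)).mp (by rw [hF.smul t ht.le, h1])
    rw [map_smul, hF.smul t ht.le, ← h1] at h2
    exact le_of_mul_le_mul_left h2 (by positivity)
  · obtain ⟨t, ht, h1⟩ := hF.exists_smul_eq_one hx'
    have h2 := (hL (t • x)).mpr (by rw [map_smul, hF.smul t ht.le, h1])
    rw [hF.smul t ht.le, ← h1] at h2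
    exact le_of_mul_le_mul_left h2 (by positivity)

/-- The sublevel bodies of a gauge and of a small perturbation of it are Hausdorff close. -/
theorem IsQuarticGauge.hausdorffDist_le {F η : E3 → ℝ} (hF : IsQuarticGauge F) {p : E3}
    {δ R : ℝ} (hδ : 0 < δ) (hδ1 : δ ≤ 1) (hη : ∀ x, |η x| ≤ δ) (hR0 : 0 ≤ R)
    (hR : ∀ x, F x ≤ 2 → ‖x‖ ≤ R) {K K' : Set E3} (hK : ∀ y, y ∈ K ↔ F (y - p) ≤ 1)
    (hK' : ∀ y, y ∈ K' ↔ F (y - p) - η (y - p) ≤ 1) : Metric.hausdorffDist K K' ≤ δ * R := by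
  have hpow : ∀ l : ℝ, 0 ≤ l → l ≤ 1 → l ^ 4 ≤ l := fun l h0 h1 =>
    pow_le_of_le_one h0 h1 (by norm_num)
  have hdist : ∀ y : E3, ∀ l : ℝ, dist y (l • (y - p) + p) = |1 - l| * ‖y - p‖ := by
    intro y l
    rw [dist_eq_norm, ← Real.norm_eq_abs, ← norm_smul]
    congr 1
    module
  refine Metric.hausdorffDist_le_of_mem_dist (by positivity) (fun y hy => ?_) fun y hy => ?_
  · rw [hK] at hy
    -- Shrinking by `1 - δ` lowers the level to at most `1 - δ`, which absorbs the perturbation;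
    -- conversely the factor `(1 + δ)⁻¹` compensates a level of `1 + δ`.
    refine ⟨(1 - δ) • (y - p) + p, ?_, ?_⟩
    · rw [hK', add_sub_cancel_right, hF.smul _ (by linarith)]
      have h1 := (abs_le.mp (hη ((1 - δ) • (y - p)))).1
      have h2 := hpow (1 - δ) (by linarith) (by linarith)
      have h3 : (1 - δ) ^ 4 * F (y - p) ≤ (1 - δ) ^ 4 :=
        mul_le_of_le_one_right (by positivity) hy
      linarith
    · rw [hdist, sub_sub_cancel, abs_of_pos hδ]
      have := hR _ (hy.trans one_le_two)
      gcongr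
  · rw [hK'] at hy
    have h1 : F (y - p) ≤ 1 + δ := by linarith [(abs_le.mp (hη (y - p))).2]
    have hl0 : 0 < (1 + δ)⁻¹ := by positivity
    have hl1 : (1 + δ)⁻¹ ≤ 1 := inv_le_one_of_one_le₀ (by linarith)
    have hl : (1 + δ)⁻¹ * (1 + δ) = 1 := inv_mul_cancel₀ (by positivity)
    refine ⟨(1 + δ)⁻¹ • (y - p) + p, ?_, ?_⟩
    · rw [hK, add_sub_cancel_right, hF.smul _ hl0.le]
      refine le_trans ?_ hl.le
      have := hpow _ hl0.le hl1
      have hnn := hF.nonneg (y - p)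
      gcongr
    · rw [hdist]
      have h2 : |1 - (1 + δ)⁻¹| ≤ δ := by
        rw [abs_of_nonneg (by linarith)]
        nlinarith
      have h3 := hR (y - p) (by linarith)
      gcongr

/-- At a point of positive Gaussian curvature the gauge is locally `C²` and strongly convex. -/
theorem exists_strongly_convex_ball {K : ConvexBody E3} (h : (interior (K : Set E3)).Nonempty)
    {q : E3} {κ : ℝ} (hκ : 0 < κ) (hq : HasGaussianCurvatureAt K q κ) :
    ∃ R > 0, ∃ m > 0, (∀ y ∈ Metric.ball (q - centerOfMass K) R,
      ContDiffAt ℝ 2 (quarticGauge K) y) ∧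
      ConvexOn ℝ (Metric.ball (q - centerOfMass K) R)
        (fun y => quarticGauge K y - m * ‖y‖ ^ 2) := by
  obtain ⟨φ, n, hφ, hn, hdet⟩ := hq
  have hdet0 : (secondForm φ n).det ≠ 0 := by
    intro h0
    rw [h0, zero_div] at hdet
    exact hκ.ne' hdet
  obtain ⟨m, hm, hpos⟩ := exists_pos_le_fderiv_fderiv h hφ hn hdet0
  obtain ⟨R, hR, h1, h2⟩ :=
    exists_ball_convexOn_sub_norm_sq (contDiffAt_quarticGauge h hφ hn) hm hpos
  exact ⟨R, hR, m, hm, h1, h2⟩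

theorem exists_body_with_symmetryGroup {S U : ℕ} (hS : 1 ≤ S) {K : ConvexBody E3}
    (hK : K ∈ classC S U) {ε : ℝ} (hε : 0 < ε) {H : Subgroup (E3 ≃ᵢ E3)}
    (hH : H ≤ symmetryGroup K) :
    ∃ K' ∈ classC S U, Metric.hausdorffDist (K : Set E3) (K' : Set E3) < ε ∧
      symmetryGroup K' = H := by
  have hint : (interior (K : Set E3)).Nonempty := hK.1.1
  set p := centerOfMass K with hp
  set F := quarticGauge K with hFdef
  have hF : IsQuarticGauge F := isQuarticGauge hint
  have hKF : ∀ y, y ∈ K ↔ F (y - p) ≤ 1 := fun y => mem_body_iff hint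
  have hE : (equilibriumSet F).Finite := by
    refine (hK.2.1.image fun q => q - p).subset fun x hx => ⟨x + p, ?_, add_sub_cancel_right x p⟩
    refine (isEquilibrium_iff hint).mpr ⟨?_, fun y hy => ?_⟩
    · rw [← quarticGauge_eq_one_iff hint, add_sub_cancel_right]
      exact hx.1
    · have := hx.2 (y - p) ((hKF y).mp hy)
      rwa [add_sub_cancel_right, ← sub_sub, sub_right_comm]
  have hmom : ∀ a, ∫ x in {x | F x ≤ 1}, inner ℝ a x = 0 := fun a => by
    rw [← setIntegral_inner_sub hKF a, setIntegral_sub_centerOfMass K hint, inner_zero_right]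
  -- Only an equilibrium is needed: its positive curvature supplies the ball of strong convexity.
  obtain ⟨q, hq⟩ : {q | IsStable K q}.Nonempty := by
    refine Set.nonempty_of_ncard_ne_zero ?_
    rw [hK.2.2.2.1]
    omega
  have hqE : IsEquilibrium K q := hq.1
  obtain ⟨κ, hκ, hcurv⟩ := (hK.2.2.1 q hqE).2
  obtain ⟨R, hR, m, hm, hC, hconv⟩ := exists_strongly_convex_ball hint hκ hcurv
  have hH₀ : H.comap (isometryAbout p) ≤ gaugeSymm F := fun L hL =>
    hF.mem_gaugeSymm_of_le_one_iff ((isometryAbout_mem_symmetryGroup_iff hKF L).mp (hH hL))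
  obtain ⟨B, hB, hBF⟩ := hF.exists_bound 2
  obtain ⟨δ, hδ, hδ1, hδB⟩ : ∃ δ : ℝ, 0 < δ ∧ δ ≤ 1 ∧ δ * B < ε := by
    refine ⟨min 1 (ε / (2 * B)), by positivity, min_le_left _ _, ?_⟩
    calc min 1 (ε / (2 * B)) * B ≤ ε / (2 * B) * B := by gcongr; exact min_le_right _ _
      _ = ε / 2 := by field_simp
      _ < ε := half_lt_self hε
  obtain ⟨η, hη, hfconv, hηδ, hη0, hfmom, hts, hsymm⟩ :=
    hF.exists_perturbation hE hmom ((quarticGauge_eq_one_iff hint).mpr hqE.1) hR hm hC hconv hH₀ hδ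
  set f : E3 → ℝ := fun x => F x - η x with hf
  have hfc : Continuous f := hF.continuous.sub hη.continuous
  have hf0 : f 0 < 1 := by simp [hf, hF.apply_zero, hη0]
  have hfsub : Continuous fun y => f (y - p) := hfc.comp (continuous_sub_right p)
  let K' : ConvexBody E3 :=
    { carrier := {y | f (y - p) ≤ 1}
      convex' := by
        have h1 := (hfconv.translate_left (-p)).convex_le 1
        simpa [sub_eq_add_neg] using h1
      isCompact' := by
        refine Metric.isCompact_of_isClosed_isBounded (isClosed_le hfsub continuous_const)
          (isBounded_iff_forall_norm_le.mpr ⟨B + ‖p‖, fun y hy => ?_⟩)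
        have h1 : F (y - p) - η (y - p) ≤ 1 := hy
        have h2 := hBF (y - p) (by linarith [(abs_le.mp (hηδ (y - p))).2])
        linarith [norm_le_norm_sub_add y p]
      nonempty' := ⟨p, by rw [Set.mem_ofPred_eq, sub_self]; exact hf0.le⟩ }
  have hK'f : ∀ y, y ∈ K' ↔ f (y - p) ≤ 1 := fun y => Iff.rfl
  have hint' : (interior (K' : Set E3)).Nonempty := by
    refine ⟨p, interior_maximal (s := (K' : Set E3)) (t := {y | f (y - p) < 1})
      (fun y hy => (hK'f y).mpr (le_of_lt hy)) (isOpen_lt hfsub continuous_const) ?_⟩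
    rw [Set.mem_ofPred_eq, sub_self]
    exact hf0
  have hcm : centerOfMass K' = p := by
    refine centerOfMass_eq K' hint' (ext_inner_left ℝ fun a => ?_)
    rw [setIntegral_inner_sub hK'f a, hfmom a, inner_zero_right]
  have hgerm : ∀ q, q - p ∉ tsupport η → ∀ᶠ y in 𝓝 q, y ∈ K ↔ y ∈ K' := by
    intro q hq
    have h1 : ContinuousAt (fun y => y - p) q := by fun_prop
    filter_upwards [h1.eventually ((isClosed_tsupport η).isOpen_compl.mem_nhds hq)] with y hy
    rw [hKF, hK'f, hf]
    simp only [image_eq_zero_of_notMem_tsupport hy, sub_zero]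
  refine ⟨K', mem_classC_of_germ hK hint' hcm (fun q hq => ?_) fun q hq => hgerm q fun hmem => ?_,
    ?_, ?_⟩
  -- On the support the perturbed function is differentiable with nonradial gradient, so the normal
  -- is unique and there is no equilibrium; elsewhere the germs agree.
  · by_cases hmem : q - p ∈ tsupport η
    · right
      obtain ⟨hd, w, hw, -, hfw⟩ := hts _ hmem
      have hdf : DifferentiableAt ℝ f (q - p) := hd.sub (hη.differentiable (by norm_num) _)
      have hval : f (q - p) = 1 := frontier_subset_level hfc hK'f hq
      constructor
      · have := existsUnique_normal hfconv hdf hval hf0 hK'f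
        rwa [sub_add_cancel] at this
      · intro heq
        have hx0 : q - p ≠ 0 := by
          intro h0
          rw [h0] at hval
          exact hf0.ne hval
        obtain ⟨y, hy, hpos⟩ := exists_inner_pos_of_slope hdf hx0 hw hfw
        have h1 := ((isEquilibrium_iff hint').mp heq).2 (y + p)
          ((hK'f _).mpr (by rw [add_sub_cancel_right, ← hval]; exact hy))
        have h2 : y + p - q = y - (q - p) := by abel
        rw [hcm, h2] at h1
        exact h1.not_gt hpos
    · exact Or.inl (hgerm q hmem)
  -- The gradient of the original `F` is nonradial there too, so the support contains no old
  -- equilibrium.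
  · obtain ⟨hd, w, hw, hFw, -⟩ := hts _ hmem
    have hval : F (q - p) = 1 := (quarticGauge_eq_one_iff hint).mpr hq.1
    have hx0 : q - p ≠ 0 := by
      intro h0
      rw [h0, hF.apply_zero] at hval
      norm_num at hval
    obtain ⟨y, hy, hpos⟩ := exists_inner_pos_of_slope hd hx0 hw hFw
    have h1 := ((isEquilibrium_iff hint).mp hq).2 (y + p)
      ((hKF _).mpr (by rw [add_sub_cancel_right, ← hval]; exact hy))
    have h2 : y + p - q = y - (q - p) := by abel
    rw [h2] at h1
    exact h1.not_gt hpos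
  · exact (hF.hausdorffDist_le hδ hδ1 hηδ hB.le hBF hKF hK'f).trans_lt hδB
  -- The two bodies share the center `p`, so isometries on either side fix it and come from linear
  -- ones, to which `hsymm` applies.
  · ext g
    constructor
    · intro hg
      have hgp := symmetry_apply_centerOfMass hint' hg
      rw [hcm] at hgp
      obtain ⟨L, rfl⟩ := exists_isometryAbout hgp
      exact (hsymm L).mpr ((isometryAbout_mem_symmetryGroup_iff hK'f L).mp hg)
    · intro hg
      obtain ⟨L, rfl⟩ := exists_isometryAbout (symmetry_apply_centerOfMass hint (hH hg))
      exact (isometryAbout_mem_symmetryGroup_iff hK'f L).mpr ((hsymm L).mp hg)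

end Equilibria

theorem proposition3 (S U : ℕ) (hS : 1 ≤ S) (hU : 1 ≤ U)
    (K : ConvexBody Equilibria.E3) (hK : K ∈ Equilibria.classC S U)
    (ε : ℝ) (hε : 0 < ε)
    (H : Subgroup (Equilibria.E3 ≃ᵢ Equilibria.E3)) (hH : H ≤ Equilibria.symmetryGroup K) :
    ∃ K' ∈ Equilibria.classC S U,
      Metric.hausdorffDist (K : Set Equilibria.E3) (K' : Set Equilibria.E3) < ε ∧
        Equilibria.symmetryGroup K' = H :=
  Equilibria.exists_body_with_symmetryGroup hS hK hε hH
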